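/- All representations are over $\mathbb C$; $\mathfrak S_V$ denotes the group of permutations of a finite set $V$. Let $G$ be a finite graph, loops and multiple edges allowed, with vertex set $V$ and edges enumerated $e_1,\dots,e_m$. The chromatic symmetric homology of $G$ is defined as follows. A state of $G$ is a set $F$ of edges; let $B_1,\dots,B_r$ be the vertex sets of the connected components of the spanning subgraph with edge set $F$, and let $b_k=|B_k|$. Let $\mathcal S^{(b-1,1)}$ be the standard representation of $\mathfrak S_b$ on the vectors of $\mathbb C^b$ with coordinate sum zero, let $\mathcal L_b=\bigwedge^*\mathcal S^{(b-1,1)}$, graded by exterior degree, and let $$\mathcal M_F=\mathrm{Ind}_{\mathfrak S_{B_1}\times\dots\times\mathfrak S_{B_r}}^{\mathfrak S_V}\left(\mathcal L_{b_1}\otimes\dots\otimes\mathcal L_{b_r}\right)=\mathrm{Ind}_{\mathfrak S_{B_1}\times\dots\times\mathfrak S_{B_r}}^{\mathfrak S_V}\left(\textstyle\bigwedge^* T_F\right),$$ where $T_F=\bigoplus_k \mathcal S^{(b_k-1,1)}$ is the space of functions $V\to\mathbb C$ whose sum over each $B_k$ is zero. For $i,j\ge 0$ put $C_{i,j}(G)=\bigoplus_{|F|=i}(\mathcal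 M_F)_j$. For $e\in F$ the per-edge map $\mathcal M_F\to\mathcal M_{F-e}$ is the morphism of graded $\mathfrak S_V$-modules which, under Frobenius reciprocity (induction from a subgroup being right adjoint to restriction) and induction in stages, corresponds to the map $\bigwedge^*T_F\to\bigwedge^*T_{F-e}$ induced by the projection $T_F\to T_{F-e}$ that subtracts from a function its mean over each component of $F-e$; it is the identity if removing $e$ does not change the components. The differential $d_{i,j}\colon C_{i,j}(G)\to C_{i-1,j}(G)$ (with $C_{-1,j}(G)=0$) is the sum over all pairs $e\in F$, $|F|=i$, of these maps multiplied by the sign $(-1)^k$, where $k$ is the number of edges not in $F$ that come after $e$ in the enumeration. Finally, $H_{i,j}(G)=\ker d_{i,j}/\operatorname{im} d_{i+1,j}$, a representation of $\mathfrak S_V$. **Proposition 3.3.** Let $A$ and $B$ be finite graphs with vertex sets $V_A$ and $V_B$, and let $A+B$ be their disjoint union, with vertex set $V_A\sqcup V_B$. Then, for any enumerations of the edges of $A$, of $B$ and of $A+B$, and for all $i,j\ge 0$, there is an isomorphism of representations of $\mathfrak S_{V_A\sqcup V_B}$ $$H_{i,j}(A+B)\;\cong\;\bigoplus_{\substack{p+r=i\\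 q+s=j}}\mathrm{Ind}_{\mathfrak S_{V_A}\times\mathfrak S_{V_B}}^{\mathfrak S_{V_A\sqcup V_B}}\bigl(H_{p,q}(A)\otimes H_{r,s}(B)\bigr),$$ where $p,q,r,s$ range over the non-negative integers and $\otimes$ is the external tensor product. -/

import Mathlib

open scoped DirectSum TensorProduct

/-- A multigraph (loops and multiple edges allowed) with vertex set `V` and edge set `E`:
every edge has an unordered pair of end points. -/
structure MultiGraph (V E : Type*) where
  ends : E → Sym2 V

namespace MultiGraph

noncomputable section

universe u v

/-- The disjoint union `A + B` of two multigraphs. -/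
def disjointUnion {VA VB EA EB : Type*} (A : MultiGraph VA EA) (B : MultiGraph VB EB) :
    MultiGraph (VA ⊕ VB) (EA ⊕ EB) where
  ends := Sum.elim (fun e => (A.ends e).map Sum.inl) (fun e => (B.ends e).map Sum.inr)

variable {V : Type u} {E : Type v} (G : MultiGraph V E)

/-- `G.SameComp F v w`: the vertices `v` and `w` lie in the same connected component of the state
`F`, i.e. of the spanning subgraph of `G` with edge set `F`. (Loops and multiplicities of edges
play no role for connectivity, so the underlying simple graph may be used.) -/
def SameComp (F : Finset E) (v w : V) : Prop :=
  (SimpleGraph.fromEdgeSet (G.ends '' (F : Set E))).Reachable v w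

theorem SameComp.refl (F : Finset E) (v : V) : G.SameComp F v v :=
  SimpleGraph.Reachable.refl v

variable {G} in
theorem SameComp.symm {F : Finset E} {v w : V} (h : G.SameComp F v w) : G.SameComp F w v :=
  SimpleGraph.Reachable.symm h

variable {G} in
theorem SameComp.trans {F : Finset E} {v w x : V} (h : G.SameComp F v w)
    (h' : G.SameComp F w x) : G.SameComp F v x :=
  SimpleGraph.Reachable.trans h h'

variable {G} in
theorem SameComp.mono {F F' : Finset E} (hF : F' ⊆ F) {v w : V} (h : G.SameComp F' v w) :
    G.SameComp F v w :=
  SimpleGraph.Reachable.mono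
    (SimpleGraph.fromEdgeSet_mono (Set.image_mono (Finset.coe_subset.2 hF))) h

/-- The Young subgroup `𝔖_{B₁} × ⋯ × 𝔖_{Bᵣ}` of `𝔖_V`, where `B₁, …, Bᵣ` are the connected
components of the state `F`: the permutations that map every component to itself. -/
def young (F : Finset E) : Subgroup (Equiv.Perm V) where
  carrier := {σ | ∀ v, G.SameComp F v (σ v)}
  mul_mem' {σ τ} hσ hτ v := (hτ v).trans (hσ (τ v))
  one_mem' v := SameComp.refl G F v
  inv_mem' {σ} hσ v := by
    have h := (hσ (σ⁻¹ v)).symm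
    have e : σ (σ⁻¹ v) = v := σ.apply_symm_apply v
    rwa [e] at h

theorem young_mono {F F' : Finset E} (hF : F' ⊆ F) : G.young F' ≤ G.young F :=
  fun _ hσ v => (hσ v).mono hF

/-- The permutation representation `ℂ^V` of `𝔖_V`: `(σ x)(v) = x (σ⁻¹ v)`. -/
def permRep (V : Type u) : Representation ℂ (Equiv.Perm V) (V → ℂ) where
  toFun σ := LinearMap.funLeft ℂ ℂ ⇑σ⁻¹
  map_one' := by ext; rfl
  map_mul' σ τ := by ext; rfl

/-- The `j`-th exterior power of a representation. -/
def extPowRep {H W : Type*} [Monoid H] [AddCommGroup W] [Module ℂ W]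
    (ρ : Representation ℂ H W) (j : ℕ) : Representation ℂ H (⋀[ℂ]^j W) where
  toFun h := exteriorPower.map j (ρ h)
  map_one' := by rw [map_one]; exact exteriorPower.map_id
  map_mul' g h := by rw [map_mul]; exact exteriorPower.map_comp (ρ h) (ρ g)

variable [Fintype V]

open Classical in
/-- The connected component of `v` in the state `F`. -/
def comp (F : Finset E) (v : V) : Finset V := Finset.univ.filter (G.SameComp F v)

theorem mem_comp {F : Finset E} {v w : V} : w ∈ G.comp F v ↔ G.SameComp F v w := by
  simp [comp]

variable {G} in
theorem comp_eq {F : Finset E} {v w : V} (h : G.SameComp F v w) : G.comp F v = G.comp F w := by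
  ext x
  simp only [mem_comp]
  exact ⟨h.symm.trans, h.trans⟩

theorem self_mem_comp (F : Finset E) (v : V) : v ∈ G.comp F v :=
  G.mem_comp.2 (SameComp.refl G F v)

/-- The space `T_F = 𝒮^{(b₁-1,1)} ⊕ ⋯ ⊕ 𝒮^{(bᵣ-1,1)}`, where `B₁, …, Bᵣ` are the connected
components of the state `F` and `bₖ = |Bₖ|`: the functions on `V` whose sum over each component
vanishes. Here `𝒮^{(b-1,1)}` is the standard representation of `𝔖_b` on the vectors of `ℂ^b` with
coordinate sum zero (it is the zero space for `b = 1`). -/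
def stdSpace (F : Finset E) : Submodule ℂ (V → ℂ) where
  carrier := {x | ∀ v, ∑ w ∈ G.comp F v, x w = 0}
  add_mem' hx hy v := by simp [Finset.sum_add_distrib, hx v, hy v]
  zero_mem' v := by simp
  smul_mem' c x hx v := by simp [← Finset.mul_sum, hx v]

/-- The representation of the Young subgroup of `F` on `T_F` by permutation of coordinates. -/
def stdRep (F : Finset E) : Representation ℂ (G.young F) (G.stdSpace F) :=
  Representation.subrepresentation ((permRep V).comp (G.young F).subtype) (G.stdSpace F)
    (by
      intro σ x hx v
      have hσ : ∀ w, G.SameComp F w ((σ : Equiv.Perm V) w) := σ.2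
      rw [← hx v]
      symm
      refine Finset.sum_equiv (σ : Equiv.Perm V) (fun w => ?_) (fun w _ => ?_)
      · simp only [mem_comp]
        exact ⟨fun h => h.trans (hσ w), fun h => h.trans (hσ w).symm⟩
      · change x w = x ((σ : Equiv.Perm V)⁻¹ ((σ : Equiv.Perm V) w))
        exact congrArg x ((σ : Equiv.Perm V).symm_apply_apply w).symm)

/-- The degree `j` part of the `𝔖_{B₁} × ⋯ × 𝔖_{Bᵣ}`-module `ℒ_{b₁} ⊗ ⋯ ⊗ ℒ_{bᵣ}`. As
`ℒ_b = ⋀^* 𝒮^{(b-1,1)} = ⨁ᵢ 𝒮^{(b-i,1^i)}`, the tensor product is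
`⋀^* (𝒮^{(b₁-1,1)} ⊕ ⋯ ⊕ 𝒮^{(bᵣ-1,1)}) = ⋀^* T_F`. -/
def youngRep (F : Finset E) (j : ℕ) : Representation ℂ (G.young F) (⋀[ℂ]^j (G.stdSpace F)) :=
  extPowRep (G.stdRep F) j

/-- The underlying space of the degree `j` part of
`ℳ_F = Ind_{𝔖_{B₁} × ⋯ × 𝔖_{Bᵣ}}^{𝔖_V} (ℒ_{b₁} ⊗ ⋯ ⊗ ℒ_{bᵣ})`. -/
def StateModule (F : Finset E) (j : ℕ) : Type u :=
  Representation.IndV (G.young F).subtype (G.youngRep F j)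

instance (F : Finset E) (j : ℕ) : AddCommGroup (G.StateModule F j) :=
  inferInstanceAs (AddCommGroup (Representation.IndV (G.young F).subtype (G.youngRep F j)))

instance (F : Finset E) (j : ℕ) : Module ℂ (G.StateModule F j) :=
  inferInstanceAs (Module ℂ (Representation.IndV (G.young F).subtype (G.youngRep F j)))

/-- The action of `𝔖_V` on the degree `j` part of `ℳ_F`. -/
def stateRep (F : Finset E) (j : ℕ) : Representation ℂ (Equiv.Perm V) (G.StateModule F j) :=
  Representation.ind (G.young F).subtype (G.youngRep F j)

open Classical in
/-- The canonical isomorphism between the induced module `ℳ_F` (in degree `j`) and the module of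
`𝔖_{B₁} × ⋯ × 𝔖_{Bᵣ}`-equivariant functions from `𝔖_V` to `ℒ_{b₁} ⊗ ⋯ ⊗ ℒ_{bᵣ}`. -/
def indEquivCoind (F : Finset E) (j : ℕ) :
    (G.stateRep F j).Equiv (Representation.coind (G.young F).subtype (G.youngRep F j)) :=
  .mk (.ofLinearMap (Rep.indToCoind (Rep.of (G.youngRep F j)))
      (Rep.coindToInd (Rep.of (G.youngRep F j)))
      (Rep.coindToInd_indToCoind _) (Rep.indToCoind_coindToInd _))
    (fun g => (Rep.indCoindIso (Rep.of (G.youngRep F j))).hom.hom.isIntertwining' g)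

/-- The linear map `ℂ^V → T_F` that subtracts from a function its mean over each component of `F`.
It is the identity on `T_F` and it kills the functions that are constant on every component. -/
def meanFree (F : Finset E) : (V → ℂ) →ₗ[ℂ] G.stdSpace F where
  toFun x := ⟨fun v => x v - ((G.comp F v).card : ℂ)⁻¹ * ∑ w ∈ G.comp F v, x w, fun v => by
    have h : ∀ w ∈ G.comp F v, x w - ((G.comp F w).card : ℂ)⁻¹ * ∑ z ∈ G.comp F w, x z
        = x w - ((G.comp F v).card : ℂ)⁻¹ * ∑ z ∈ G.comp F v, x z := by
      intro w hw
      rw [comp_eq (G.mem_comp.1 hw)]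
    have hc : ((G.comp F v).card : ℂ) ≠ 0 :=
      Nat.cast_ne_zero.2 (Finset.card_ne_zero_of_mem (G.self_mem_comp F v))
    rw [Finset.sum_congr rfl h, Finset.sum_sub_distrib, Finset.sum_const, nsmul_eq_mul,
      mul_inv_cancel_left₀ hc, sub_self]⟩
  map_add' x y := by
    ext v
    simp only [Pi.add_apply, Finset.sum_add_distrib, Submodule.coe_add]
    ring
  map_smul' c x := by
    ext v
    simp only [Pi.smul_apply, smul_eq_mul, ← Finset.mul_sum, SetLike.val_smul, RingHom.id_apply]
    ring

/-- `meanFree` is the identity on `T_F`. -/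
theorem meanFree_apply_of_mem (F : Finset E) (x : G.stdSpace F) : G.meanFree F x.1 = x := by
  ext v
  change x.1 v - ((G.comp F v).card : ℂ)⁻¹ * ∑ w ∈ G.comp F v, x.1 w = x.1 v
  rw [x.2 v]; simp

/-- `meanFree` kills the functions that are constant on every component of `F`. -/
theorem meanFree_eq_zero (F : Finset E) (x : V → ℂ)
    (hx : ∀ v w, G.SameComp F v w → x v = x w) : G.meanFree F x = 0 := by
  ext v
  change x v - ((G.comp F v).card : ℂ)⁻¹ * ∑ w ∈ G.comp F v, x w = 0
  have hc : ((G.comp F v).card : ℂ) ≠ 0 :=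
    Nat.cast_ne_zero.2 (Finset.card_ne_zero_of_mem (G.self_mem_comp F v))
  rw [Finset.sum_congr rfl (fun w hw => (hx v w (G.mem_comp.1 hw)).symm), Finset.sum_const,
    nsmul_eq_mul, inv_mul_cancel_left₀ hc, sub_self]

/-- The projection `T_F → T_{F'}` for states `F' ⊆ F`. If removing an edge `e` from `F` does not
disconnect a component, it is the identity of `T_F = T_{F - e}`. If it splits a component `A ∪ B`
into `A` and `B`, then, as modules over the smaller Young subgroup, `T_F = T_{F - e} ⊕ 𝟏`, and it
is the identity on `T_{F - e}` and zero on `𝟏`; hence the map induced on exterior algebras is the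
identity on `⋀^* T_{F - e}` and zero on `(⋀^* T_{F - e})[1]`. -/
def proj (F F' : Finset E) : G.stdSpace F →ₗ[ℂ] G.stdSpace F' :=
  G.meanFree F' ∘ₗ (G.stdSpace F).subtype

theorem proj_smul {F F' : Finset E} (hF : F' ⊆ F) (s : G.young F') (x : G.stdSpace F) :
    G.proj F F' (G.stdRep F ⟨s.1, G.young_mono hF s.2⟩ x) = G.stdRep F' s (G.proj F F' x) := by
  obtain ⟨σ, hσ⟩ := s
  have hσ' : ∀ w, G.SameComp F' w (σ w) := hσ
  ext v
  change x.1 (σ⁻¹ v) - ((G.comp F' v).card : ℂ)⁻¹ * ∑ w ∈ G.comp F' v, x.1 (σ⁻¹ w)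
    = x.1 (σ⁻¹ v) - ((G.comp F' (σ⁻¹ v)).card : ℂ)⁻¹ * ∑ w ∈ G.comp F' (σ⁻¹ v), x.1 w
  have hv : G.SameComp F' (σ⁻¹ v) v := by
    simpa using hσ' (σ⁻¹ v)
  rw [comp_eq hv]
  congr 2
  refine Finset.sum_equiv σ⁻¹ (fun w => ?_) (fun w _ => rfl)
  have hw : G.SameComp F' (σ⁻¹ w) w := by
    simpa using hσ' (σ⁻¹ w)
  simp only [mem_comp]
  exact ⟨fun h => h.trans hw.symm, fun h => h.trans hw⟩

theorem proj_comp {F F' F'' : Finset E} (h' : F'' ⊆ F') :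
    G.proj F' F'' ∘ₗ G.proj F F' = G.proj F F'' := by
  ext1 x
  change G.meanFree F'' (G.meanFree F' x.1).1 = G.meanFree F'' x.1
  rw [← sub_eq_zero, ← map_sub]
  refine G.meanFree_eq_zero F'' _ fun v w h => ?_
  change (x.1 v - ((G.comp F' v).card : ℂ)⁻¹ * ∑ z ∈ G.comp F' v, x.1 z) - x.1 v
    = (x.1 w - ((G.comp F' w).card : ℂ)⁻¹ * ∑ z ∈ G.comp F' w, x.1 z) - x.1 w
  rw [comp_eq (h.mono h')]
  ring

/-- The `𝔖_V`-morphism between modules of equivariant functions that is given by composition with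
`⋀^j T_F → ⋀^j T_{F'}`, for states `F' ⊆ F`. -/
def coindMap {F F' : Finset E} (hF : F' ⊆ F) (j : ℕ) :
    (Representation.coind (G.young F).subtype (G.youngRep F j)).IntertwiningMap
      (Representation.coind (G.young F').subtype (G.youngRep F' j)) where
  toLinearMap :=
    ((exteriorPower.map j (G.proj F F')).compLeft (Equiv.Perm V)).restrict (by
      intro f hf s h
      have h1 : f (s.1 * h) = G.youngRep F j ⟨s.1, G.young_mono hF s.2⟩ (f h) :=
        hf ⟨s.1, G.young_mono hF s.2⟩ h
      change exteriorPower.map j (G.proj F F') (f (s.1 * h))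
        = exteriorPower.map j (G.stdRep F' s) (exteriorPower.map j (G.proj F F') (f h))
      rw [h1]
      change exteriorPower.map j (G.proj F F')
        (exteriorPower.map j (G.stdRep F ⟨s.1, G.young_mono hF s.2⟩) (f h)) = _
      rw [← LinearMap.comp_apply, ← LinearMap.comp_apply, ← exteriorPower.map_comp,
        ← exteriorPower.map_comp]
      congr 2
      ext1 x
      exact G.proj_smul hF s x)
  isIntertwining' g := by ext; rfl

/-- The per-edge map `ℳ_F → ℳ_{F'}` in degree `j`, for states `F' ⊆ F` (used for `F' = F - e`).
Under Frobenius reciprocity (induction from a subgroup of a finite group is right adjoint to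
restriction, through `indEquivCoind`), and with induction in stages, it is the map induced from
`⋀^* T_F → ⋀^* T_{F'}`. In particular it is the identity if `F` and `F'` have the same components.
-/
def edgeMap {F F' : Finset E} (hF : F' ⊆ F) (j : ℕ) :
    (G.stateRep F j).IntertwiningMap (G.stateRep F' j) :=
  ((G.indEquivCoind F' j).symm.toIntertwiningMap.comp (G.coindMap hF j)).comp
    (G.indEquivCoind F j).toIntertwiningMap

theorem edgeMap_comp {F F' F'' : Finset E} (h : F' ⊆ F) (h' : F'' ⊆ F') (j : ℕ)
    (y : G.StateModule F j) :
    G.edgeMap h' j (G.edgeMap h j y) = G.edgeMap (h'.trans h) j y := by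
  change (G.indEquivCoind F'' j).symm (G.coindMap h' j ((G.indEquivCoind F' j)
    ((G.indEquivCoind F' j).symm (G.coindMap h j (G.indEquivCoind F j y))))) =
    (G.indEquivCoind F'' j).symm (G.coindMap (h'.trans h) j (G.indEquivCoind F j y))
  rw [Representation.Equiv.apply_symm_apply]
  congr 1
  ext1
  funext g
  change exteriorPower.map j (G.proj F' F'') (exteriorPower.map j (G.proj F F') _) =
    exteriorPower.map j (G.proj F F'') _
  rw [← LinearMap.comp_apply, ← exteriorPower.map_comp, G.proj_comp h']

/-- The underlying space of the chain module `C_{i,j}(G) = ⨁_{|F| = i} (ℳ_F)_j`. -/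
abbrev Chain (i j : ℕ) : Type (max u v) :=
  ⨁ F : {F : Finset E // F.card = i}, G.StateModule F.1 j

/-- The action of `𝔖_V` on `C_{i,j}(G)`. -/
def chainRep (i j : ℕ) : Representation ℂ (Equiv.Perm V) (G.Chain i j) :=
  Representation.directSum fun F : {F : Finset E // F.card = i} => G.stateRep F.1 j

variable [DecidableEq E]

theorem lof_edgeMap_congr (k j : ℕ) {F S S' : Finset E} (hSS : S = S') (hS : S ⊆ F)
    (hS' : S' ⊆ F) (c : S.card = k) (c' : S'.card = k) (y : G.StateModule F j) :
    DirectSum.lof ℂ {F' : Finset E // F'.card = k} (fun F' => G.StateModule F'.1 j) ⟨S, c⟩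
        (G.edgeMap hS j y) =
      DirectSum.lof ℂ {F' : Finset E // F'.card = k} (fun F' => G.StateModule F'.1 j) ⟨S', c'⟩
        (G.edgeMap hS' j y) := by
  subst hSS; rfl

variable [Fintype E]

/-- The sign of the per-edge map `ℳ_F → ℳ_{F - e}` with respect to the enumeration
`num` of the edges: `(-1)^k`, where `k` is the number of edges after `e` that are not in `F`. -/
def edgeSign (num : E ≃ Fin (Fintype.card E)) (F : Finset E) (e : E) : ℂ :=
  (-1) ^ (Finset.univ.filter fun f : E => f ∉ F ∧ num e < num f).card

theorem edgeSign_erase (num : E ≃ Fin (Fintype.card E)) (F : Finset E) {e f : E} (he : e ∈ F) :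
    edgeSign num (F.erase e) f = (if num f < num e then -1 else 1) * edgeSign num F f := by
  unfold edgeSign
  split_ifs with h
  · have : (Finset.univ.filter fun x : E => x ∉ F.erase e ∧ num f < num x)
        = insert e (Finset.univ.filter fun x : E => x ∉ F ∧ num f < num x) := by
      ext x
      by_cases hx : x = e
      · subst hx; simp [h]
      · simp [hx]
    rw [this, Finset.card_insert_of_notMem (by simp [he]), pow_succ]
    ring
  · rw [one_mul]
    congr 2
    ext x
    by_cases hx : x = e
    · subst hx; simp [h]
    · simp [hx]

theorem edgeSign_anticomm (num : E ≃ Fin (Fintype.card E)) (F : Finset E) {e f : E}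
    (he : e ∈ F) (hf : f ∈ F) (hef : e ≠ f) :
    edgeSign num F e * edgeSign num (F.erase e) f
      = -(edgeSign num F f * edgeSign num (F.erase f) e) := by
  rw [edgeSign_erase num F he, edgeSign_erase num F hf]
  rcases lt_or_gt_of_ne (num.injective.ne hef) with h | h
  · simp [h, h.not_gt]; ring
  · simp [h, h.not_gt]; ring

/-- The differential `d_{i,j} : C_{i,j}(G) → C_{i-1,j}(G)`: on `ℳ_F` it is the sum over `e ∈ F` of
the signed per-edge maps `ℳ_F → ℳ_{F - e}`. For `i = 0` this is the zero map (there is no `e ∈ F`),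
so that the truncated subtraction does no harm. -/
def diff (num : E ≃ Fin (Fintype.card E)) (i j : ℕ) : G.Chain i j →ₗ[ℂ] G.Chain (i - 1) j :=
  DirectSum.toModule ℂ _ _ fun F =>
    ∑ e : {e : E // e ∈ F.1},
      edgeSign num F.1 e.1 •
        (DirectSum.lof ℂ {F' : Finset E // F'.card = i - 1} (fun F' => G.StateModule F'.1 j)
            ⟨F.1.erase e.1, by rw [Finset.card_erase_of_mem e.2, F.2]⟩ ∘ₗ
          (G.edgeMap (Finset.erase_subset e.1 F.1) j).toLinearMap)

theorem diff_comm (num : E ≃ Fin (Fintype.card E)) (i j : ℕ) (σ : Equiv.Perm V)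
    (x : G.Chain i j) :
    G.diff num i j (G.chainRep i j σ x) = G.chainRep (i - 1) j σ (G.diff num i j x) := by
  suffices h : G.diff num i j ∘ₗ G.chainRep i j σ = G.chainRep (i - 1) j σ ∘ₗ G.diff num i j from
    LinearMap.congr_fun h x
  refine DirectSum.linearMap_ext ℂ fun F => LinearMap.ext fun y => ?_
  simp only [LinearMap.comp_apply, diff, chainRep, Representation.directSum_apply,
    DirectSum.lmap_lof, DirectSum.toModule_lof, LinearMap.sum_apply, LinearMap.smul_apply, map_sum,
    map_smul]
  refine Finset.sum_congr rfl fun e _ => ?_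
  congr 2
  exact LinearMap.congr_fun
    ((G.edgeMap (Finset.erase_subset e.1 F.1) j).isIntertwining' σ) y

theorem diff_lof (num : E ≃ Fin (Fintype.card E)) (k j : ℕ) (F : {F : Finset E // F.card = k})
    (y : G.StateModule F.1 j) :
    G.diff num k j (DirectSum.lof ℂ _ (fun F' : {F : Finset E // F.card = k} =>
        G.StateModule F'.1 j) F y) = ∑ e : {e : E // e ∈ F.1}, edgeSign num F.1 e.1 •
        DirectSum.lof ℂ {F' : Finset E // F'.card = k - 1} (fun F' => G.StateModule F'.1 j)
            ⟨F.1.erase e.1, by rw [Finset.card_erase_of_mem e.2, F.2]⟩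
            (G.edgeMap (Finset.erase_subset e.1 F.1) j y) := by
  simp only [diff, DirectSum.toModule_lof, LinearMap.sum_apply, LinearMap.smul_apply,
    LinearMap.comp_apply]
  rfl

/-- `d ∘ d = 0`. -/
theorem diff_diff (num : E ≃ Fin (Fintype.card E)) (k j : ℕ) (x : G.Chain k j) :
    G.diff num (k - 1) j (G.diff num k j x) = 0 := by
  suffices h : G.diff num (k - 1) j ∘ₗ G.diff num k j = 0 from LinearMap.congr_fun h x
  refine DirectSum.linearMap_ext ℂ fun F => LinearMap.ext fun y => ?_
  simp only [LinearMap.comp_apply, LinearMap.zero_apply]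
  have h2 : ∀ e : {e : E // e ∈ F.1}, G.diff num (k - 1) j
        (DirectSum.lof ℂ {F' : Finset E // F'.card = k - 1} (fun F' => G.StateModule F'.1 j)
            ⟨F.1.erase e.1, by rw [Finset.card_erase_of_mem e.2, F.2]⟩
            (G.edgeMap (Finset.erase_subset e.1 F.1) j y)) =
      ∑ f : {f : E // f ∈ F.1.erase e.1}, edgeSign num (F.1.erase e.1) f.1 •
        DirectSum.lof ℂ {F' : Finset E // F'.card = k - 1 - 1} (fun F' => G.StateModule F'.1 j)
          ⟨(F.1.erase e.1).erase f.1, by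
            rw [Finset.card_erase_of_mem f.2, Finset.card_erase_of_mem e.2, F.2]⟩
          (G.edgeMap ((Finset.erase_subset f.1 _).trans (Finset.erase_subset e.1 F.1)) j y) := by
    intro e
    refine (G.diff_lof num (k - 1) j ⟨F.1.erase e.1, _⟩ _).trans ?_
    refine Finset.sum_congr rfl fun f _ => ?_
    rw [← G.edgeMap_comp (Finset.erase_subset e.1 F.1) (Finset.erase_subset f.1 (F.1.erase e.1)) j y]
  simp only [diff_lof, map_sum, map_smul]
  rw [Finset.sum_congr rfl fun e _ => congrArg _ (h2 e)]
  simp only [Finset.smul_sum, smul_smul]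
  rw [Finset.sum_sigma']
  refine Finset.sum_involution
    (fun p _ => ⟨⟨p.2.1, Finset.mem_of_mem_erase p.2.2⟩,
      ⟨p.1.1, Finset.mem_erase.2 ⟨(Finset.ne_of_mem_erase p.2.2).symm, p.1.2⟩⟩⟩) ?_ ?_ ?_ ?_
  · rintro ⟨⟨e, he⟩, ⟨f, hf⟩⟩ _
    have hf' := Finset.mem_of_mem_erase hf
    have hne := (Finset.ne_of_mem_erase hf).symm
    dsimp only
    rw [edgeSign_anticomm num F.1 he hf' hne, neg_smul, neg_add_eq_zero]
    congr 1
    exact G.lof_edgeMap_congr _ _ Finset.erase_right_comm _ _ _ _ _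
  · rintro ⟨⟨e, he⟩, ⟨f, hf⟩⟩ _ _ h
    have h1 : f = e := congrArg (fun p => p.1.1) h
    exact Finset.ne_of_mem_erase hf h1
  · intros; simp
  · intros; rfl

/-- The cycles `ker d_{i,j}`. -/
abbrev cycles (num : E ≃ Fin (Fintype.card E)) (i j : ℕ) : Submodule ℂ (G.Chain i j) :=
  LinearMap.ker (G.diff num i j)

/-- The boundaries `im d_{i+1,j}`. -/
abbrev boundaries (num : E ≃ Fin (Fintype.card E)) (i j : ℕ) : Submodule ℂ (G.Chain i j) :=
  LinearMap.range (G.diff num (i + 1) j)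

/-- The chromatic symmetric homology `H_{i,j}(G) = ker d_{i,j} / im d_{i+1,j}`. -/
abbrev Homology (num : E ≃ Fin (Fintype.card E)) (i j : ℕ) : Type (max u v) :=
  G.cycles num i j ⧸ (G.boundaries num i j).submoduleOf (G.cycles num i j)

/-- The action of `𝔖_V` on `ker d_{i,j}`. -/
def cyclesRep (num : E ≃ Fin (Fintype.card E)) (i j : ℕ) :
    Representation ℂ (Equiv.Perm V) (G.cycles num i j) :=
  (G.chainRep i j).subrepresentation (G.cycles num i j) (by
    intro σ x hx
    rw [LinearMap.mem_ker] at hx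
    rw [Submodule.mem_comap, LinearMap.mem_ker, diff_comm, hx, map_zero])

/-- The action of `𝔖_V` on `H_{i,j}(G)`. -/
def homologyRep (num : E ≃ Fin (Fintype.card E)) (i j : ℕ) :
    Representation ℂ (Equiv.Perm V) (G.Homology num i j) :=
  (G.cyclesRep num i j).quotient _ (by
    rintro σ x ⟨y, hy⟩
    exact ⟨G.chainRep (i + 1) j σ y, (G.diff_comm num (i + 1) j σ y).trans
      (congrArg (G.chainRep i j σ) hy)⟩)

end

end MultiGraph

/-- The external tensor product of representations `ρ` of `H` and `τ` of `K`, a representation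
of `H × K`. -/
noncomputable def extTensorRep {H K X Y : Type*} [Monoid H] [Monoid K] [AddCommGroup X]
    [Module ℂ X] [AddCommGroup Y] [Module ℂ Y] (ρ : Representation ℂ H X)
    (τ : Representation ℂ K Y) : Representation ℂ (H × K) (X ⊗[ℂ] Y) :=
  Representation.tprod (ρ.comp (MonoidHom.fst H K)) (τ.comp (MonoidHom.snd H K))

/-! This is an equivariant Künneth theorem for a complex that is an induced tensor product. No edge
joins the two halves of `A + B`. So a state is a pair `F = F_A ⊔ F_B`, its Young subgroup is the
product of those of `F_A` and `F_B` inside `𝔖_{V_A} × 𝔖_{V_B}`, and `T_F = T_{F_A} ⊕ T_{F_B}`.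
Therefore `⋀^j T_F` is the sum over `q + s = j` of `⋀^q T_{F_A} ⊗ ⋀^s T_{F_B}`
(`wedge_sum_bijective`), and induction in stages turns `ℳ_F` into the module induced from `ℳ_{F_A} ⊗
ℳ_{F_B}`. The edge projections respect these decompositions. Up to signs, the complex of `A + B` is
thus induced from the tensor product of the complexes of `A` and `B`; the isomorphism is `assemble`.

The signs depend on three unrelated enumerations. In both differentials the squares of the cube of
states anticommute, so the ratio of the two sign rules is a multiplicative 1-cocycle on the cube. It
is a coboundary (`exists_sign_potential`), and rescaling the summand of each state by the potential
`η` removes the discrepancy.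

Over `ℂ` a complex of representations of a finite group retracts equivariantly onto its homology: a
linear generalized inverse of the differential is averaged over the group, and its part of degree
`+1` gives a homotopy (`nonempty_contraction`). Two such contractions have a tensor product
(`tensorDiff_tensorHomotopy`). Being equivariant, it passes to coinduced modules, where it gives
mutually orthogonal split embeddings of the Künneth summands into the homology of `A + B` that
together span it.

Induction is replaced throughout by coinduction, i.e. by equivariant functions, so that maps are
checked pointwise. All homological degrees are kept in one module `totalChain` with an endomorphism
as differential; this avoids the truncated index `i - 1`. -/

/-- The pairs of natural numbers with sum `j`. -/
abbrev Splitting (j : ℕ) : Type := {a : ℕ × ℕ // a ∈ Finset.HasAntidiagonal.antidiagonal j}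

theorem Splitting.add_eq {j : ℕ} (a : Splitting j) : a.1.1 + a.1.2 = j :=
  Finset.HasAntidiagonal.mem_antidiagonal.1 a.2

/-! ### Exterior powers of a direct sum -/

section Wedge

variable {R : Type*} [CommRing R] {U W M N : Type*} [AddCommGroup U] [Module R U]
  [AddCommGroup W] [Module R W] [AddCommGroup M] [Module R M] [AddCommGroup N] [Module R N]

theorem exteriorPower.coe_map {n : ℕ} (f : M →ₗ[R] N) (x : ⋀[R]^n M) :
    (exteriorPower.map n f x : ExteriorAlgebra R N) = ExteriorAlgebra.map f x := by
  suffices h : (⋀[R]^n N).subtype ∘ₗ exteriorPower.map n f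
      = (ExteriorAlgebra.map f).toLinearMap ∘ₗ (⋀[R]^n M).subtype from LinearMap.congr_fun h x
  ext m
  simp

/-- The linear map `⋀^q U ⊗ ⋀^s W → ⋀^(q+s) M` that sends `a ⊗ b` to `f(a) ∧ g(b)`. -/
noncomputable def wedge {q s j : ℕ} (h : q + s = j) (f : U →ₗ[R] M) (g : W →ₗ[R] M) :
    (⋀[R]^q U) ⊗[R] (⋀[R]^s W) →ₗ[R] ⋀[R]^j M :=
  (LinearMap.mul' R (ExteriorAlgebra R M) ∘ₗ
    TensorProduct.map ((⋀[R]^q M).subtype ∘ₗ exteriorPower.map q f)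
      ((⋀[R]^s M).subtype ∘ₗ exteriorPower.map s g)).codRestrict _ (by
    intro t
    induction t using TensorProduct.induction_on with
    | zero => simp
    | add x y hx hy => rw [map_add]; exact add_mem hx hy
    | tmul a b =>
      subst h
      simp only [ExteriorAlgebra.exteriorPower, pow_add]
      exact Submodule.mul_mem_mul (exteriorPower.map q f a).2 (exteriorPower.map s g b).2)

theorem coe_wedge_tmul {q s j : ℕ} (h : q + s = j) (f : U →ₗ[R] M) (g : W →ₗ[R] M)
    (a : ⋀[R]^q U) (b : ⋀[R]^s W) :
    (wedge h f g (a ⊗ₜ b) : ExteriorAlgebra R M)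
      = ExteriorAlgebra.map f a.1 * ExteriorAlgebra.map g b.1 := by
  rw [← exteriorPower.coe_map, ← exteriorPower.coe_map]
  rfl

theorem map_wedge {q s j : ℕ} (h : q + s = j) (f : U →ₗ[R] M) (g : W →ₗ[R] M) (k : M →ₗ[R] N)
    (t : (⋀[R]^q U) ⊗[R] (⋀[R]^s W)) :
    exteriorPower.map j k (wedge h f g t) = wedge h (k ∘ₗ f) (k ∘ₗ g) t := by
  induction t using TensorProduct.induction_on with
  | zero => simp
  | add x y hx hy => simp only [map_add, hx, hy]
  | tmul a b =>
    apply Subtype.ext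
    rw [exteriorPower.coe_map, coe_wedge_tmul, coe_wedge_tmul, map_mul, ← AlgHom.comp_apply,
      ← AlgHom.comp_apply, ExteriorAlgebra.map_comp_map, ExteriorAlgebra.map_comp_map]

theorem wedge_map {U' W' : Type*} [AddCommGroup U'] [Module R U'] [AddCommGroup W'] [Module R W']
    {q s j : ℕ} (h : q + s = j) (f : U →ₗ[R] M) (g : W →ₗ[R] M) (k : U' →ₗ[R] U)
    (l : W' →ₗ[R] W) (t : (⋀[R]^q U') ⊗[R] (⋀[R]^s W')) :
    wedge h f g (TensorProduct.map (exteriorPower.map q k) (exteriorPower.map s l) t)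
      = wedge h (f ∘ₗ k) (g ∘ₗ l) t := by
  induction t using TensorProduct.induction_on with
  | zero => simp
  | add x y hx hy => simp only [map_add, hx, hy]
  | tmul a b =>
    apply Subtype.ext
    rw [TensorProduct.map_tmul, coe_wedge_tmul, coe_wedge_tmul, exteriorPower.coe_map,
      exteriorPower.coe_map, ← AlgHom.comp_apply, ← AlgHom.comp_apply,
      ExteriorAlgebra.map_comp_map, ExteriorAlgebra.map_comp_map]

/-- Vectors anticommute in the exterior algebra, and a submodule absorbs the sign. So the two
submodules of degree one elements commute, and the binomial theorem applies to them in the semiring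
of submodules. -/
theorem ExteriorAlgebra.range_mul_range_le (f : U →ₗ[R] M) (g : W →ₗ[R] M) :
    LinearMap.range (ι R ∘ₗ f) * LinearMap.range (ι R ∘ₗ g)
      ≤ LinearMap.range (ι R ∘ₗ g) * LinearMap.range (ι R ∘ₗ f) := by
  rw [Submodule.mul_le]
  rintro _ ⟨x, rfl⟩ _ ⟨y, rfl⟩
  have h : ι R (f x) * ι R (g y) = -(ι R (g y) * ι R (f x)) :=
    eq_neg_of_add_eq_zero_left (ι_add_mul_swap (f x) (g y))
  rw [LinearMap.comp_apply, LinearMap.comp_apply, h]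
  exact neg_mem (Submodule.mul_mem_mul ⟨y, rfl⟩ ⟨x, rfl⟩)

theorem ExteriorAlgebra.map_exteriorPower (q : ℕ) (f : U →ₗ[R] M) :
    (⋀[R]^q U).map (ExteriorAlgebra.map f).toLinearMap = LinearMap.range (ι R ∘ₗ f) ^ q := by
  rw [ExteriorAlgebra.exteriorPower, Submodule.map_pow, ← LinearMap.range_comp]
  congr 2
  ext; simp

/-- `⋀^j M` is the `j`-th power of the submodule of vectors, which is the sum of the images of `U`
and `W`; the binomial theorem for commuting submodules expands this power into the products of `⋀^q`
and `⋀^s`. -/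
theorem wedge_sum_surjective (j : ℕ) (f : U →ₗ[R] M) (g : W →ₗ[R] M)
    (hfg : Function.Surjective (f.coprod g)) :
    Function.Surjective (fun t : (∀ a : Splitting j,
        (⋀[R]^a.1.1 U) ⊗[R] (⋀[R]^a.1.2 W)) =>
      ∑ a, wedge a.add_eq f g (t a)) := by
  let Φ : (∀ a : Splitting j, (⋀[R]^a.1.1 U) ⊗[R] (⋀[R]^a.1.2 W)) →ₗ[R] ⋀[R]^j M :=
    ∑ a : Splitting j, wedge a.add_eq f g ∘ₗ LinearMap.proj a
  have hΦ : ∀ t, Φ t = ∑ a, wedge a.add_eq f g (t a) := fun t => by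
    simp [Φ]
  suffices h : ⋀[R]^j M ≤ (LinearMap.range Φ).map (⋀[R]^j M).subtype by
    intro x
    obtain ⟨y, ⟨t, rfl⟩, ht⟩ := h x.2
    exact ⟨t, (hΦ t).symm.trans (Subtype.ext ht)⟩
  have hsup : LinearMap.range (ExteriorAlgebra.ι R (M := M))
      = LinearMap.range (ExteriorAlgebra.ι R ∘ₗ f)
        + LinearMap.range (ExteriorAlgebra.ι R ∘ₗ g) := by
    rw [LinearMap.range_comp, LinearMap.range_comp, Submodule.add_eq_sup, ← Submodule.map_sup,
      ← LinearMap.range_coprod, LinearMap.range_eq_top.2 hfg, Submodule.map_top]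
  have hcomm : Commute (LinearMap.range (ExteriorAlgebra.ι R ∘ₗ f))
      (LinearMap.range (ExteriorAlgebra.ι R ∘ₗ g)) :=
    le_antisymm (ExteriorAlgebra.range_mul_range_le f g) (ExteriorAlgebra.range_mul_range_le g f)
  change LinearMap.range (ExteriorAlgebra.ι R) ^ j ≤ _
  rw [hsup, hcomm.add_pow']
  refine Finset.sum_induction _ (fun S => S ≤ (LinearMap.range Φ).map (⋀[R]^j M).subtype)
    (fun _ _ h1 h2 => sup_le h1 h2) bot_le ?_
  rintro ⟨q, s⟩ hqs
  -- Addition of submodules is the supremum, so the binomial coefficients do no harm.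
  have hle : ∀ n : ℕ, ∀ S : Submodule R (ExteriorAlgebra R M), n • S ≤ S := by
    intro n S
    induction n with
    | zero => simp
    | succ n ih => rw [succ_nsmul]; exact sup_le ih le_rfl
  refine (hle _ _).trans ?_
  rw [← ExteriorAlgebra.map_exteriorPower, ← ExteriorAlgebra.map_exteriorPower, Submodule.mul_le]
  rintro _ ⟨a, ha, rfl⟩ _ ⟨b, hb, rfl⟩
  classical
  refine ⟨_, ⟨Pi.single ⟨(q, s), hqs⟩ ((⟨a, ha⟩ : ⋀[R]^q U) ⊗ₜ[R] (⟨b, hb⟩ : ⋀[R]^s W)), rfl⟩, ?_⟩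
  rw [hΦ, Finset.sum_eq_single ⟨(q, s), hqs⟩]
  · rw [Pi.single_eq_same]
    exact coe_wedge_tmul (Splitting.add_eq ⟨(q, s), hqs⟩) f g _ _
  · intro b _ hb
    rw [Pi.single_eq_of_ne hb, map_zero]
  · simp

/-- Surjectivity is known, and both sides have the same dimension by Vandermonde's identity for
binomial coefficients. -/
theorem wedge_sum_bijective {K U W M : Type*} [Field K] [AddCommGroup U] [Module K U]
    [AddCommGroup W] [Module K W] [AddCommGroup M] [Module K M] [FiniteDimensional K U]
    [FiniteDimensional K W] (j : ℕ) (f : U →ₗ[K] M) (g : W →ₗ[K] M)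
    (hfg : Function.Bijective (f.coprod g)) :
    Function.Bijective (fun t : (∀ a : Splitting j,
        (⋀[K]^a.1.1 U) ⊗[K] (⋀[K]^a.1.2 W)) =>
      ∑ a, wedge a.add_eq f g (t a)) := by
  have hs := wedge_sum_surjective j f g hfg.2
  refine ⟨?_, hs⟩
  let Φ : (∀ a : Splitting j, (⋀[K]^a.1.1 U) ⊗[K] (⋀[K]^a.1.2 W)) →ₗ[K] ⋀[K]^j M :=
    ∑ a : Splitting j, wedge a.add_eq f g ∘ₗ LinearMap.proj a
  have hΦ : ⇑Φ = fun t => ∑ a, wedge a.add_eq f g (t a) := by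
    ext t; simp [Φ]
  rw [← hΦ] at hs ⊢
  have e := LinearEquiv.ofBijective _ hfg
  have : FiniteDimensional K M := Module.Finite.equiv e
  have hrank : Module.finrank K (∀ a : Splitting j, (⋀[K]^a.1.1 U) ⊗[K] (⋀[K]^a.1.2 W))
      = Module.finrank K (⋀[K]^j M) := by
    rw [exteriorPower.finrank_eq, ← e.finrank_eq, Module.finrank_prod, Nat.add_choose_eq,
      Module.finrank_pi_fintype,
      ← Finset.sum_coe_sort (Finset.HasAntidiagonal.antidiagonal j)]
    simp [exteriorPower.finrank_eq]
  let e' := LinearEquiv.ofFinrankEq _ _ hrank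
  have hinj : Function.Injective (Φ ∘ₗ e'.symm.toLinearMap) :=
    OrzechProperty.injective_of_surjective_endomorphism _ (hs.comp e'.symm.surjective)
  intro x y hxy
  refine e'.injective (hinj ?_)
  simpa using hxy

end Wedge

/-! ### Splittings over a field, and potentials on the cube of states -/

section LinearAlgebra

variable {K : Type*} [Field K] {X Y : Type*} [AddCommGroup X] [Module K X] [AddCommGroup Y]
  [Module K Y]

/-- A section of the map onto its image, extended to the whole target; both exist over a field. This
is the raw material for contracting homotopies. -/
theorem LinearMap.exists_generalizedInverse (f : X →ₗ[K] Y) :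
    ∃ g : Y →ₗ[K] X, f ∘ₗ g ∘ₗ f = f := by
  obtain ⟨s, hs⟩ := f.rangeRestrict.exists_rightInverse_of_surjective f.range_rangeRestrict
  obtain ⟨g, hg⟩ := LinearMap.exists_extend s
  refine ⟨g, LinearMap.ext fun x => ?_⟩
  have h1 : g (f x) = s (f.rangeRestrict x) := LinearMap.congr_fun hg (f.rangeRestrict x)
  have h2 := congrArg Subtype.val (LinearMap.congr_fun hs (f.rangeRestrict x))
  simpa [h1] using h2

/-- Joint injectivity embeds `X` into a finite product, and over a field this embedding splits. An
identity of this kind, unlike injectivity itself, visibly survives tensor products. -/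
theorem LinearMap.exists_sum_comp_eq_id {ι : Type*} [Fintype ι] {U : ι → Type*}
    [∀ i, AddCommGroup (U i)] [∀ i, Module K (U i)] (u : ∀ i, X →ₗ[K] U i)
    (hu : ∀ x, (∀ i, u i x = 0) → x = 0) :
    ∃ l : ∀ i, U i →ₗ[K] X, ∀ x, ∑ i, l i (u i x) = x := by
  classical
  obtain ⟨L, hL⟩ := (LinearMap.pi u).exists_leftInverse_of_injective
    (LinearMap.ker_eq_bot'.2 fun x hx => hu x fun i => congrFun hx i)
  refine ⟨fun i => L ∘ₗ LinearMap.single K U i, fun x => ?_⟩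
  simp only [LinearMap.comp_apply, LinearMap.coe_single, ← map_sum]
  rw [Finset.univ_sum_single (fun i => u i x)]
  exact LinearMap.congr_fun hL x

theorem TensorProduct.eq_zero_of_forall_map_eq_zero {ι κ : Type*} [Fintype ι] [Fintype κ]
    {U : ι → Type*} {V : κ → Type*} [∀ i, AddCommGroup (U i)] [∀ i, Module K (U i)]
    [∀ k, AddCommGroup (V k)] [∀ k, Module K (V k)] (u : ∀ i, X →ₗ[K] U i)
    (v : ∀ k, Y →ₗ[K] V k) (hu : ∀ x, (∀ i, u i x = 0) → x = 0)
    (hv : ∀ y, (∀ k, v k y = 0) → y = 0) (t : X ⊗[K] Y)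
    (ht : ∀ i k, TensorProduct.map (u i) (v k) t = 0) : t = 0 := by
  obtain ⟨l, hl⟩ := LinearMap.exists_sum_comp_eq_id u hu
  obtain ⟨m, hm⟩ := LinearMap.exists_sum_comp_eq_id v hv
  have key : ∑ i, ∑ k, TensorProduct.map (l i) (m k) ∘ₗ TensorProduct.map (u i) (v k)
      = LinearMap.id := by
    ext x y
    simp only [TensorProduct.AlgebraTensorModule.curry_apply, TensorProduct.curry_apply,
      LinearMap.coe_restrictScalars, LinearMap.sum_apply, LinearMap.comp_apply,
      TensorProduct.map_tmul, LinearMap.id_apply, ← TensorProduct.tmul_sum,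
      ← TensorProduct.sum_tmul, hl, hm]
  rw [← LinearMap.id_apply (R := K) t, ← key]
  simp [ht]

end LinearAlgebra

/-- A multiplicative 1-cocycle on the cube of subsets is a coboundary. The potential is built by
cardinality: its value at `F` is forced by deleting any one element, and the commuting squares make
the choice irrelevant. -/
theorem exists_sign_potential {E : Type*} [Fintype E] [DecidableEq E] (t : Finset E → E → ℂ)
    (ht : ∀ F e, t F e ≠ 0) (hcomm : ∀ F e f, e ∈ F → f ∈ F → e ≠ f →
      t F e * t (F.erase e) f = t F f * t (F.erase f) e) :
    ∃ η : Finset E → ℂ, (∀ F, η F ≠ 0) ∧ ∀ F, ∀ e ∈ F, η F = t F e * η (F.erase e) := by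
  suffices h : ∀ n : ℕ, ∃ η : Finset E → ℂ, (∀ F, η F ≠ 0) ∧
      ∀ F, F.card ≤ n → ∀ e ∈ F, η F = t F e * η (F.erase e) by
    obtain ⟨η, h0, h1⟩ := h (Fintype.card E)
    exact ⟨η, h0, fun F => h1 F F.card_le_univ⟩
  intro n
  induction n with
  | zero =>
    refine ⟨fun _ => 1, fun _ => one_ne_zero, fun F hF e he => ?_⟩
    rw [Finset.card_eq_zero.1 (Nat.le_zero.1 hF)] at he
    simp at he
  | succ n ih =>
    obtain ⟨η, h0, h1⟩ := ih
    -- An arbitrary element of `F` is deleted. The default value `1` is never reached, since the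
    -- empty set has at most `n` elements.
    refine ⟨fun F => if F.card ≤ n then η F else
      if h : F.Nonempty then t F h.choose * η (F.erase h.choose) else 1, fun F => ?_,
      fun F hF e he => ?_⟩
    · dsimp only
      split_ifs
      · exact h0 F
      · exact mul_ne_zero (ht _ _) (h0 _)
      · exact one_ne_zero
    · have hcard := Finset.card_erase_add_one he
      have hle : (F.erase e).card ≤ n := by omega
      dsimp only
      rw [if_pos hle]
      by_cases hF' : F.card ≤ n
      · rw [if_pos hF']
        exact h1 F hF' e he
      · have hne : F.Nonempty := ⟨e, he⟩
        rw [if_neg hF', dif_pos hne]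
        generalize hf : hne.choose = f
        have hfF : f ∈ F := hf ▸ hne.choose_spec
        by_cases hef : f = e
        · rw [hef]
        have hcard' := Finset.card_erase_add_one hfF
        -- Independence of the deleted element: both sides are pushed down to `F` without `e` and
        -- `f` and compared by the square.
        rw [h1 (F.erase f) (by omega) e (Finset.mem_erase.2 ⟨Ne.symm hef, he⟩),
          h1 (F.erase e) hle f (Finset.mem_erase.2 ⟨hef, hfF⟩), ← mul_assoc, ← mul_assoc,
          hcomm F f e hfF he hef, Finset.erase_right_comm]

/-! ### Induction and coinduction along a homomorphism of finite groups -/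

namespace Representation

section IndCoind

variable {G H X : Type*} [Group G] [Group H] [Fintype G] [AddCommGroup X]
  [Module ℂ X] (φ : G →* H) (ρ : Representation ℂ G X)

open Classical in
/-- The equivariant function supported on the coset of `h` that is determined by a vector. -/
noncomputable def coindSingle (h : H) : X →ₗ[ℂ] coindV φ ρ where
  toFun x := ⟨fun g => ∑ k : G, if φ k * h = g then ρ k x else 0, fun k g => by
    rw [map_sum]
    symm
    refine Fintype.sum_equiv (Equiv.mulLeft k) _ _ fun l => ?_
    have : φ (k * l) * h = φ k * g ↔ φ l * h = g := by rw [map_mul, mul_assoc, mul_right_inj]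
    simp only [Equiv.coe_mulLeft, this]
    split_ifs <;> simp⟩
  map_add' x y := by
    ext g
    simp only [map_add, Submodule.coe_add, Pi.add_apply, ← Finset.sum_add_distrib]
    exact Finset.sum_congr rfl fun k _ => by split_ifs <;> simp
  map_smul' c x := by
    ext g
    simp only [map_smul, Submodule.coe_smul, Pi.smul_apply, Finset.smul_sum, RingHom.id_apply]
    exact Finset.sum_congr rfl fun k _ => by split_ifs <;> simp

open Classical in
theorem coindSingle_apply (h g : H) (x : X) :
    (coindSingle φ ρ h x).1 g = ∑ k : G, if φ k * h = g then ρ k x else 0 := rfl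

theorem coindSingle_map_mul (k : G) (h : H) (x : X) :
    coindSingle φ ρ (φ k * h) (ρ k x) = coindSingle φ ρ h x := by
  classical
  ext g
  rw [coindSingle_apply, coindSingle_apply]
  refine Fintype.sum_equiv (Equiv.mulRight k) _ _ fun l => ?_
  simp only [Equiv.coe_mulRight, map_mul, mul_assoc, Module.End.mul_apply]

theorem coind_coindSingle (h g : H) (x : X) :
    coind φ ρ g (coindSingle φ ρ h x) = coindSingle φ ρ (h * g⁻¹) x := by
  classical
  ext g'
  change (coindSingle φ ρ h x).1 (g' * g) = _
  rw [coindSingle_apply, coindSingle_apply]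
  refine Finset.sum_congr rfl fun l _ => ?_
  simp only [← mul_assoc, mul_inv_eq_iff_eq_mul]

/-- The canonical map from the induced to the coinduced module. -/
noncomputable def indVToCoindV : IndV φ ρ →ₗ[ℂ] coindV φ ρ :=
  Coinvariants.lift _ (TensorProduct.lift ((Finsupp.linearCombination _ (coindSingle φ ρ)) ∘ₗ
    (MonoidAlgebra.coeffLinearEquiv ℂ).toLinearMap)) fun k => by
      ext h x : 4
      simp [coindSingle_map_mul]

theorem indVToCoindV_mk (h : H) (x : X) :
    indVToCoindV φ ρ (IndV.mk φ ρ h x) = coindSingle φ ρ h x := by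
  simp [indVToCoindV]

variable [Fintype H]

/-- The inverse of `indVToCoindV`. -/
noncomputable def coindVToIndV : coindV φ ρ →ₗ[ℂ] IndV φ ρ :=
  -- In both composites with `indVToCoindV`, every element of `G` contributes the same term; this
  -- factor compensates, also when `φ` has a kernel.
  (Fintype.card G : ℂ)⁻¹ • ∑ g : H,
    IndV.mk φ ρ g ∘ₗ LinearMap.proj g ∘ₗ (coindV φ ρ).subtype

theorem coindVToIndV_apply (f : coindV φ ρ) :
    coindVToIndV φ ρ f = (Fintype.card G : ℂ)⁻¹ • ∑ g : H, IndV.mk φ ρ g (f.1 g) := by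
  simp [coindVToIndV]

omit [Fintype G] [Fintype H] in
theorem IndV.mk_map_mul (k : G) (h : H) (x : X) :
    IndV.mk φ ρ (φ k * h) (ρ k x) = IndV.mk φ ρ h x := by
  have := Coinvariants.mk_self_apply (Representation.tprod ((leftRegular ℂ H).comp φ) ρ) k
    (MonoidAlgebra.single h (1 : ℂ) ⊗ₜ x)
  simpa using this

theorem card_smul_inv_cancel (G : Type*) [Group G] [Fintype G] {X : Type*} [AddCommGroup X]
    [Module ℂ X] (x : X) : (Fintype.card G : ℂ)⁻¹ • Fintype.card G • x = x := by
  rw [← Nat.cast_smul_eq_nsmul ℂ, smul_smul, inv_mul_cancel₀, one_smul]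
  exact Nat.cast_ne_zero.2 Fintype.card_ne_zero

theorem indVToCoindV_coindVToIndV (f : coindV φ ρ) :
    indVToCoindV φ ρ (coindVToIndV φ ρ f) = f := by
  classical
  rw [coindVToIndV_apply, map_smul, map_sum, Finset.sum_congr rfl fun g _ =>
    indVToCoindV_mk φ ρ g (f.1 g)]
  ext g
  simp only [Submodule.coe_smul, Submodule.coe_sum, Pi.smul_apply, Finset.sum_apply,
    coindSingle_apply]
  rw [Finset.sum_comm]
  -- For each `k` only the argument `(φ k)⁻¹ * g` counts, and equivariance makes its contribution
  -- independent of `k`.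
  have h : ∀ k : G, (∑ h : H, if φ k * h = g then ρ k (f.1 h) else 0) = f.1 g := fun k => by
    rw [Finset.sum_eq_single ((φ k)⁻¹ * g)]
    · rw [if_pos (by group), ← f.2 k]
      group
    · intro h _ hh
      rw [if_neg]
      rintro rfl
      exact hh (by group)
    · simp
  rw [Finset.sum_congr rfl fun k _ => h k, Finset.sum_const, Finset.card_univ]
  exact card_smul_inv_cancel G _

theorem coindVToIndV_coindSingle (h : H) (x : X) :
    coindVToIndV φ ρ (coindSingle φ ρ h x) = IndV.mk φ ρ h x := by
  classical
  rw [coindVToIndV_apply]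
  simp only [coindSingle_apply, map_sum]
  rw [Finset.sum_comm]
  have h : ∀ k : G, (∑ g : H, IndV.mk φ ρ g (if φ k * h = g then ρ k x else 0))
      = IndV.mk φ ρ h x := fun k => by
    rw [Finset.sum_eq_single (φ k * h), if_pos rfl, IndV.mk_map_mul]
    · intro g _ hg
      rw [if_neg (Ne.symm hg), map_zero]
    · simp
  rw [Finset.sum_congr rfl fun k _ => h k, Finset.sum_const, Finset.card_univ]
  exact card_smul_inv_cancel G _

/-- Induction along a homomorphism of finite groups agrees with coinduction. -/
noncomputable def indEquivCoind : (ind φ ρ).Equiv (coind φ ρ) :=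
  .mk (.ofLinearMap (indVToCoindV φ ρ) (coindVToIndV φ ρ)
    (LinearMap.ext (indVToCoindV_coindVToIndV φ ρ))
    (IndV.hom_ext _ _ fun h => LinearMap.ext fun x =>
      (congrArg _ (indVToCoindV_mk φ ρ h x)).trans (coindVToIndV_coindSingle φ ρ h x)))
    fun g => IndV.hom_ext _ _ fun h => LinearMap.ext fun x => by
      change indVToCoindV φ ρ (ind φ ρ g (IndV.mk φ ρ h x))
        = coind φ ρ g (indVToCoindV φ ρ (IndV.mk φ ρ h x))
      rw [ind_mk, indVToCoindV_mk, indVToCoindV_mk, coind_coindSingle]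

end IndCoind

end Representation

/-! ### The total chain module and its differential -/

namespace MultiGraph

noncomputable section

universe u v

variable {V : Type u} {E : Type v} (G : MultiGraph V E) [Fintype V]

/-- The degree `j` part of `⋀^* T_F`. -/
def StatePow (F : Finset E) (j : ℕ) : Type u := ⋀[ℂ]^j (G.stdSpace F)

instance (F : Finset E) (j : ℕ) : AddCommGroup (G.StatePow F j) :=
  inferInstanceAs (AddCommGroup (⋀[ℂ]^j (G.stdSpace F)))

instance (F : Finset E) (j : ℕ) : Module ℂ (G.StatePow F j) :=
  inferInstanceAs (Module ℂ (⋀[ℂ]^j (G.stdSpace F)))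

/-- The action of the Young subgroup of `F` on `⋀^j T_F`. -/
def statePowRep (F : Finset E) (j : ℕ) : Representation ℂ (G.young F) (G.StatePow F j) :=
  G.youngRep F j

/-- The map `⋀^j T_F → ⋀^j T_{F'}` that is induced by the projection. -/
def statePowMap (F F' : Finset E) (j : ℕ) : G.StatePow F j →ₗ[ℂ] G.StatePow F' j :=
  exteriorPower.map j (G.proj F F')

/-- The equivariant functions `𝔖_V → ⋀^j T_F`. -/
abbrev stateCoind (F : Finset E) (j : ℕ) : Submodule ℂ (Equiv.Perm V → G.StatePow F j) :=
  Representation.coindV (G.young F).subtype (G.statePowRep F j)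

/-- The canonical isomorphism from `ℳ_F` to the equivariant functions `𝔖_V → ⋀^j T_F`. -/
def stateEquiv (F : Finset E) (j : ℕ) : (G.stateRep F j).Equiv
    (Representation.coind (G.young F).subtype (G.statePowRep F j)) :=
  G.indEquivCoind F j

/-- Composition of equivariant functions with `⋀^j T_F → ⋀^j T_{F'}`. -/
def stateCoindMap {F F' : Finset E} (hF : F' ⊆ F) (j : ℕ) :
    (Representation.coind (G.young F).subtype (G.statePowRep F j)).IntertwiningMap
      (Representation.coind (G.young F').subtype (G.statePowRep F' j)) :=
  G.coindMap hF j

theorem stateCoindMap_apply {F F' : Finset E} (hF : F' ⊆ F) (j : ℕ) (f : G.stateCoind F j)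
    (g : Equiv.Perm V) : (G.stateCoindMap hF j f).1 g = G.statePowMap F F' j (f.1 g) := rfl

/-- The per-edge map is by definition conjugated from composition of equivariant functions, so on
the function side it acts pointwise. -/
theorem stateEquiv_edgeMap {F F' : Finset E} (hF : F' ⊆ F) (j : ℕ) (y : G.StateModule F j) :
    G.stateEquiv F' j (G.edgeMap hF j y) = G.stateCoindMap hF j (G.stateEquiv F j y) :=
  (G.indEquivCoind F' j).apply_symm_apply _

/-- The families of equivariant functions `𝔖_V → ⋀^j T_F`, indexed by all states `F`. -/
def totalChain (j : ℕ) :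
    Submodule ℂ (∀ F : Finset E, Equiv.Perm V → G.StatePow F j) where
  carrier := {c | ∀ F, c F ∈ G.stateCoind F j}
  add_mem' hx hy F := add_mem (hx F) (hy F)
  zero_mem' _ := zero_mem _
  smul_mem' c _ hx F := Submodule.smul_mem _ c (hx F)

namespace totalChain

variable {G}

@[ext]
theorem ext {j : ℕ} {x y : G.totalChain j} (h : ∀ F g, x.1 F g = y.1 F g) : x = y :=
  Subtype.ext (funext fun F => funext fun g => h F g)

variable (G)

/-- The value of a family at the state `F` and the permutation `g`. -/
def eval (j : ℕ) (F : Finset E) (g : Equiv.Perm V) :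
    G.totalChain j →ₗ[ℂ] G.StatePow F j :=
  LinearMap.proj g ∘ₗ LinearMap.proj F ∘ₗ (G.totalChain j).subtype

theorem eval_apply (j : ℕ) (F : Finset E) (g : Equiv.Perm V) (c : G.totalChain j) :
    eval G j F g c = c.1 F g := rfl

/-- The member at the state `F` of a family. -/
def component (j : ℕ) (F : Finset E) : G.totalChain j →ₗ[ℂ]
    G.stateCoind F j where
  toFun c := ⟨c.1 F, c.2 F⟩
  map_add' _ _ := rfl
  map_smul' _ _ := rfl

/-- The action of `𝔖_V` on families of equivariant functions. -/
def rep (j : ℕ) : Representation ℂ (Equiv.Perm V) (G.totalChain j) where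
  toFun σ :=
    { toFun := fun c => ⟨fun F => (Representation.coind (G.young F).subtype (G.statePowRep F j) σ
        (component G j F c)).1, fun F => Subtype.prop _⟩
      map_add' := fun _ _ => rfl
      map_smul' := fun _ _ => rfl }
  map_one' := by
    refine LinearMap.ext fun c => totalChain.ext fun F g => ?_
    change c.1 F (g * 1) = c.1 F g
    rw [mul_one]
  map_mul' σ τ := by
    refine LinearMap.ext fun c => totalChain.ext fun F g => ?_
    change c.1 F (g * (σ * τ)) = c.1 F (g * σ * τ)
    rw [mul_assoc]

theorem rep_apply (j : ℕ) (σ : Equiv.Perm V) (c : G.totalChain j) (F : Finset E)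
    (g : Equiv.Perm V) : (rep G j σ c).1 F g = c.1 F (g * σ) := rfl

theorem eval_rep (j : ℕ) (σ : Equiv.Perm V) (F : Finset E) (g : Equiv.Perm V) :
    eval G j F g ∘ₗ rep G j σ = eval G j F (g * σ) := rfl

/-- The sign `(-1)^|F|` at the state `F`. -/
def sign (j : ℕ) : G.totalChain j →ₗ[ℂ] G.totalChain j where
  toFun c := ⟨fun F => (-1 : ℂ) ^ F.card • c.1 F, fun F => Submodule.smul_mem _ _ (c.2 F)⟩
  map_add' x y := by
    ext F g
    exact (smul_add ((-1 : ℂ) ^ F.card) (x.1 F g) (y.1 F g))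
  map_smul' a x := by
    ext F g
    exact (smul_comm ((-1 : ℂ) ^ F.card) a (x.1 F g))

theorem sign_apply (j : ℕ) (c : G.totalChain j) (F : Finset E) (g : Equiv.Perm V) :
    (sign G j c).1 F g = (-1 : ℂ) ^ F.card • c.1 F g := rfl

theorem sign_sign (j : ℕ) (c : G.totalChain j) : sign G j (sign G j c) = c := by
  ext1 F g
  rw [sign_apply, sign_apply, smul_smul, ← mul_pow]
  simp

theorem sign_rep (j : ℕ) (σ : Equiv.Perm V) (c : G.totalChain j) :
    sign G j (rep G j σ c) = rep G j σ (sign G j c) := rfl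

variable [DecidableEq E]

/-- The family whose only nonzero member is a given one, at the state `F`. -/
def single (j : ℕ) (F : Finset E) :
    G.stateCoind F j →ₗ[ℂ] G.totalChain j where
  toFun f := ⟨LinearMap.single ℂ (fun F' => Equiv.Perm V → G.StatePow F' j) F f.1,
    fun F' => by
      by_cases h : F' = F
      · subst h; rw [LinearMap.single_apply, Pi.single_eq_same]; exact f.2
      · rw [LinearMap.single_apply, Pi.single_eq_of_ne h]; exact zero_mem _⟩
  map_add' x y := Subtype.ext (map_add
    (LinearMap.single ℂ (fun F' => Equiv.Perm V → G.StatePow F' j) F) x.1 y.1)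
  map_smul' a x := Subtype.ext (map_smul
    (LinearMap.single ℂ (fun F' => Equiv.Perm V → G.StatePow F' j) F) a x.1)

theorem single_same (j : ℕ) (F : Finset E)
    (f : G.stateCoind F j) (g : Equiv.Perm V) :
    (single G j F f).1 F g = f.1 g :=
  congrFun (Pi.single_eq_same (M := fun F' => Equiv.Perm V → G.StatePow F' j) F f.1) g

theorem single_of_ne (j : ℕ) {F F' : Finset E} (h : F' ≠ F)
    (f : G.stateCoind F j) (g : Equiv.Perm V) :
    (single G j F f).1 F' g = 0 :=
  congrFun (Pi.single_eq_of_ne (M := fun F' => Equiv.Perm V → G.StatePow F' j) h f.1) g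

variable [Fintype E] (num : E ≃ Fin (Fintype.card E))

/-- The differential on families of equivariant functions. -/
def diff (j : ℕ) : G.totalChain j →ₗ[ℂ] G.totalChain j where
  toFun c := ⟨fun F => (∑ e ∈ Fᶜ, edgeSign num (insert e F) e •
      G.stateCoindMap (Finset.subset_insert e F) j (component G j (insert e F) c)).1,
    fun F => Subtype.prop _⟩
  map_add' x y := Subtype.ext (funext fun F => by
    simp only [map_add, smul_add, Finset.sum_add_distrib]
    rfl)
  map_smul' a x := Subtype.ext (funext fun F => by
    simp only [map_smul, smul_comm _ a, ← Finset.smul_sum]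
    rfl)

theorem diff_apply (j : ℕ) (c : G.totalChain j) (F : Finset E) (g : Equiv.Perm V) :
    (diff G num j c).1 F g = ∑ e ∈ Fᶜ, edgeSign num (insert e F) e •
      G.statePowMap (insert e F) F j (c.1 (insert e F) g) := by
  change (∑ e ∈ Fᶜ, edgeSign num (insert e F) e •
      G.stateCoindMap (Finset.subset_insert e F) j (component G j (insert e F) c)).1 g = _
  rw [Submodule.coe_sum, Finset.sum_apply]
  rfl

theorem diff_rep (j : ℕ) (σ : Equiv.Perm V) (c : G.totalChain j) :
    diff G num j (rep G j σ c) = rep G j σ (diff G num j c) := by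
  ext1 F g
  rw [rep_apply, diff_apply, diff_apply]
  rfl

theorem diff_sign (j : ℕ) (c : G.totalChain j) :
    diff G num j (sign G j c) = - sign G j (diff G num j c) := by
  ext1 F g
  change _ = -(sign G j (diff G num j c)).1 F g
  rw [sign_apply, diff_apply, diff_apply, Finset.smul_sum, ← Finset.sum_neg_distrib]
  refine Finset.sum_congr rfl fun e he => ?_
  rw [sign_apply, map_smul, Finset.card_insert_of_notMem (Finset.mem_compl.1 he), pow_succ,
    smul_comm, mul_smul, neg_one_smul, smul_neg]

/-- Matches two forms of the differential: on families, the value at `F` collects the contributions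
of `insert e F`; on chains, the summand of `F` is distributed to the states `F.erase e`. -/
theorem diff_single (j : ℕ) (F : Finset E)
    (f : G.stateCoind F j) :
    diff G num j (single G j F f) = ∑ e : {e // e ∈ F}, edgeSign num F e.1 •
      single G j (F.erase e.1) (G.stateCoindMap (Finset.erase_subset e.1 F) j f) := by
  have key : ∀ (F' F'' : Finset E) (h : F' = F'') (h' : F' ⊆ F) (h'' : F'' ⊆ F)
      (g : Equiv.Perm V), (single G j F' (G.stateCoindMap h' j f)).1 F'' g
        = (G.stateCoindMap h'' j f).1 g := by
    rintro F' _ rfl h' h'' g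
    rw [single_same]
  ext1 F' g
  rw [diff_apply, Submodule.coe_sum, Finset.sum_apply, Finset.sum_apply]
  rw [Finset.sum_coe_sort F (fun e => (edgeSign num F e •
    single G j (F.erase e) (G.stateCoindMap (Finset.erase_subset e F) j f)).1 F' g)]
  -- At `F'`, one sum runs over `e ∉ F'` and the other over `e ∈ F`. Terms in only one range vanish;
  -- a common term is nonzero only if `insert e F' = F`, and then the two agree.
  refine Finset.sum_congr_of_eq_on_inter (fun e he he' => ?_) (fun e he he' => ?_)
    fun e he he' => ?_
  · rw [single_of_ne, map_zero, smul_zero]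
    rintro rfl
    exact he' (Finset.mem_insert_self _ _)
  · change edgeSign num F e • (single G j (F.erase e) _).1 F' g = 0
    rw [single_of_ne, smul_zero]
    rintro rfl
    exact he' (by simp)
  · change _ = edgeSign num F e • (single G j (F.erase e) _).1 F' g
    by_cases h : insert e F' = F
    · subst h
      have h1 := key ((insert e F').erase e) F' (Finset.erase_insert (Finset.mem_compl.1 he))
        (Finset.erase_subset e _) (Finset.subset_insert e F') g
      have h2 : G.statePowMap (insert e F') F' j
          ((single G j (insert e F') f).1 (insert e F') g)
          = (G.stateCoindMap (Finset.subset_insert e F') j f).1 g := by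
        rw [single_same, stateCoindMap_apply]
      exact congrArg (edgeSign num (insert e F') e • ·) (h2.trans h1.symm)
    · rw [single_of_ne G j h, single_of_ne, map_zero, smul_zero, smul_zero]
      rintro rfl
      exact h (Finset.insert_erase he')

end totalChain

end

end MultiGraph

/-! ### Graded chains inside the total chain module -/

namespace MultiGraph

noncomputable section

universe u v

variable {V : Type u} {E : Type v} (G : MultiGraph V E) [Fintype V]

namespace totalChain

/-- The inclusion of the chains of homological degree `i`. -/
def inc (i j : ℕ) : G.Chain i j →ₗ[ℂ] G.totalChain j where
  toFun y := ⟨fun F => if h : F.card = i then (G.stateEquiv F j (y ⟨F, h⟩)).1 else 0, fun F => by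
    dsimp only
    split_ifs with h
    · exact Subtype.prop _
    · exact zero_mem _⟩
  map_add' x y := by
    ext F g
    change (if h : F.card = i then (G.stateEquiv F j (x ⟨F, h⟩ + y ⟨F, h⟩)).1 else 0) g
      = (if h : F.card = i then (G.stateEquiv F j (x ⟨F, h⟩)).1 else 0) g
        + (if h : F.card = i then (G.stateEquiv F j (y ⟨F, h⟩)).1 else 0) g
    split_ifs with h
    · rw [map_add]; rfl
    · simp
  map_smul' a x := by
    ext F g
    change (if h : F.card = i then (G.stateEquiv F j (a • x ⟨F, h⟩)).1 else 0) g
      = a • (if h : F.card = i then (G.stateEquiv F j (x ⟨F, h⟩)).1 else 0) g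
    split_ifs with h
    · rw [map_smul]; rfl
    · simp

theorem inc_of_card {i j : ℕ} (y : G.Chain i j) {F : Finset E} (h : F.card = i) :
    (inc G i j y).1 F = (G.stateEquiv F j (y ⟨F, h⟩)).1 :=
  dif_pos h

theorem inc_of_card_ne {i j : ℕ} (y : G.Chain i j) {F : Finset E} (h : F.card ≠ i) :
    (inc G i j y).1 F = 0 :=
  dif_neg h

theorem inc_rep (i j : ℕ) (σ : Equiv.Perm V) (y : G.Chain i j) :
    inc G i j (G.chainRep i j σ y) = rep G j σ (inc G i j y) := by
  ext1 F g
  rw [rep_apply]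
  by_cases h : F.card = i
  · rw [inc_of_card G _ h, inc_of_card G _ h]
    have h1 : (G.chainRep i j σ y) ⟨F, h⟩ = G.stateRep F j σ (y ⟨F, h⟩) := rfl
    have h2 := LinearMap.congr_fun ((G.stateEquiv F j).isIntertwining' σ) (y ⟨F, h⟩)
    rw [h1]
    exact congrFun (congrArg Subtype.val h2) g
  · rw [inc_of_card_ne G _ h, inc_of_card_ne G _ h]
    rfl

theorem sign_inc (i j : ℕ) (y : G.Chain i j) :
    sign G j (inc G i j y) = (-1 : ℂ) ^ i • inc G i j y := by
  ext1 F g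
  rw [sign_apply]
  change _ = (-1 : ℂ) ^ i • (inc G i j y).1 F g
  by_cases h : F.card = i
  · rw [h]
  · rw [inc_of_card_ne G _ h]; simp

theorem inc_injective (i j : ℕ) : Function.Injective (inc G i j) := by
  intro x y h
  refine DFinsupp.ext fun F => (G.stateEquiv F.1 j).toLinearEquiv.injective (Subtype.ext ?_)
  exact (inc_of_card G x F.2).symm.trans
    ((congrFun (congrArg Subtype.val h) F.1).trans (inc_of_card G y F.2))

variable [DecidableEq E]

theorem inc_lof (i j : ℕ) (F : {F : Finset E // F.card = i}) (y : G.StateModule F.1 j) :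
    inc G i j (DirectSum.lof ℂ _ (fun F : {F : Finset E // F.card = i} => G.StateModule F.1 j) F y)
      = single G j F.1 (G.stateEquiv F.1 j y) := by
  ext1 F' g
  by_cases hF : F' = F.1
  · subst hF
    rw [inc_of_card G _ F.2, single_same, DirectSum.lof_apply]
  · rw [single_of_ne G j hF]
    by_cases h : F'.card = i
    · rw [inc_of_card G _ h, DirectSum.lof_eq_of, DirectSum.of_eq_of_ne, map_zero]
      · rfl
      · intro h'
        exact hF (congrArg Subtype.val h')
    · rw [inc_of_card_ne G _ h]; rfl

variable [Fintype E]

/-- The projection to the chains of homological degree `i`. -/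
def pr (i j : ℕ) : G.totalChain j →ₗ[ℂ] G.Chain i j :=
  (DirectSum.linearEquivFunOnFintype ℂ {F : Finset E // F.card = i}
    (fun F => G.StateModule F.1 j)).symm.toLinearMap ∘ₗ
    LinearMap.pi fun F => (G.stateEquiv F.1 j).toLinearEquiv.symm.toLinearMap ∘ₗ component G j F.1

omit [DecidableEq E] in
theorem stateEquiv_pr (i j : ℕ) (c : G.totalChain j) (F : {F : Finset E // F.card = i}) :
    (G.stateEquiv F.1 j (pr G i j c F)).1 = c.1 F.1 := by
  have h : pr G i j c F = (G.stateEquiv F.1 j).toLinearEquiv.symm (component G j F.1 c) :=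
    congrFun ((DirectSum.linearEquivFunOnFintype ℂ {F : Finset E // F.card = i}
      (fun F => G.StateModule F.1 j)).apply_symm_apply fun F =>
        (G.stateEquiv F.1 j).toLinearEquiv.symm (component G j F.1 c)) F
  rw [h]
  exact congrArg Subtype.val ((G.stateEquiv F.1 j).toLinearEquiv.apply_symm_apply _)

omit [DecidableEq E] in
theorem inc_pr_of_card {i j : ℕ} (c : G.totalChain j) {F : Finset E} (h : F.card = i) :
    (inc G i j (pr G i j c)).1 F = c.1 F := by
  rw [inc_of_card G _ h]
  exact stateEquiv_pr G i j c ⟨F, h⟩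

omit [DecidableEq E] in
theorem inc_pr_apply (i j : ℕ) (c : G.totalChain j) (F : Finset E) (g : Equiv.Perm V) :
    (inc G i j (pr G i j c)).1 F g = if F.card = i then c.1 F g else 0 := by
  split_ifs with h
  · rw [inc_pr_of_card G c h]
  · rw [inc_of_card_ne G _ h]; rfl

omit [DecidableEq E] in
theorem pr_inc (i j : ℕ) (y : G.Chain i j) : pr G i j (inc G i j y) = y := by
  apply inc_injective
  ext1 F g
  rw [inc_pr_apply]
  split_ifs with h
  · rfl
  · rw [inc_of_card_ne G _ h]; rfl

omit [DecidableEq E] in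
theorem pr_inc_of_ne {i i' : ℕ} (h : i ≠ i') (j : ℕ) (y : G.Chain i' j) :
    pr G i j (inc G i' j y) = 0 := by
  apply inc_injective
  ext1 F g
  rw [inc_pr_apply, map_zero]
  split_ifs with h'
  · rw [inc_of_card_ne G _ (fun h'' => h (h'.symm.trans h''))]; rfl
  · rfl

omit [DecidableEq E] in
theorem pr_rep (i j : ℕ) (σ : Equiv.Perm V) (c : G.totalChain j) :
    pr G i j (rep G j σ c) = G.chainRep i j σ (pr G i j c) := by
  apply inc_injective
  rw [inc_rep]
  ext1 F g
  rw [rep_apply, inc_pr_apply, inc_pr_apply, rep_apply]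

omit [DecidableEq E] in
theorem sum_inc_pr (j : ℕ) (c : G.totalChain j) :
    ∑ i ∈ Finset.range (Fintype.card E + 1), inc G i j (pr G i j c) = c := by
  ext1 F g
  rw [Submodule.coe_sum, Finset.sum_apply, Finset.sum_apply,
    Finset.sum_congr rfl fun i _ => inc_pr_apply G i j c F g, Finset.sum_ite_eq, if_pos]
  exact Finset.mem_range.2 (Nat.lt_succ_of_le F.card_le_univ)

variable (num : E ≃ Fin (Fintype.card E))

/-- For `i = 0` both sides vanish, so the truncated `i - 1` is harmless. -/
theorem inc_diff (i j : ℕ) (y : G.Chain i j) :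
    inc G (i - 1) j (G.diff num i j y) = diff G num j (inc G i j y) := by
  suffices h : inc G (i - 1) j ∘ₗ G.diff num i j = diff G num j ∘ₗ inc G i j from
    LinearMap.congr_fun h y
  refine DirectSum.linearMap_ext ℂ fun F => LinearMap.ext fun y => ?_
  rw [LinearMap.comp_apply, LinearMap.comp_apply, LinearMap.comp_apply, LinearMap.comp_apply,
    diff_lof, inc_lof, diff_single, map_sum]
  refine Finset.sum_congr rfl fun e _ => ?_
  rw [map_smul, inc_lof, stateEquiv_edgeMap]

theorem pr_diff (i j : ℕ) (c : G.totalChain j) :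
    pr G i j (diff G num j c) = G.diff num (i + 1) j (pr G (i + 1) j c) := by
  apply inc_injective
  refine Eq.trans ?_ (inc_diff G num (i + 1) j _).symm
  ext1 F g
  rw [inc_pr_apply, diff_apply, diff_apply]
  split_ifs with h
  · refine Finset.sum_congr rfl fun e he => ?_
    rw [inc_pr_apply, if_pos]
    rw [Finset.card_insert_of_notMem (Finset.mem_compl.1 he), h]
  · refine (Finset.sum_eq_zero fun e he => ?_).symm
    rw [inc_pr_apply, if_neg, map_zero, smul_zero]
    rw [Finset.card_insert_of_notMem (Finset.mem_compl.1 he)]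
    omega

theorem diff_inc_zero (j : ℕ) (y : G.Chain 0 j) : diff G num j (inc G 0 j y) = 0 := by
  ext1 F g
  rw [diff_apply]
  refine Finset.sum_eq_zero fun e he => ?_
  rw [inc_of_card_ne]
  · simp
  · simp

theorem diff_diff (j : ℕ) (c : G.totalChain j) : diff G num j (diff G num j c) = 0 := by
  rw [← sum_inc_pr G j c, map_sum, map_sum]
  refine Finset.sum_eq_zero fun i _ => ?_
  rw [← inc_diff, ← inc_diff, G.diff_diff, map_zero]

end totalChain

end

end MultiGraph

/-! ### Equivariant contraction of the total complex onto homology -/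

namespace MultiGraph

noncomputable section

universe u v

variable {V : Type u} {E : Type v} (G : MultiGraph V E) [Fintype V] [DecidableEq E] [Fintype E]
  (num : E ≃ Fin (Fintype.card E))

open totalChain

/-- An equivariant deformation of the total chain module of a graph to its homology. -/
structure Contraction (j : ℕ) where
  h : G.totalChain j →ₗ[ℂ] G.totalChain j
  proj : G.totalChain j →ₗ[ℂ] G.totalChain j
  incl (p : ℕ) : G.Homology num p j →ₗ[ℂ] G.totalChain j
  retr (p : ℕ) : G.totalChain j →ₗ[ℂ] G.Homology num p j
  h_rep (σ : Equiv.Perm V) (c : G.totalChain j) : h (rep G j σ c) = rep G j σ (h c)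
  proj_rep (σ : Equiv.Perm V) (c : G.totalChain j) : proj (rep G j σ c) = rep G j σ (proj c)
  incl_rep (p : ℕ) (σ : Equiv.Perm V) (x : G.Homology num p j) :
    incl p (G.homologyRep num p j σ x) = rep G j σ (incl p x)
  retr_rep (p : ℕ) (σ : Equiv.Perm V) (c : G.totalChain j) :
    retr p (rep G j σ c) = G.homologyRep num p j σ (retr p c)
  h_sign (c : G.totalChain j) : h (sign G j c) = -sign G j (h c)
  proj_sign (c : G.totalChain j) : proj (sign G j c) = sign G j (proj c)
  diff_h (c : G.totalChain j) :
    totalChain.diff G num j (h c) + h (totalChain.diff G num j c) = c - proj c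
  diff_proj (c : G.totalChain j) : totalChain.diff G num j (proj c) = 0
  proj_diff (c : G.totalChain j) : proj (totalChain.diff G num j c) = 0
  diff_incl (p : ℕ) (x : G.Homology num p j) : totalChain.diff G num j (incl p x) = 0
  retr_diff (p : ℕ) (c : G.totalChain j) : retr p (totalChain.diff G num j c) = 0
  retr_incl (p : ℕ) (x : G.Homology num p j) : retr p (incl p x) = x
  retr_incl_of_ne (p p' : ℕ) (hp : p ≠ p') (x : G.Homology num p' j) : retr p (incl p' x) = 0
  incl_retr (p : ℕ) (c : G.totalChain j) : incl p (retr p c) = proj (inc G p j (pr G p j c))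
  inc_pr_incl (p : ℕ) (x : G.Homology num p j) : inc G p j (pr G p j (incl p x)) = incl p x

namespace totalChain

/-- The projection of the total chain module to the homological degree `i`. -/
def degProj (i j : ℕ) : Module.End ℂ (G.totalChain j) := inc G i j ∘ₗ pr G i j

omit [DecidableEq E] in
theorem degProj_apply (i j : ℕ) (c : G.totalChain j) :
    degProj G i j c = inc G i j (pr G i j c) := rfl

omit [DecidableEq E] in
theorem degProj_mul_self (i j : ℕ) : degProj G i j * degProj G i j = degProj G i j :=
  LinearMap.ext fun c => by
    change inc G i j (pr G i j (inc G i j (pr G i j c))) = inc G i j (pr G i j c)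
    rw [pr_inc]

omit [DecidableEq E] in
theorem degProj_mul_of_ne {i i' : ℕ} (h : i ≠ i') (j : ℕ) :
    degProj G i j * degProj G i' j = 0 :=
  LinearMap.ext fun c => by
    change inc G i j (pr G i j (inc G i' j (pr G i' j c))) = 0
    rw [pr_inc_of_ne G h, map_zero]

theorem diff_mul_degProj_succ (i j : ℕ) :
    diff G num j * degProj G (i + 1) j = degProj G i j * diff G num j :=
  LinearMap.ext fun c => (inc_diff G num (i + 1) j _).symm.trans
    (congrArg (inc G i j) (pr_diff G num i j c).symm)

theorem diff_mul_degProj_zero (j : ℕ) : diff G num j * degProj G 0 j = 0 :=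
  LinearMap.ext fun _ => diff_inc_zero G num j _

omit [DecidableEq E] in
theorem sum_degProj (j : ℕ) :
    ∑ i ∈ Finset.range (Fintype.card E + 1), degProj G i j = 1 :=
  LinearMap.ext fun c => by
    rw [LinearMap.sum_apply]
    exact sum_inc_pr G j c

omit [DecidableEq E] in
theorem rep_mul_degProj (i j : ℕ) (σ : Equiv.Perm V) :
    rep G j σ * degProj G i j = degProj G i j * rep G j σ :=
  LinearMap.ext fun c => (inc_rep G i j σ _).symm.trans
    (congrArg (inc G i j) (pr_rep G i j σ c).symm)

omit [DecidableEq E] in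
theorem sign_mul_degProj (i j : ℕ) :
    sign G j * degProj G i j = (-1 : ℂ) ^ i • degProj G i j :=
  LinearMap.ext fun _ => sign_inc G i j _

omit [DecidableEq E] in
theorem degProj_mul_sign (i j : ℕ) :
    degProj G i j * sign G j = (-1 : ℂ) ^ i • degProj G i j := by
  refine LinearMap.ext fun c => totalChain.ext fun F g => ?_
  change (inc G i j (pr G i j (sign G j c))).1 F g = (-1 : ℂ) ^ i • (inc G i j (pr G i j c)).1 F g
  rw [inc_pr_apply, inc_pr_apply, sign_apply]
  split_ifs with h
  · rw [h]
  · rw [smul_zero]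

/-- The equation `D * h * D = D` survives averaging over `𝔖_V`, because `D` is equivariant, and
restriction to the part of degree `+1`, because `D` has degree `-1`. A map of degree `+1`
anticommutes with the sign `(-1)^|F|`. -/
theorem exists_homogeneous_generalizedInverse (j : ℕ) :
    ∃ h : Module.End ℂ (G.totalChain j), diff G num j * h * diff G num j = diff G num j ∧
      (∀ σ, rep G j σ * h = h * rep G j σ) ∧
      (h * sign G j + sign G j * h : Module.End ℂ (G.totalChain j)) = 0 ∧
      (∀ i, degProj G (i + 1) j * h = h * degProj G i j) ∧ degProj G 0 j * h = 0 := by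
  set D : Module.End ℂ (G.totalChain j) := diff G num j with hD
  have hDρ : ∀ σ, D * rep G j σ = rep G j σ * D := fun σ => LinearMap.ext (diff_rep G num j σ)
  obtain ⟨h0, hh0⟩ : ∃ h0 : Module.End ℂ (G.totalChain j), D * h0 * D = D := by
    obtain ⟨h0, hh0⟩ := LinearMap.exists_generalizedInverse (diff G num j)
    exact ⟨h0, hh0⟩
  classical
  -- Maschke averaging of a linear generalized inverse.
  let h1 : Module.End ℂ (G.totalChain j) :=
    (Fintype.card (Equiv.Perm V) : ℂ)⁻¹ • ∑ σ : Equiv.Perm V, rep G j σ * h0 * rep G j σ⁻¹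
  have hh1 : D * h1 * D = D := by
    simp only [h1, mul_smul_comm, smul_mul_assoc, Finset.mul_sum, Finset.sum_mul]
    have : ∀ σ : Equiv.Perm V, D * (rep G j σ * h0 * rep G j σ⁻¹) * D = D := fun σ => by
      calc D * (rep G j σ * h0 * rep G j σ⁻¹) * D
          = (D * rep G j σ) * h0 * (rep G j σ⁻¹ * D) := by noncomm_ring
        _ = rep G j σ * (D * h0 * D) * rep G j σ⁻¹ := by
            rw [hDρ, ← hDρ σ⁻¹]; noncomm_ring
        _ = D * (rep G j σ * rep G j σ⁻¹) := by rw [hh0, ← hDρ, mul_assoc]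
        _ = D := by rw [← map_mul, mul_inv_cancel, map_one, mul_one]
    rw [Finset.sum_congr rfl fun σ _ => this σ, Finset.sum_const, Finset.card_univ]
    exact Representation.card_smul_inv_cancel (Equiv.Perm V) D
  have hρ1 : ∀ σ, rep G j σ * h1 = h1 * rep G j σ := fun σ => by
    simp only [h1, mul_smul_comm, smul_mul_assoc, Finset.mul_sum, Finset.sum_mul]
    congr 1
    refine Fintype.sum_equiv (Equiv.mulLeft σ) _ _ fun τ => ?_
    rw [Equiv.coe_mulLeft, mul_inv_rev, map_mul, map_mul, mul_assoc (rep G j σ * rep G j τ * h0),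
      mul_assoc (rep G j τ⁻¹), ← map_mul (rep G j) σ⁻¹ σ, inv_mul_cancel, map_one, mul_one]
    noncomm_ring
  -- The part of degree `+1`. No state has more than `Fintype.card E` edges, so this range is
  -- enough.
  refine ⟨∑ i ∈ Finset.range (Fintype.card E), degProj G (i + 1) j * h1 * degProj G i j,
    ?_, fun σ => ?_, ?_, fun i => ?_, ?_⟩
  · have : ∀ i, D * (degProj G (i + 1) j * h1 * degProj G i j) * D = D * degProj G (i + 1) j := by
      intro i
      have e : D * degProj G (i + 1) j = degProj G i j * D := diff_mul_degProj_succ G num i j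
      calc D * (degProj G (i + 1) j * h1 * degProj G i j) * D
          = (D * degProj G (i + 1) j) * h1 * (degProj G i j * D) := by noncomm_ring
        _ = degProj G i j * (D * h1 * D) * degProj G (i + 1) j := by
            rw [e, mul_assoc (degProj G i j), mul_assoc (degProj G i j), ← e]; noncomm_ring
        _ = D * degProj G (i + 1) j := by
            rw [hh1, ← e, mul_assoc, degProj_mul_self]
    rw [Finset.mul_sum, Finset.sum_mul, Finset.sum_congr rfl fun i _ => this i]
    -- The terms found above are `D * degProj G (i + 1) j`; they add up to `D` because degree `0`,
    -- the only one missing, is killed by `D`.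
    have h2 : D * (∑ i ∈ Finset.range (Fintype.card E + 1), degProj G i j) = D := by
      rw [sum_degProj, mul_one]
    rwa [Finset.sum_range_succ', mul_add, diff_mul_degProj_zero, add_zero, Finset.mul_sum] at h2
  · rw [Finset.mul_sum, Finset.sum_mul]
    refine Finset.sum_congr rfl fun i _ => ?_
    rw [← mul_assoc, ← mul_assoc, rep_mul_degProj, mul_assoc (degProj G (i + 1) j), hρ1,
      mul_assoc, mul_assoc, rep_mul_degProj]
    noncomm_ring
  · rw [Finset.mul_sum, Finset.sum_mul, ← Finset.sum_add_distrib]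
    refine Finset.sum_eq_zero fun i _ => ?_
    rw [← mul_assoc, ← mul_assoc, sign_mul_degProj, mul_assoc _ _ (sign G j), degProj_mul_sign,
      mul_smul_comm, smul_mul_assoc, smul_mul_assoc, pow_succ, mul_neg_one, ← add_smul,
      add_neg_cancel, zero_smul]
  · rw [Finset.mul_sum, Finset.sum_mul]
    refine Finset.sum_congr rfl fun k _ => ?_
    rw [← mul_assoc, ← mul_assoc, mul_assoc _ _ (degProj G i j)]
    by_cases h : i = k
    · rw [h, degProj_mul_self, degProj_mul_self]
    · rw [degProj_mul_of_ne G (by omega), degProj_mul_of_ne G (Ne.symm h)]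
      simp
  · rw [Finset.mul_sum]
    refine Finset.sum_eq_zero fun k _ => ?_
    rw [← mul_assoc, ← mul_assoc, degProj_mul_of_ne G (by omega)]
    simp

end totalChain

end

end MultiGraph

/-- Take `π = 1 - D * h - h * D`; then `D * h * D = D` and `D * D = 0` give `D * π = π * D = 0`. In
general `π` is not idempotent, since `h * D * h = h` is not assumed, but `π * π` is. It is the map
needed later, where `π` is used once to embed homology and once to retract onto it. -/
theorem exists_homotopy_to_idempotent {A : Type*} [Ring A] (D h S : A) (e : ℕ → A)
    (hDD : D * D = 0) (hDhD : D * h * D = D) (hDS : D * S + S * D = 0) (hhS : h * S + S * h = 0)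
    (hDe : ∀ i, D * e (i + 1) = e i * D) (hDe0 : D * e 0 = 0)
    (he : ∀ i, e (i + 1) * h = h * e i) (he0 : e 0 * h = 0) :
    ∃ π k : A, D * π = 0 ∧ π * D = 0 ∧
      (∀ x, x * D = D * x → x * h = h * x → x * π = π * x ∧ x * k = k * x) ∧
      π * S = S * π ∧ k * S + S * k = 0 ∧ (∀ i, π * e i = e i * π) ∧
      D * k + k * D + π * π = 1 := by
  obtain ⟨π, hπ⟩ : ∃ π : A, π = 1 - D * h - h * D := ⟨_, rfl⟩
  have hDπ : D * π = 0 := by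
    have : D * π = D - (D * D) * h - D * h * D := by rw [hπ]; noncomm_ring
    rw [this, hDD, hDhD, zero_mul, sub_zero, sub_self]
  have hπD : π * D = 0 := by
    have : π * D = D - D * h * D - h * (D * D) := by rw [hπ]; noncomm_ring
    rw [this, hDD, hDhD, mul_zero, sub_zero, sub_self]
  have hπρ : ∀ x, x * D = D * x → x * h = h * x → x * π = π * x := fun x hD hh => by
    have h1 : x * (D * h) = D * h * x := by rw [← mul_assoc, hD, mul_assoc, hh, mul_assoc]
    have h2 : x * (h * D) = h * D * x := by rw [← mul_assoc, hh, mul_assoc, hD, mul_assoc]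
    rw [hπ, mul_sub, mul_sub, sub_mul, sub_mul, h1, h2, mul_one, one_mul]
  have hDS' : D * S = -(S * D) := eq_neg_of_add_eq_zero_left hDS
  have hhS' : h * S = -(S * h) := eq_neg_of_add_eq_zero_left hhS
  have hπS : π * S = S * π := by
    have h1 : D * h * S = S * (D * h) := by
      rw [mul_assoc, hhS', mul_neg, ← mul_assoc, hDS', neg_mul, neg_neg, mul_assoc]
    have h2 : h * D * S = S * (h * D) := by
      rw [mul_assoc, hDS', mul_neg, ← mul_assoc, hhS', neg_mul, neg_neg, mul_assoc]
    rw [hπ, mul_sub, mul_sub, sub_mul, sub_mul, h1, h2, mul_one, one_mul]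
  -- The factor `1 + π` turns the homotopy from `1` to `π` into one from `1` to `π * π`, as `(1 - π)
  -- * (1 + π) = 1 - π * π`.
  refine ⟨π, h * (1 + π), hDπ, hπD, fun x hD hh => ⟨hπρ x hD hh, ?_⟩, hπS, ?_, fun i => ?_, ?_⟩
  · rw [← mul_assoc, hh, mul_assoc, mul_assoc, mul_add, add_mul, hπρ x hD hh, mul_one, one_mul]
  · have h1 : h * (1 + π) * S = h * S + h * (π * S) := by noncomm_ring
    rw [h1, hπS, ← mul_assoc, hhS']
    noncomm_ring
  · have h1 : D * h * e i = e i * (D * h) := by rw [mul_assoc, ← he, ← mul_assoc, hDe, mul_assoc]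
    have h2 : h * D * e i = e i * (h * D) := by
      cases i with
      | zero => rw [mul_assoc, hDe0, mul_zero, ← mul_assoc, he0, zero_mul]
      | succ i => rw [mul_assoc, hDe, ← mul_assoc, ← he, mul_assoc]
    rw [hπ, mul_sub, mul_sub, sub_mul, sub_mul, h1, h2, mul_one, one_mul]
  · have h1 : D * (h * (1 + π)) + h * (1 + π) * D
        = (D * h + h * D) * (1 + π) + h * (π * D) - h * (D * π) := by noncomm_ring
    have h2 : D * h + h * D = 1 - π := by rw [hπ]; noncomm_ring
    rw [h1, h2, hπD, hDπ]
    noncomm_ring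

namespace MultiGraph

noncomputable section

universe u v

variable {V : Type u} {E : Type v} (G : MultiGraph V E) [Fintype V] [DecidableEq E] [Fintype E]
  (num : E ≃ Fin (Fintype.card E))

open totalChain

/-- Since `π` kills boundaries, it embeds homology classes as honest chains; since its values are
cycles, it also retracts chains to homology. The composite of retraction and embedding is `π * π` in
one degree, which explains the choice of `proj`. -/
theorem nonempty_contraction (j : ℕ) : Nonempty (G.Contraction num j) := by
  obtain ⟨h, hDhD, hρ, hs, he, he0⟩ := exists_homogeneous_generalizedInverse G num j
  set D : Module.End ℂ (G.totalChain j) := totalChain.diff G num j with hD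
  let S : Module.End ℂ (G.totalChain j) := sign G j
  have hDρ : ∀ σ, rep G j σ * D = D * rep G j σ :=
    fun σ => LinearMap.ext fun c => (diff_rep G num j σ c).symm
  obtain ⟨π, k, hDπ, hπD, hcomm, hπS, hkS, hπe, hhom⟩ := exists_homotopy_to_idempotent D h
    (sign G j) (degProj G · j) (LinearMap.ext (totalChain.diff_diff G num j)) hDhD
    (LinearMap.ext fun c => add_eq_zero_iff_eq_neg.2 (diff_sign G num j c)) hs
    (diff_mul_degProj_succ G num · j) (diff_mul_degProj_zero G num j) he he0
  have hπρ : ∀ σ, rep G j σ * π = π * rep G j σ := fun σ => (hcomm _ (hDρ σ) (hρ σ)).1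
  have hkρ : ∀ σ, rep G j σ * k = k * rep G j σ := fun σ => (hcomm _ (hDρ σ) (hρ σ)).2
  have hhom' : ∀ c, D (k c) + k (D c) + π (π c) = c := LinearMap.congr_fun hhom
  have hπinc : ∀ p (z : G.Chain p j), π (inc G p j z) = inc G p j (pr G p j (π (inc G p j z))) :=
    fun p z => by
      have := LinearMap.congr_fun (hπe p) (inc G p j z)
      have h1 : π (inc G p j (pr G p j (inc G p j z)))
        = inc G p j (pr G p j (π (inc G p j z))) := this
      rwa [pr_inc] at h1
  have hcyc : ∀ p c, pr G p j (π c) ∈ G.cycles num p j := fun p c => by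
    rw [LinearMap.mem_ker]
    apply inc_injective
    rw [inc_diff, map_zero]
    have h1 : inc G p j (pr G p j (π c)) = π (inc G p j (pr G p j c)) :=
      (LinearMap.congr_fun (hπe p) c).symm
    rw [h1]
    exact LinearMap.congr_fun hDπ _
  let I : ∀ p, G.Homology num p j →ₗ[ℂ] G.totalChain j := fun p =>
    Submodule.liftQ _ (π ∘ₗ inc G p j ∘ₗ (G.cycles num p j).subtype) (by
      rintro z ⟨y, hy⟩
      rw [LinearMap.mem_ker]
      change π (inc G p j z.1) = 0
      have hy' : G.diff num (p + 1) j y = z.1 := hy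
      rw [← hy']
      have h1 : inc G p j (G.diff num (p + 1) j y) = D (inc G (p + 1) j y) :=
        inc_diff G num (p + 1) j y
      rw [h1]
      exact LinearMap.congr_fun hπD _)
  let P : ∀ p, G.totalChain j →ₗ[ℂ] G.Homology num p j := fun p =>
    Submodule.mkQ _ ∘ₗ (pr G p j ∘ₗ π).codRestrict (G.cycles num p j) (hcyc p)
  refine ⟨⟨k, π * π, I, P, fun σ c => ?_, fun σ c => ?_, fun p σ x => ?_, fun p σ c => ?_,
    fun c => ?_, fun c => ?_, fun c => ?_, fun c => ?_, fun c => ?_, fun p x => ?_, fun p c => ?_,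
    fun p x => ?_, fun p p' hp x => ?_, fun p c => ?_, fun p x => ?_⟩⟩
  · exact (LinearMap.congr_fun (hkρ σ) c).symm
  · exact (congrArg π (LinearMap.congr_fun (hπρ σ) c).symm).trans
      (LinearMap.congr_fun (hπρ σ) (π c)).symm
  · obtain ⟨z, rfl⟩ := Submodule.mkQ_surjective _ x
    change π (inc G p j (G.chainRep p j σ z.1)) = rep G j σ (π (inc G p j z.1))
    rw [inc_rep]
    exact (LinearMap.congr_fun (hπρ σ) _).symm
  · refine congrArg (Submodule.mkQ _) (Subtype.ext ?_)
    change pr G p j (π (rep G j σ c)) = G.chainRep p j σ (pr G p j (π c))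
    rw [← pr_rep]
    exact congrArg _ (LinearMap.congr_fun (hπρ σ) c).symm
  · exact add_eq_zero_iff_eq_neg.1 (LinearMap.congr_fun hkS c)
  · exact (congrArg π (LinearMap.congr_fun hπS c)).trans (LinearMap.congr_fun hπS (π c))
  · exact eq_sub_of_add_eq (hhom' c)
  · exact LinearMap.congr_fun hDπ _
  · exact (congrArg π (LinearMap.congr_fun hπD c)).trans (map_zero π)
  · obtain ⟨z, rfl⟩ := Submodule.mkQ_surjective _ x
    exact LinearMap.congr_fun hDπ _
  · change Submodule.mkQ _ (⟨pr G p j (π (D c)), _⟩ : G.cycles num p j) = 0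
    rw [← map_zero (Submodule.mkQ _)]
    refine congrArg (Submodule.mkQ _) (Subtype.ext ?_)
    exact (congrArg (pr G p j) (LinearMap.congr_fun hπD c)).trans (map_zero _)
  · obtain ⟨z, rfl⟩ := Submodule.mkQ_surjective _ x
    -- For a cycle `z` the homotopy gives `z - π (π z) = D (k z)`, so both represent the same class.
    refine (Submodule.Quotient.eq _).2 ⟨-pr G (p + 1) j (k (inc G p j z.1)), ?_⟩
    change G.diff num (p + 1) j _ = pr G p j (π (π (inc G p j z.1))) - z.1
    have hz : D (inc G p j z.1) = 0 := by
      have h1 : D (inc G p j z.1) = inc G (p - 1) j (G.diff num p j z.1) :=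
        (inc_diff G num p j z.1).symm
      rw [h1, LinearMap.mem_ker.1 z.2, map_zero]
    have h3 : D (k (inc G p j z.1)) + k (D (inc G p j z.1))
      = inc G p j z.1 - π (π (inc G p j z.1)) := eq_sub_of_add_eq (hhom' _)
    rw [hz, map_zero, add_zero] at h3
    have h4 := pr_diff G num p j (k (inc G p j z.1))
    have h5 : pr G p j (D (k (inc G p j z.1))) = z.1 - pr G p j (π (π (inc G p j z.1))) := by
      rw [h3, map_sub, pr_inc]
    rw [map_neg, ← h4]
    exact (congrArg Neg.neg h5).trans (neg_sub _ _)
  · obtain ⟨z, rfl⟩ := Submodule.mkQ_surjective _ x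
    change Submodule.mkQ _ (⟨pr G p j (π (π (inc G p' j z.1))), _⟩ : G.cycles num p j) = 0
    rw [← map_zero (Submodule.mkQ _)]
    refine congrArg (Submodule.mkQ _) (Subtype.ext ?_)
    change pr G p j (π (π (inc G p' j z.1))) = 0
    rw [hπinc, hπinc, pr_inc_of_ne G hp]
  · change π (inc G p j (pr G p j (π c))) = π (π (inc G p j (pr G p j c)))
    exact congrArg π (LinearMap.congr_fun (hπe p) c).symm
  · obtain ⟨z, rfl⟩ := Submodule.mkQ_surjective _ x
    exact (hπinc p z.1).symm

end

end MultiGraph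

/-! ### States of a disjoint union -/

namespace MultiGraph

noncomputable section

universe u₁ u₂ v₁ v₂

variable {VA : Type u₁} {VB : Type u₂} {EA : Type v₁} {EB : Type v₂}
  (A : MultiGraph VA EA) (B : MultiGraph VB EB)

/-- A map of graphs carries paths to paths; an edge whose ends are identified becomes a trivial
step. -/
theorem sameComp_of_edges_hom {V W E E' : Type*} {G : MultiGraph V E} {H : MultiGraph W E'}
    {F : Finset E} {F' : Finset E'} (f : V → W) (φ : E → E') (hφ : ∀ e ∈ F, φ e ∈ F')
    (hf : ∀ e, H.ends (φ e) = (G.ends e).map f) {v w : V} (h : G.SameComp F v w) :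
    H.SameComp F' (f v) (f w) := by
  rw [SameComp, SimpleGraph.reachable_iff_reflTransGen] at h
  induction h with
  | refl => exact SameComp.refl H F' _
  | tail _ hbc ih =>
    refine ih.trans ?_
    rename_i b c _
    rw [SimpleGraph.fromEdgeSet_adj] at hbc
    obtain ⟨⟨e, he, hbc⟩, _⟩ := hbc
    by_cases hne : f b = f c
    · rw [hne]
      exact SameComp.refl H F' _
    · refine SimpleGraph.Adj.reachable ?_
      rw [SimpleGraph.fromEdgeSet_adj]
      exact ⟨⟨φ e, hφ e he, by rw [hf, hbc, Sym2.map_mk]⟩, hne⟩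

/-- Induction along a path: an edge at a vertex of `A` comes from `A`, so the path never leaves `A`.
-/
theorem exists_inl_of_sameComp {F : Finset (EA ⊕ EB)} {v : VA} {x : VA ⊕ VB}
    (h : (A.disjointUnion B).SameComp F (Sum.inl v) x) :
    ∃ w, x = Sum.inl w ∧ A.SameComp F.toLeft v w := by
  rw [SameComp, SimpleGraph.reachable_iff_reflTransGen] at h
  induction h with
  | refl => exact ⟨v, rfl, SameComp.refl A _ _⟩
  | tail _ hbc ih =>
    obtain ⟨b, rfl, hb⟩ := ih
    rename_i c _
    rw [SimpleGraph.fromEdgeSet_adj] at hbc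
    obtain ⟨⟨e, he, hbc⟩, hne⟩ := hbc
    rcases e with a | a
    · change (A.ends a).map Sum.inl = s(Sum.inl b, c) at hbc
      generalize hz : A.ends a = z at hbc
      induction z with | _ x y
      rw [Sym2.map_mk, Sym2.eq_iff] at hbc
      have key : ∀ d, A.ends a = s(b, d) → A.SameComp F.toLeft v d := by
        intro d hd
        refine hb.trans ?_
        by_cases hbd : b = d
        · rw [hbd]
          exact SameComp.refl A _ _
        · refine SimpleGraph.Adj.reachable ?_
          rw [SimpleGraph.fromEdgeSet_adj]
          exact ⟨⟨a, Finset.mem_coe.2 (Finset.mem_toLeft.2 he), hd⟩, hbd⟩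
      rcases hbc with ⟨h1, h2⟩ | ⟨h1, h2⟩
      · exact ⟨y, h2.symm, key y (by rw [hz, Sum.inl.inj h1])⟩
      · exact ⟨x, h1.symm, key x (by rw [hz, Sum.inl.inj h2, Sym2.eq_swap])⟩
    · change (B.ends a).map Sum.inr = s(Sum.inl b, c) at hbc
      generalize B.ends a = z at hbc
      induction z with | _ x y
      rw [Sym2.map_mk, Sym2.eq_iff] at hbc
      rcases hbc with ⟨h1, h2⟩ | ⟨h1, h2⟩ <;> simp at h1 h2

theorem exists_inr_of_sameComp {F : Finset (EA ⊕ EB)} {v : VB} {x : VA ⊕ VB}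
    (h : (A.disjointUnion B).SameComp F (Sum.inr v) x) :
    ∃ w, x = Sum.inr w ∧ B.SameComp F.toRight v w := by
  -- Exchanging the summands reduces this to the case of the first one.
  have h' : (B.disjointUnion A).SameComp (F.map (Equiv.sumComm EA EB).toEmbedding)
      (Sum.swap (Sum.inr v)) (Sum.swap x) := by
    refine sameComp_of_edges_hom Sum.swap Sum.swap (fun e he => ?_) (fun e => ?_) h
    · exact Finset.mem_map.2 ⟨e, he, rfl⟩
    · rcases e with e | e
      · change (A.ends e).map Sum.inr = ((A.ends e).map Sum.inl).map Sum.swap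
        rw [Sym2.map_map]
        rfl
      · change (B.ends e).map Sum.inl = ((B.ends e).map Sum.inr).map Sum.swap
        rw [Sym2.map_map]
        rfl
  obtain ⟨w, hw, hvw⟩ := exists_inl_of_sameComp B A h'
  refine ⟨w, ?_, ?_⟩
  · rw [← Sum.swap_swap x, hw]
    rfl
  · rwa [Finset.toLeft_map_sumComm] at hvw

theorem sameComp_inl_inl {F : Finset (EA ⊕ EB)} {v w : VA} :
    (A.disjointUnion B).SameComp F (Sum.inl v) (Sum.inl w) ↔ A.SameComp F.toLeft v w := by
  constructor
  · intro h
    obtain ⟨w', hw, h'⟩ := exists_inl_of_sameComp A B h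
    rwa [Sum.inl.inj hw]
  · exact sameComp_of_edges_hom Sum.inl Sum.inl (fun e he => Finset.mem_toLeft.1 he) fun e => rfl

theorem sameComp_inr_inr {F : Finset (EA ⊕ EB)} {v w : VB} :
    (A.disjointUnion B).SameComp F (Sum.inr v) (Sum.inr w) ↔ B.SameComp F.toRight v w := by
  constructor
  · intro h
    obtain ⟨w', hw, h'⟩ := exists_inr_of_sameComp A B h
    rwa [Sum.inr.inj hw]
  · exact sameComp_of_edges_hom Sum.inr Sum.inr (fun e he => Finset.mem_toRight.1 he) fun e => rfl

theorem not_sameComp_inl_inr {F : Finset (EA ⊕ EB)} {v : VA} {w : VB} :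
    ¬(A.disjointUnion B).SameComp F (Sum.inl v) (Sum.inr w) := by
  intro h
  obtain ⟨w', hw, h'⟩ := exists_inl_of_sameComp A B h
  simp at hw

theorem sumCongrHom_mem_young {F : Finset (EA ⊕ EB)} {k : Equiv.Perm VA × Equiv.Perm VB} :
    Equiv.Perm.sumCongrHom VA VB k ∈ (A.disjointUnion B).young F ↔
      k.1 ∈ A.young F.toLeft ∧ k.2 ∈ B.young F.toRight := by
  constructor
  · intro h
    exact ⟨fun v => (sameComp_inl_inl A B).1 (h (Sum.inl v)),
      fun v => (sameComp_inr_inr A B).1 (h (Sum.inr v))⟩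
  · rintro ⟨h1, h2⟩ (v | v)
    · exact (sameComp_inl_inl A B).2 (h1 v)
    · exact (sameComp_inr_inr A B).2 (h2 v)

/-- A permutation that preserves components preserves `V_A`. Hence the Young subgroup lies in
`𝔖_{V_A} × 𝔖_{V_B}`, as induction in stages requires. -/
theorem exists_of_mem_young [Finite VA] [Finite VB] {F : Finset (EA ⊕ EB)}
    {σ : Equiv.Perm (VA ⊕ VB)} (hσ : σ ∈ (A.disjointUnion B).young F) :
    ∃ k, Equiv.Perm.sumCongrHom VA VB k = σ := by
  refine Equiv.Perm.mem_sumCongrHom_range_of_perm_mapsTo_inl ?_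
  rintro _ ⟨v, rfl⟩
  obtain ⟨w, hw, _⟩ := exists_inl_of_sameComp A B (hσ (Sum.inl v))
  exact ⟨w, hw.symm⟩

variable [Fintype VA] [Fintype VB]

theorem comp_inl (F : Finset (EA ⊕ EB)) (v : VA) :
    (A.disjointUnion B).comp F (Sum.inl v) = (A.comp F.toLeft v).map .inl := by
  ext (x | x)
  · simp [mem_comp, sameComp_inl_inl]
  · simp [mem_comp, not_sameComp_inl_inr]

theorem comp_inr (F : Finset (EA ⊕ EB)) (v : VB) :
    (A.disjointUnion B).comp F (Sum.inr v) = (B.comp F.toRight v).map .inr := by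
  ext (x | x)
  · simp only [mem_comp, Finset.mem_map, Function.Embedding.inr_apply, reduceCtorEq, and_false,
      exists_false, iff_false]
    exact fun h => not_sameComp_inl_inr A B h.symm
  · simp [mem_comp, sameComp_inr_inr]

theorem mem_stdSpace_disjointUnion {F : Finset (EA ⊕ EB)} {x : VA → ℂ} {y : VB → ℂ} :
    Sum.elim x y ∈ (A.disjointUnion B).stdSpace F ↔
      x ∈ A.stdSpace F.toLeft ∧ y ∈ B.stdSpace F.toRight := by
  change (∀ v, ∑ w ∈ (A.disjointUnion B).comp F v, Sum.elim x y w = 0) ↔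
    (∀ v, ∑ w ∈ A.comp F.toLeft v, x w = 0) ∧ ∀ v, ∑ w ∈ B.comp F.toRight v, y w = 0
  simp [Sum.forall, comp_inl, comp_inr]

/-- Extension by zero from the first summand. -/
def stdInl (F : Finset (EA ⊕ EB)) : A.stdSpace F.toLeft →ₗ[ℂ] (A.disjointUnion B).stdSpace F where
  toFun x := ⟨Sum.elim x.1 0, (mem_stdSpace_disjointUnion A B).2 ⟨x.2, zero_mem _⟩⟩
  map_add' x y := by ext (v | v) <;> simp
  map_smul' a x := by ext (v | v) <;> simp

/-- Extension by zero from the second summand. -/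
def stdInr (F : Finset (EA ⊕ EB)) : B.stdSpace F.toRight →ₗ[ℂ] (A.disjointUnion B).stdSpace F where
  toFun x := ⟨Sum.elim 0 x.1, (mem_stdSpace_disjointUnion A B).2 ⟨zero_mem _, x.2⟩⟩
  map_add' x y := by ext (v | v) <;> simp
  map_smul' a x := by ext (v | v) <;> simp

theorem coprod_stdInl_stdInr_bijective (F : Finset (EA ⊕ EB)) :
    Function.Bijective ((stdInl A B F).coprod (stdInr A B F)) := by
  have key : ∀ x y, ((stdInl A B F).coprod (stdInr A B F) (x, y)).1 = Sum.elim x.1 y.1 := by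
    intro x y
    ext (v | v) <;> simp [stdInl, stdInr]
  constructor
  · rintro ⟨x, y⟩ ⟨x', y'⟩ h
    have h' := congrArg Subtype.val h
    rw [key, key] at h'
    refine Prod.ext (Subtype.ext ?_) (Subtype.ext ?_)
    · exact funext fun v => congrFun h' (Sum.inl v)
    · exact funext fun v => congrFun h' (Sum.inr v)
  · intro z
    have hz : Sum.elim (z.1 ∘ Sum.inl) (z.1 ∘ Sum.inr) = z.1 := Sum.elim_comp_inl_inr z.1
    have hz' := (mem_stdSpace_disjointUnion A B).1 (hz.symm ▸ z.2)
    exact ⟨(⟨_, hz'.1⟩, ⟨_, hz'.2⟩), Subtype.ext ((key _ _).trans hz)⟩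

/-- Each component lies in one half, so the means of an extension by zero are the means in `A`, and
zero on `B`. -/
theorem proj_stdInl (F F' : Finset (EA ⊕ EB)) :
    (A.disjointUnion B).proj F F' ∘ₗ stdInl A B F
      = stdInl A B F' ∘ₗ A.proj F.toLeft F'.toLeft := by
  refine LinearMap.ext fun x => Subtype.ext (funext fun v => ?_)
  change Sum.elim x.1 0 v - (((A.disjointUnion B).comp F' v).card : ℂ)⁻¹ *
    ∑ w ∈ (A.disjointUnion B).comp F' v, Sum.elim x.1 0 w
    = Sum.elim (fun v => x.1 v - ((A.comp F'.toLeft v).card : ℂ)⁻¹ *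
      ∑ w ∈ A.comp F'.toLeft v, x.1 w) 0 v
  rcases v with v | v
  · simp [comp_inl]
  · simp [comp_inr]

theorem proj_stdInr (F F' : Finset (EA ⊕ EB)) :
    (A.disjointUnion B).proj F F' ∘ₗ stdInr A B F
      = stdInr A B F' ∘ₗ B.proj F.toRight F'.toRight := by
  refine LinearMap.ext fun x => Subtype.ext (funext fun v => ?_)
  change Sum.elim (0 : VA → ℂ) x.1 v - (((A.disjointUnion B).comp F' v).card : ℂ)⁻¹ *
    ∑ w ∈ (A.disjointUnion B).comp F' v, Sum.elim (0 : VA → ℂ) x.1 w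
    = Sum.elim (0 : VA → ℂ) (fun v => x.1 v - ((B.comp F'.toRight v).card : ℂ)⁻¹ *
      ∑ w ∈ B.comp F'.toRight v, x.1 w) v
  rcases v with v | v
  · simp [comp_inl]
  · simp [comp_inr]

theorem stdRep_stdInl (F : Finset (EA ⊕ EB)) (s : A.young F.toLeft) (t : B.young F.toRight) :
    (A.disjointUnion B).stdRep F ⟨Equiv.Perm.sumCongrHom VA VB (s.1, t.1),
        (sumCongrHom_mem_young A B).2 ⟨s.2, t.2⟩⟩ ∘ₗ stdInl A B F
      = stdInl A B F ∘ₗ A.stdRep F.toLeft s := by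
  refine LinearMap.ext fun x => Subtype.ext (funext fun v => ?_)
  rcases v with v | v <;> rfl

theorem stdRep_stdInr (F : Finset (EA ⊕ EB)) (s : A.young F.toLeft) (t : B.young F.toRight) :
    (A.disjointUnion B).stdRep F ⟨Equiv.Perm.sumCongrHom VA VB (s.1, t.1),
        (sumCongrHom_mem_young A B).2 ⟨s.2, t.2⟩⟩ ∘ₗ stdInr A B F
      = stdInr A B F ∘ₗ B.stdRep F.toRight t := by
  refine LinearMap.ext fun x => Subtype.ext (funext fun v => ?_)
  rcases v with v | v <;> rfl

/-- The wedge product `⋀^q T_{F_A} ⊗ ⋀^s T_{F_B} → ⋀^j T_F` for a state `F = F_A ⊔ F_B` of the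
disjoint union, with `j = q + s`. -/
def stateWedge {q s j : ℕ} (h : q + s = j) (F : Finset (EA ⊕ EB)) :
    A.StatePow F.toLeft q ⊗[ℂ] B.StatePow F.toRight s →ₗ[ℂ] (A.disjointUnion B).StatePow F j :=
  wedge h (stdInl A B F) (stdInr A B F)

theorem statePowMap_stateWedge {q s j : ℕ} (h : q + s = j) (F F' : Finset (EA ⊕ EB))
    (t : A.StatePow F.toLeft q ⊗[ℂ] B.StatePow F.toRight s) :
    (A.disjointUnion B).statePowMap F F' j (stateWedge A B h F t)
      = stateWedge A B h F' (TensorProduct.map (A.statePowMap F.toLeft F'.toLeft q)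
          (B.statePowMap F.toRight F'.toRight s) t) := by
  refine (map_wedge h _ _ _ t).trans ?_
  rw [proj_stdInl, proj_stdInr]
  exact (wedge_map h _ _ _ _ t).symm

theorem statePowRep_stateWedge {q s j : ℕ} (h : q + s = j) (F : Finset (EA ⊕ EB))
    (k : A.young F.toLeft) (l : B.young F.toRight)
    (t : A.StatePow F.toLeft q ⊗[ℂ] B.StatePow F.toRight s) :
    (A.disjointUnion B).statePowRep F j ⟨Equiv.Perm.sumCongrHom VA VB (k.1, l.1),
        (sumCongrHom_mem_young A B).2 ⟨k.2, l.2⟩⟩ (stateWedge A B h F t)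
      = stateWedge A B h F (TensorProduct.map (A.statePowRep F.toLeft q k)
          (B.statePowRep F.toRight s l) t) := by
  refine (map_wedge h _ _ _ t).trans ?_
  rw [stdRep_stdInl, stdRep_stdInr]
  exact (wedge_map h _ _ _ _ t).symm

theorem sum_stateWedge_bijective (j : ℕ) (F : Finset (EA ⊕ EB)) :
    Function.Bijective (fun t : (∀ a : Splitting j,
        A.StatePow F.toLeft a.1.1 ⊗[ℂ] B.StatePow F.toRight a.1.2) =>
      ∑ a, stateWedge A B a.add_eq F (t a)) :=
  wedge_sum_bijective j _ _ (coprod_stdInl_stdInr_bijective A B F)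

theorem statePowMap_self {V E : Type*} [Fintype V] (G : MultiGraph V E) (F : Finset E) (j : ℕ) :
    G.statePowMap F F j = LinearMap.id := by
  have h : G.proj F F = LinearMap.id := LinearMap.ext fun x => G.meanFree_apply_of_mem F x
  exact (congrArg (exteriorPower.map j) h).trans exteriorPower.map_id

end

end MultiGraph

/-! ### The comparison map for chains: definition, equivariance and injectivity -/

namespace Representation

variable {G H X Y : Type*} [Group G] [Group H] [AddCommGroup X] [Module ℂ X] [AddCommGroup Y]
  [Module ℂ Y] (φ : G →* H) {ρ : Representation ℂ G X} {τ : Representation ℂ G Y}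

/-- Composition of equivariant functions with an equivariant linear map. -/
noncomputable def coindVMap (f : X →ₗ[ℂ] Y) (hf : ∀ k x, f (ρ k x) = τ k (f x)) :
    coindV φ ρ →ₗ[ℂ] coindV φ τ :=
  (f.compLeft H).restrict fun w hw k h => by
    change f (w (φ k * h)) = τ k (f (w h))
    rw [hw k h, hf]

open Classical in
theorem coindSingle_subtype_apply (S : Subgroup H) [Fintype S] (ρ : Representation ℂ S X)
    (h g : H) (x : X) : (coindSingle S.subtype ρ h x).1 g
      = if hg : g * h⁻¹ ∈ S then ρ ⟨g * h⁻¹, hg⟩ x else 0 := by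
  rw [coindSingle_apply]
  split_ifs with hg
  · rw [Finset.sum_eq_single ⟨g * h⁻¹, hg⟩, if_pos (by simp)]
    · intro s _ hs
      rw [if_neg]
      rintro rfl
      exact hs (Subtype.ext (by simp))
    · simp
  · refine Finset.sum_eq_zero fun s _ => if_neg ?_
    rintro rfl
    exact hg (by simp)

end Representation

namespace MultiGraph

noncomputable section

universe u₁ u₂ v₁ v₂

variable {VA : Type u₁} {VB : Type u₂} {EA : Type v₁} {EB : Type v₂}
  (A : MultiGraph VA EA) (B : MultiGraph VB EB) [Fintype VA] [Fintype VB]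

open totalChain Representation

/-- The tensor product of the total chain modules of two graphs. -/
def TensorChain (q s : ℕ) : Type (max u₁ u₂ v₁ v₂) := A.totalChain q ⊗[ℂ] B.totalChain s

instance (q s : ℕ) : AddCommGroup (TensorChain A B q s) :=
  inferInstanceAs (AddCommGroup (A.totalChain q ⊗[ℂ] B.totalChain s))

instance (q s : ℕ) : Module ℂ (TensorChain A B q s) :=
  inferInstanceAs (Module ℂ (A.totalChain q ⊗[ℂ] B.totalChain s))

variable {A B} in
/-- Pure tensors of families. -/
def TensorChain.tmul {q s : ℕ} (x : A.totalChain q) (y : B.totalChain s) : TensorChain A B q s :=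
  x ⊗ₜ[ℂ] y

variable {A B} in
theorem TensorChain.hom_ext {q s : ℕ} {X : Type*} [AddCommGroup X] [Module ℂ X]
    {f g : TensorChain A B q s →ₗ[ℂ] X}
    (h : ∀ x y, f (TensorChain.tmul x y) = g (TensorChain.tmul x y)) : f = g :=
  TensorProduct.ext' (M := A.totalChain q) (N := B.totalChain s) h

variable {A B} in
/-- Tensor products of linear maps on total chain modules. -/
def tensorMap {q s : ℕ} {X Y : Type*} [AddCommGroup X] [Module ℂ X] [AddCommGroup Y] [Module ℂ Y]
    (f : A.totalChain q →ₗ[ℂ] X) (g : B.totalChain s →ₗ[ℂ] Y) :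
    TensorChain A B q s →ₗ[ℂ] X ⊗[ℂ] Y :=
  TensorProduct.map f g

theorem map_tensorMap {q s : ℕ} {X Y X' Y' : Type*} [AddCommGroup X] [Module ℂ X]
    [AddCommGroup Y] [Module ℂ Y] [AddCommGroup X'] [Module ℂ X'] [AddCommGroup Y'] [Module ℂ Y']
    (f : A.totalChain q →ₗ[ℂ] X) (g : B.totalChain s →ₗ[ℂ] Y) (f' : X →ₗ[ℂ] X') (g' : Y →ₗ[ℂ] Y')
    (t : TensorChain A B q s) :
    TensorProduct.map f' g' (tensorMap f g t) = tensorMap (f' ∘ₗ f) (g' ∘ₗ g) t :=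
  LinearMap.congr_fun (TensorChain.hom_ext (f := TensorProduct.map f' g' ∘ₗ tensorMap f g)
    (g := tensorMap (f' ∘ₗ f) (g' ∘ₗ g)) fun _ _ => rfl) t

/-- The action of `𝔖_{V_A} × 𝔖_{V_B}` on the tensor product of the total chain modules. -/
def tensorRep (q s : ℕ) : Representation ℂ (Equiv.Perm VA × Equiv.Perm VB)
    (TensorChain A B q s) :=
  extTensorRep (totalChain.rep A q) (totalChain.rep B s)

/-- The module coinduced from the tensor product of the total chain modules. -/
def TensorCoind (q s : ℕ) : Type (max u₁ u₂ v₁ v₂) :=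
  coindV (Equiv.Perm.sumCongrHom VA VB) (tensorRep A B q s)

instance (q s : ℕ) : AddCommGroup (TensorCoind A B q s) :=
  inferInstanceAs (AddCommGroup (coindV (Equiv.Perm.sumCongrHom VA VB) (tensorRep A B q s)))

instance (q s : ℕ) : Module ℂ (TensorCoind A B q s) :=
  inferInstanceAs (Module ℂ (coindV (Equiv.Perm.sumCongrHom VA VB) (tensorRep A B q s)))

/-- The values of equivariant functions. -/
def tensorEval {q s : ℕ} (g : Equiv.Perm (VA ⊕ VB)) :
    TensorCoind A B q s →ₗ[ℂ] TensorChain A B q s :=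
  LinearMap.proj g ∘ₗ (coindV (Equiv.Perm.sumCongrHom VA VB) (tensorRep A B q s)).subtype

variable {A B} in
theorem TensorCoind.ext {q s : ℕ} {w w' : TensorCoind A B q s}
    (h : ∀ g, tensorEval A B g w = tensorEval A B g w') : w = w' :=
  Subtype.ext (funext h)

theorem tensorEval_mul {q s : ℕ} (k : Equiv.Perm VA × Equiv.Perm VB) (g : Equiv.Perm (VA ⊕ VB))
    (w : TensorCoind A B q s) :
    tensorEval A B (Equiv.Perm.sumCongrHom VA VB k * g) w
      = tensorRep A B q s k (tensorEval A B g w) :=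
  w.2 k g

/-- The action of `𝔖_{V_A ⊔ V_B}` on the module coinduced from the tensor product of the total
chain modules. -/
def tensorCoindRep (q s : ℕ) :
    Representation ℂ (Equiv.Perm (VA ⊕ VB)) (TensorCoind A B q s) :=
  coind (Equiv.Perm.sumCongrHom VA VB) (tensorRep A B q s)

theorem tensorRep_tmul {q s : ℕ} (k : Equiv.Perm VA × Equiv.Perm VB) (x : A.totalChain q)
    (y : B.totalChain s) : tensorRep A B q s k (TensorChain.tmul x y)
      = TensorChain.tmul (totalChain.rep A q k.1 x) (totalChain.rep B s k.2 y) := rfl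

theorem tensorMap_tensorRep {q s : ℕ} {X Y : Type*} [AddCommGroup X] [Module ℂ X]
    [AddCommGroup Y] [Module ℂ Y] (f : A.totalChain q →ₗ[ℂ] X) (g : B.totalChain s →ₗ[ℂ] Y)
    (k : Equiv.Perm VA × Equiv.Perm VB) (t : TensorChain A B q s) :
    tensorMap f g (tensorRep A B q s k t)
      = tensorMap (f ∘ₗ totalChain.rep A q k.1) (g ∘ₗ totalChain.rep B s k.2) t :=
  LinearMap.congr_fun (TensorChain.hom_ext (f := tensorMap f g ∘ₗ tensorRep A B q s k)
    (g := tensorMap (f ∘ₗ totalChain.rep A q k.1) (g ∘ₗ totalChain.rep B s k.2)) fun _ _ => rfl) t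

theorem totalChain.eval_young_mul {V E : Type*} [Fintype V] (G : MultiGraph V E) (j : ℕ)
    (F : Finset E) (s : G.young F) (g : Equiv.Perm V) :
    eval G j F (s.1 * g) = G.statePowRep F j s ∘ₗ eval G j F g :=
  LinearMap.ext fun c => c.2 F s g

/-- The wedge product of the values at the states `F_A` and `F_B` and the identity permutations,
for a state `F = F_A ⊔ F_B` of the disjoint union. -/
def evalWedge {q s j : ℕ} (h : q + s = j) (F : Finset (EA ⊕ EB)) :
    TensorChain A B q s →ₗ[ℂ] (A.disjointUnion B).StatePow F j :=
  stateWedge A B h F ∘ₗ tensorMap (eval A q F.toLeft 1) (eval B s F.toRight 1)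

theorem evalWedge_tmul {q s j : ℕ} (h : q + s = j) (F : Finset (EA ⊕ EB)) (x : A.totalChain q)
    (y : B.totalChain s) : evalWedge A B h F (TensorChain.tmul x y)
      = stateWedge A B h F (x.1 F.toLeft 1 ⊗ₜ y.1 F.toRight 1) := rfl

/-- Acting by `k` moves the evaluation points from the identities to `k.1` and `k.2`. So evaluation
at the identities, applied to all translates, loses no information. -/
theorem evalWedge_tensorRep {q s j : ℕ} (h : q + s = j) (F : Finset (EA ⊕ EB))
    (k : Equiv.Perm VA × Equiv.Perm VB) (t : TensorChain A B q s) :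
    evalWedge A B h F (tensorRep A B q s k t) = stateWedge A B h F
      (tensorMap (eval A q F.toLeft k.1) (eval B s F.toRight k.2) t) := by
  rw [evalWedge, LinearMap.comp_apply, tensorMap_tensorRep, eval_rep, eval_rep, one_mul, one_mul]

theorem evalWedge_tensorRep_young {q s j : ℕ} (h : q + s = j) (F : Finset (EA ⊕ EB))
    (k : Equiv.Perm VA × Equiv.Perm VB)
    (hk : Equiv.Perm.sumCongrHom VA VB k ∈ (A.disjointUnion B).young F)
    (t : TensorChain A B q s) :
    evalWedge A B h F (tensorRep A B q s k t)
      = (A.disjointUnion B).statePowRep F j ⟨_, hk⟩ (evalWedge A B h F t) := by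
  have hk' := (sumCongrHom_mem_young A B).1 hk
  have hA := totalChain.eval_young_mul A q F.toLeft ⟨k.1, hk'.1⟩ 1
  have hB := totalChain.eval_young_mul B s F.toRight ⟨k.2, hk'.2⟩ 1
  rw [mul_one] at hA hB
  rw [evalWedge_tensorRep, hA, hB, ← map_tensorMap, evalWedge, LinearMap.comp_apply]
  exact (statePowRep_stateWedge A B h F ⟨k.1, hk'.1⟩ ⟨k.2, hk'.2⟩ _).symm

theorem sum_evalWedge_mem (j : ℕ) (w : ∀ a : Splitting j, TensorCoind A B a.1.1 a.1.2)
    (F : Finset (EA ⊕ EB)) :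
    (fun g => ∑ a : Splitting j, evalWedge A B a.add_eq F (tensorEval A B g (w a)))
      ∈ (A.disjointUnion B).stateCoind F j := by
  intro s g
  obtain ⟨k, hk⟩ := exists_of_mem_young A B s.2
  have hk' : Equiv.Perm.sumCongrHom VA VB k ∈ (A.disjointUnion B).young F := hk ▸ s.2
  obtain rfl : s = ⟨_, hk'⟩ := Subtype.ext hk.symm
  rw [map_sum]
  refine Finset.sum_congr rfl fun a _ => ?_
  rw [← evalWedge_tensorRep_young]
  exact congrArg (evalWedge A B a.add_eq F) (tensorEval_mul A B k g (w a))

variable (η : Finset (EA ⊕ EB) → ℂ)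

/-- The comparison map from the coinduced tensor products of the total chain modules of two graphs
to the total chain module of their disjoint union, with a sign (or scalar) for every state. -/
def assemble (j : ℕ) :
    (∀ a : Splitting j, TensorCoind A B a.1.1 a.1.2) →ₗ[ℂ] (A.disjointUnion B).totalChain j :=
  (LinearMap.pi fun F => η F • LinearMap.pi fun g => ∑ a : Splitting j,
    evalWedge A B a.add_eq F ∘ₗ tensorEval A B g ∘ₗ LinearMap.proj a).codRestrict _ (by
    intro w F
    refine Submodule.smul_mem _ _ ?_
    convert sum_evalWedge_mem A B j w F using 1
    funext g
    rw [LinearMap.pi_apply, LinearMap.sum_apply]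
    rfl)

theorem assemble_apply (j : ℕ) (w : ∀ a : Splitting j, TensorCoind A B a.1.1 a.1.2)
    (F : Finset (EA ⊕ EB)) (g : Equiv.Perm (VA ⊕ VB)) : (assemble A B η j w).1 F g
      = η F • ∑ a, evalWedge A B a.add_eq F (tensorEval A B g (w a)) :=
  congrArg (η F • ·) (LinearMap.sum_apply Finset.univ
    (fun a => evalWedge A B a.add_eq F ∘ₗ tensorEval A B g ∘ₗ LinearMap.proj a) w)

theorem assemble_rep (j : ℕ) (σ : Equiv.Perm (VA ⊕ VB))
    (w : ∀ a : Splitting j, TensorCoind A B a.1.1 a.1.2) :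
    assemble A B η j (fun a => tensorCoindRep A B a.1.1 a.1.2 σ (w a))
      = totalChain.rep (A.disjointUnion B) j σ (assemble A B η j w) := by
  ext1 F g
  rw [rep_apply, assemble_apply, assemble_apply]
  rfl

theorem eval_jointly_injective {V E : Type*} [Fintype V] (G : MultiGraph V E) (j : ℕ)
    (c : G.totalChain j) (h : ∀ p : Finset E × Equiv.Perm V, eval G j p.1 p.2 c = 0) : c = 0 :=
  totalChain.ext fun F g => h (F, g)

/-- The bijectivity of the wedge decomposition separates the bidegrees. In each bidegree,
translation recovers the values at all pairs of permutations, and these evaluations are jointly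
injective on the tensor product. -/
theorem assemble_injective [Fintype EA] [Fintype EB] (hη : ∀ F, η F ≠ 0) (j : ℕ) :
    Function.Injective (assemble A B η j) := by
  classical
  rw [injective_iff_map_eq_zero]
  intro w hw
  have h1 : ∀ (F : Finset (EA ⊕ EB)) g (a : Splitting j),
      tensorMap (eval A a.1.1 F.toLeft 1) (eval B a.1.2 F.toRight 1) (tensorEval A B g (w a))
        = 0 := by
    intro F g a
    have h2 : η F • ∑ a, evalWedge A B a.add_eq F (tensorEval A B g (w a)) = 0 := by
      rw [← assemble_apply, hw]
      rfl
    have h3 := (smul_eq_zero.1 h2).resolve_left (hη F)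
    have h4 := (sum_stateWedge_bijective A B j F).1
      (a₁ := fun a => tensorMap (eval A a.1.1 F.toLeft 1) (eval B a.1.2 F.toRight 1)
        (tensorEval A B g (w a))) (a₂ := 0) (by
      simp only [Pi.zero_apply, map_zero, Finset.sum_const_zero]
      exact h3)
    exact congrFun h4 a
  funext a
  refine TensorCoind.ext fun g => ?_
  rw [Pi.zero_apply, map_zero]
  refine TensorProduct.eq_zero_of_forall_map_eq_zero
    (fun p : Finset EA × Equiv.Perm VA => eval A a.1.1 p.1 p.2)
    (fun p : Finset EB × Equiv.Perm VB => eval B a.1.2 p.1 p.2)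
    (eval_jointly_injective A _) (eval_jointly_injective B _) _ ?_
  rintro ⟨FA, gA⟩ ⟨FB, gB⟩
  obtain ⟨F, rfl, rfl⟩ : ∃ F : Finset (EA ⊕ EB), F.toLeft = FA ∧ F.toRight = FB :=
    ⟨FA.disjSum FB, by simp, by simp⟩
  -- Equivariance turns a translate of the argument `g` into evaluation at `gA` and `gB`.
  have h2 := h1 F (Equiv.Perm.sumCongrHom VA VB (gA, gB) * g) a
  rwa [tensorEval_mul, tensorMap_tensorRep, eval_rep, eval_rep, one_mul, one_mul] at h2

end

end MultiGraph

/-! ### Surjectivity of the comparison map -/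

namespace MultiGraph

noncomputable section

universe u₁ u₂ v₁ v₂ u v

open totalChain Representation

namespace totalChain

variable {V : Type u} {E : Type v} (G : MultiGraph V E) [Fintype V] [DecidableEq E]

/-- The family supported at the state `F` and the Young subgroup that has a given value at the
identity permutation. -/
def delta (j : ℕ) (F : Finset E) [Fintype (G.young F)] (x : G.StatePow F j) : G.totalChain j :=
  single G j F (coindSingle (G.young F).subtype (G.statePowRep F j) 1 x)

theorem delta_of_mem {j : ℕ} {F : Finset E} [Fintype (G.young F)] (x : G.StatePow F j)
    {k : Equiv.Perm V} (hk : k ∈ G.young F) :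
    eval G j F k (delta G j F x) = G.statePowRep F j ⟨k, hk⟩ x := by
  rw [eval_apply, delta, single_same, coindSingle_subtype_apply, dif_pos (by simpa)]
  simp

theorem delta_of_notMem {j : ℕ} {F : Finset E} [Fintype (G.young F)] (x : G.StatePow F j)
    {k : Equiv.Perm V} (hk : k ∉ G.young F) : eval G j F k (delta G j F x) = 0 := by
  rw [eval_apply, delta, single_same, coindSingle_subtype_apply, dif_neg (by simpa)]

theorem delta_of_ne {j : ℕ} {F F' : Finset E} [Fintype (G.young F)] (h : F' ≠ F)
    (x : G.StatePow F j) (k : Equiv.Perm V) : eval G j F' k (delta G j F x) = 0 :=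
  single_of_ne G j h _ _

/-- Functions supported on one coset span all families: an equivariant function is the average of
the coset functions of its values. Surjectivity of `assemble` is tested on these. -/
theorem mem_of_single_coindSingle_mem [Fintype E] [∀ F, Fintype (G.young F)] {j : ℕ}
    {S : Submodule ℂ (G.totalChain j)} (hS : ∀ F g x,
      single G j F (coindSingle (G.young F).subtype (G.statePowRep F j) g x) ∈ S)
    (c : G.totalChain j) : c ∈ S := by
  classical
  have h1 : c = ∑ F, single G j F (component G j F c) := by
    ext1 F g
    rw [Submodule.coe_sum, Finset.sum_apply, Finset.sum_apply, Finset.sum_eq_single F]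
    · rw [single_same]
      rfl
    · intro F' _ h
      exact single_of_ne G j h.symm _ _
    · simp
  rw [h1]
  refine Submodule.sum_mem _ fun F _ => ?_
  rw [← indVToCoindV_coindVToIndV (G.young F).subtype (G.statePowRep F j) (component G j F c),
    coindVToIndV_apply, map_smul, map_sum, map_smul, map_sum]
  refine Submodule.smul_mem _ _ (Submodule.sum_mem _ fun g _ => ?_)
  rw [indVToCoindV_mk]
  exact hS F g _

end totalChain

variable {VA : Type u₁} {VB : Type u₂} {EA : Type v₁} {EB : Type v₂}
  (A : MultiGraph VA EA) (B : MultiGraph VB EB) [Fintype VA] [Fintype VB]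
  (η : Finset (EA ⊕ EB) → ℂ)

/-- The equivariant function supported on the coset of `h` that is determined by a vector. -/
def tensorCoindSingle [Fintype (Equiv.Perm VA × Equiv.Perm VB)] (q s : ℕ)
    (h : Equiv.Perm (VA ⊕ VB)) : TensorChain A B q s →ₗ[ℂ] TensorCoind A B q s :=
  coindSingle (Equiv.Perm.sumCongrHom VA VB) (tensorRep A B q s) h

open Classical in
theorem tensorEval_tensorCoindSingle [Fintype (Equiv.Perm VA × Equiv.Perm VB)] {q s : ℕ}
    (h g : Equiv.Perm (VA ⊕ VB)) (t : TensorChain A B q s) :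
    tensorEval A B g (tensorCoindSingle A B q s h t)
      = ∑ k, if Equiv.Perm.sumCongrHom VA VB k * h = g then tensorRep A B q s k t else 0 :=
  (coindSingle_apply (Equiv.Perm.sumCongrHom VA VB) (tensorRep A B q s) h g t).trans
    (Finset.sum_congr rfl fun k _ => by congr)

theorem assemble_single {j : ℕ} (a : Splitting j) (w : TensorCoind A B a.1.1 a.1.2)
    (F : Finset (EA ⊕ EB)) (g : Equiv.Perm (VA ⊕ VB)) :
    (assemble A B η j (Pi.single a w)).1 F g
      = η F • evalWedge A B a.add_eq F (tensorEval A B g w) := by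
  rw [assemble_apply, Finset.sum_eq_single a]
  · rw [Pi.single_eq_same]
  · intro b _ hb
    rw [Pi.single_eq_of_ne hb, map_zero, map_zero]
  · simp

variable [DecidableEq EA] [DecidableEq EB]

/-- The families `delta` vanish off the Young subgroups. So at `g` only a pair `k` in the Young
subgroup with `k * h = g` contributes; it exists exactly when `g * h⁻¹` lies there, and is unique
because `sumCongrHom` is injective. -/
theorem assemble_single_tensorCoindSingle [Fintype (Equiv.Perm VA × Equiv.Perm VB)]
    {j : ℕ} (a : Splitting j) (F : Finset (EA ⊕ EB))
    [Fintype (A.young F.toLeft)] [Fintype (B.young F.toRight)]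
    [Fintype ((A.disjointUnion B).young F)]
    (h : Equiv.Perm (VA ⊕ VB)) (x : A.StatePow F.toLeft a.1.1) (y : B.StatePow F.toRight a.1.2) :
    assemble A B η j (Pi.single a (tensorCoindSingle A B a.1.1 a.1.2 h
        (TensorChain.tmul (delta A a.1.1 F.toLeft x) (delta B a.1.2 F.toRight y))))
      = η F • single (A.disjointUnion B) j F (coindSingle ((A.disjointUnion B).young F).subtype
          ((A.disjointUnion B).statePowRep F j) h (stateWedge A B a.add_eq F (x ⊗ₜ y))) := by
  classical
  have key : ∀ (F' : Finset (EA ⊕ EB)) (k : Equiv.Perm VA × Equiv.Perm VB),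
      evalWedge A B a.add_eq F' (tensorRep A B a.1.1 a.1.2 k
        (TensorChain.tmul (delta A a.1.1 F.toLeft x) (delta B a.1.2 F.toRight y)))
      = stateWedge A B a.add_eq F' (eval A a.1.1 F'.toLeft k.1 (delta A a.1.1 F.toLeft x) ⊗ₜ
          eval B a.1.2 F'.toRight k.2 (delta B a.1.2 F.toRight y)) := fun F' k =>
    evalWedge_tensorRep A B a.add_eq F' k _
  ext1 F' g
  rw [assemble_single, tensorEval_tensorCoindSingle, map_sum]
  change _ = η F • (single (A.disjointUnion B) j F _).1 F' g
  by_cases hF : F' = F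
  · subst hF
    rw [single_same, coindSingle_subtype_apply]
    congr 1
    split_ifs with hg
    · obtain ⟨k, hk⟩ := exists_of_mem_young A B hg
      have hk' : Equiv.Perm.sumCongrHom VA VB k ∈ (A.disjointUnion B).young F' := hk ▸ hg
      have hk'' := (sumCongrHom_mem_young A B).1 hk'
      rw [Finset.sum_eq_single k]
      · rw [if_pos (by rw [hk]; group), key, delta_of_mem A x hk''.1, delta_of_mem B y hk''.2]
        have h1 : (⟨g * h⁻¹, hg⟩ : (A.disjointUnion B).young F') = ⟨_, hk'⟩ := Subtype.ext hk.symm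
        rw [h1]
        exact (statePowRep_stateWedge A B a.add_eq F' ⟨k.1, hk''.1⟩ ⟨k.2, hk''.2⟩ (x ⊗ₜ y)).symm
      · intro l _ hl
        rw [if_neg, map_zero]
        intro hl'
        refine hl (Equiv.Perm.sumCongrHom_injective ?_)
        rw [hk, ← hl']
        group
      · simp
    · refine Finset.sum_eq_zero fun k _ => ?_
      split_ifs with hk
      · rw [key]
        have h1 : ¬ (k.1 ∈ A.young F'.toLeft ∧ k.2 ∈ B.young F'.toRight) := by
          rw [← sumCongrHom_mem_young A B]
          intro h2
          refine hg ?_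
          rw [← hk]
          simpa using h2
        by_cases h2 : k.1 ∈ A.young F'.toLeft
        · rw [delta_of_notMem B y fun h3 => h1 ⟨h2, h3⟩, TensorProduct.tmul_zero, map_zero]
        · rw [delta_of_notMem A x h2, TensorProduct.zero_tmul, map_zero]
      · rw [map_zero]
  · rw [single_of_ne _ _ hF, smul_zero, Finset.sum_eq_zero, smul_zero]
    intro k _
    split_ifs
    · rw [key]
      by_cases h1 : F'.toLeft = F.toLeft
      · have h2 : F'.toRight ≠ F.toRight := fun h2 => hF (by
          rw [← Finset.toLeft_disjSum_toRight (u := F'), h1, h2, Finset.toLeft_disjSum_toRight])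
        rw [delta_of_ne B h2, TensorProduct.tmul_zero, map_zero]
      · rw [delta_of_ne A h1, TensorProduct.zero_tmul, map_zero]
    · rw [map_zero]

theorem assemble_surjective [Fintype EA] [Fintype EB] (hη : ∀ F, η F ≠ 0) (j : ℕ) :
    Function.Surjective (assemble A B η j) := by
  classical
  intro c
  refine mem_of_single_coindSingle_mem (A.disjointUnion B)
    (S := LinearMap.range (assemble A B η j)) (fun F g z => ?_) c
  obtain ⟨t, rfl⟩ := (sum_stateWedge_bijective A B j F).2 z
  rw [map_sum, map_sum]
  refine Submodule.sum_mem _ fun a _ => ?_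
  generalize t a = t
  induction t with
  | zero => simp only [map_zero, zero_mem]
  | add t t' ht ht' => simpa only [map_add] using add_mem ht ht'
  | tmul x y =>
    rw [← inv_smul_smul₀ (hη F) (single (A.disjointUnion B) j F _),
      ← assemble_single_tensorCoindSingle]
    exact Submodule.smul_mem _ _ (LinearMap.mem_range_self _ _)

end

end MultiGraph

/-! ### The tensor differential, its signs and its grading -/

namespace MultiGraph

noncomputable section

universe u₁ u₂ v₁ v₂ u v

open totalChain Representation

variable {VA : Type u₁} {VB : Type u₂} {EA : Type v₁} {EB : Type v₂}
  {A : MultiGraph VA EA} {B : MultiGraph VB EB} [Fintype VA] [Fintype VB]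

/-- The endomorphism of equivariant functions that is induced by an equivariant endomorphism. -/
def tensorCoindMap {q s : ℕ} (f : TensorChain A B q s →ₗ[ℂ] TensorChain A B q s)
    (hf : ∀ k t, f (tensorRep A B q s k t) = tensorRep A B q s k (f t)) :
    TensorCoind A B q s →ₗ[ℂ] TensorCoind A B q s :=
  coindVMap (Equiv.Perm.sumCongrHom VA VB) f hf

theorem tensorEval_tensorCoindMap {q s : ℕ} (f : TensorChain A B q s →ₗ[ℂ] TensorChain A B q s)
    (hf : ∀ k t, f (tensorRep A B q s k t) = tensorRep A B q s k (f t))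
    (g : Equiv.Perm (VA ⊕ VB)) (w : TensorCoind A B q s) :
    tensorEval A B g (tensorCoindMap f hf w) = f (tensorEval A B g w) := rfl

/-- Tensor products of endomorphisms of total chain modules. -/
def tensorEnd {q s : ℕ} (f : A.totalChain q →ₗ[ℂ] A.totalChain q)
    (g : B.totalChain s →ₗ[ℂ] B.totalChain s) :
    TensorChain A B q s →ₗ[ℂ] TensorChain A B q s :=
  TensorProduct.map f g

theorem tensorEnd_tmul {q s : ℕ} (f : A.totalChain q →ₗ[ℂ] A.totalChain q)
    (g : B.totalChain s →ₗ[ℂ] B.totalChain s) (x : A.totalChain q) (y : B.totalChain s) :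
    tensorEnd f g (TensorChain.tmul x y) = TensorChain.tmul (f x) (g y) := rfl

theorem tensorEnd_tensorRep {q s : ℕ} (f : A.totalChain q →ₗ[ℂ] A.totalChain q)
    (g : B.totalChain s →ₗ[ℂ] B.totalChain s)
    (hf : ∀ σ x, f (totalChain.rep A q σ x) = totalChain.rep A q σ (f x))
    (hg : ∀ σ y, g (totalChain.rep B s σ y) = totalChain.rep B s σ (g y)) (k)
    (t : TensorChain A B q s) :
    tensorEnd f g (tensorRep A B q s k t) = tensorRep A B q s k (tensorEnd f g t) :=
  LinearMap.congr_fun (TensorChain.hom_ext (f := tensorEnd f g ∘ₗ tensorRep A B q s k)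
    (g := tensorRep A B q s k ∘ₗ tensorEnd f g) fun x y => by
      rw [LinearMap.comp_apply, LinearMap.comp_apply, tensorRep_tmul, tensorEnd_tmul,
        tensorEnd_tmul, tensorRep_tmul, hf, hg]) t

theorem TensorChain.add_tmul {q s : ℕ} (x x' : A.totalChain q) (y : B.totalChain s) :
    TensorChain.tmul (x + x') y = TensorChain.tmul x y + TensorChain.tmul x' y :=
  TensorProduct.add_tmul x x' y

theorem TensorChain.tmul_add {q s : ℕ} (x : A.totalChain q) (y y' : B.totalChain s) :
    TensorChain.tmul x (y + y') = TensorChain.tmul x y + TensorChain.tmul x y' :=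
  TensorProduct.tmul_add x y y'

theorem TensorChain.neg_tmul {q s : ℕ} (x : A.totalChain q) (y : B.totalChain s) :
    TensorChain.tmul (-x) y = -TensorChain.tmul x y :=
  TensorProduct.neg_tmul x y

theorem TensorChain.tmul_zero {q s : ℕ} (x : A.totalChain q) :
    TensorChain.tmul x (0 : B.totalChain s) = 0 :=
  TensorProduct.tmul_zero _ x

theorem TensorChain.zero_tmul {q s : ℕ} (y : B.totalChain s) :
    TensorChain.tmul (0 : A.totalChain q) y = 0 :=
  TensorProduct.zero_tmul _ y

variable [Fintype EA] [Fintype EB] [DecidableEq EA] [DecidableEq EB]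
  (numA : EA ≃ Fin (Fintype.card EA)) (numB : EB ≃ Fin (Fintype.card EB))
  (num : EA ⊕ EB ≃ Fin (Fintype.card (EA ⊕ EB)))

/-- The signs of the per-edge maps in the tensor product of two total complexes. -/
def prodSign (F : Finset (EA ⊕ EB)) : EA ⊕ EB → ℂ :=
  Sum.elim (edgeSign numA F.toLeft) fun b => (-1) ^ F.toLeft.card * edgeSign numB F.toRight b

variable (A B) in
/-- The differential of the tensor product of two total complexes. -/
def tensorDiff (q s : ℕ) : TensorChain A B q s →ₗ[ℂ] TensorChain A B q s :=
  tensorEnd (totalChain.diff A numA q) LinearMap.id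
    + tensorEnd (totalChain.sign A q) (totalChain.diff B numB s)

theorem tensorDiff_tensorRep (q s : ℕ) (k) (t : TensorChain A B q s) :
    tensorDiff A B numA numB q s (tensorRep A B q s k t)
      = tensorRep A B q s k (tensorDiff A B numA numB q s t) := by
  rw [tensorDiff, LinearMap.add_apply, LinearMap.add_apply, map_add]
  congr 1
  · exact tensorEnd_tensorRep _ _ (diff_rep A numA q) (fun _ _ => rfl) k t
  · exact tensorEnd_tensorRep _ _ (sign_rep A q) (diff_rep B numB s) k t

theorem tensorDiff_tmul {q s : ℕ} (x : A.totalChain q) (y : B.totalChain s) :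
    tensorDiff A B numA numB q s (TensorChain.tmul x y)
      = TensorChain.tmul (totalChain.diff A numA q x) y
        + TensorChain.tmul (totalChain.sign A q x) (totalChain.diff B numB s y) := rfl

theorem sum_compl_sum {M : Type*} [AddCommMonoid M] (F : Finset (EA ⊕ EB)) (f : EA ⊕ EB → M) :
    ∑ e ∈ Fᶜ, f e = ∑ a ∈ F.toLeftᶜ, f (.inl a) + ∑ b ∈ F.toRightᶜ, f (.inr b) := by
  have h : Fᶜ = F.toLeftᶜ.disjSum F.toRightᶜ := by
    ext (x | x) <;> simp
  rw [h, Finset.sum_disjSum]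

/-- An edge missing from `F` lies in `A` or in `B`. Adding it leaves the state of the other graph
unchanged, so there the induced map is the identity, as in `d ⊗ 1` and `sign ⊗ d`. -/
theorem evalWedge_tensorDiff {q s j : ℕ} (h : q + s = j) (F : Finset (EA ⊕ EB))
    (t : TensorChain A B q s) :
    evalWedge A B h F (tensorDiff A B numA numB q s t)
      = ∑ e ∈ Fᶜ, prodSign numA numB (insert e F) e •
        (A.disjointUnion B).statePowMap (insert e F) F j (evalWedge A B h (insert e F) t) := by
  have key : evalWedge A B h F ∘ₗ tensorDiff A B numA numB q s
      = ∑ e ∈ Fᶜ, prodSign numA numB (insert e F) e •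
        ((A.disjointUnion B).statePowMap (insert e F) F j ∘ₗ evalWedge A B h (insert e F)) := by
    refine TensorChain.hom_ext fun x y => ?_
    rw [LinearMap.comp_apply, tensorDiff_tmul, map_add, evalWedge_tmul, evalWedge_tmul,
      LinearMap.sum_apply, sum_compl_sum, diff_apply, diff_apply, sign_apply,
      TensorProduct.sum_tmul, TensorProduct.tmul_sum, map_sum, map_sum]
    congr 1
    · refine Finset.sum_congr rfl fun a _ => ?_
      rw [LinearMap.smul_apply, LinearMap.comp_apply, evalWedge_tmul, statePowMap_stateWedge,
        TensorProduct.map_tmul, prodSign, Sum.elim_inl, Finset.toLeft_insert_inl,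
        Finset.toRight_insert_inl, statePowMap_self, LinearMap.id_apply, ← TensorProduct.smul_tmul',
        map_smul]
    · refine Finset.sum_congr rfl fun b _ => ?_
      rw [LinearMap.smul_apply, LinearMap.comp_apply, evalWedge_tmul, statePowMap_stateWedge,
        TensorProduct.map_tmul, prodSign, Sum.elim_inr, Finset.toLeft_insert_inr,
        Finset.toRight_insert_inr, statePowMap_self, LinearMap.id_apply, TensorProduct.tmul_smul,
        ← TensorProduct.smul_tmul', smul_smul, mul_comm, map_smul]
  rw [← LinearMap.comp_apply, key, LinearMap.sum_apply]
  rfl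

/-- For two edges of the same graph this is the anticommutation in that graph. For a mixed pair,
removing the edge of `A` flips the Koszul sign `(-1)^|F_A|` of the edge of `B`. -/
theorem prodSign_mul_prodSign_erase (F : Finset (EA ⊕ EB)) {e f : EA ⊕ EB} (he : e ∈ F)
    (hf : f ∈ F) (hef : e ≠ f) :
    prodSign numA numB F e * prodSign numA numB (F.erase e) f
      = -(prodSign numA numB F f * prodSign numA numB (F.erase f) e) := by
  have hl : ∀ a, (F.erase (Sum.inl a)).toLeft = F.toLeft.erase a := fun a => by ext; simp
  have hl' : ∀ a, (F.erase (Sum.inl a)).toRight = F.toRight := fun a => by ext; simp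
  have hr : ∀ b, (F.erase (Sum.inr b)).toRight = F.toRight.erase b := fun a => by ext; simp
  have hr' : ∀ b, (F.erase (Sum.inr b)).toLeft = F.toLeft := fun a => by ext; simp
  have hc : ∀ a, Sum.inl a ∈ F → (-1 : ℂ) ^ F.toLeft.card = -(-1) ^ (F.toLeft.erase a).card :=
    fun a ha => by
      rw [← Finset.card_erase_add_one (Finset.mem_toLeft.2 ha), pow_succ, mul_neg_one]
  rcases e with a | b <;> rcases f with a' | b' <;>
    simp only [prodSign, Sum.elim_inl, Sum.elim_inr, hl, hl', hr, hr']
  · exact edgeSign_anticomm numA _ (Finset.mem_toLeft.2 he) (Finset.mem_toLeft.2 hf)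
      (fun h => hef (congrArg _ h))
  · rw [hc a he]
    ring
  · rw [hc a' hf]
    ring
  · have h := edgeSign_anticomm numB _ (Finset.mem_toRight.2 he) (Finset.mem_toRight.2 hf)
      (fun h => hef (congrArg _ h))
    linear_combination (-1) ^ F.toLeft.card * (-1) ^ F.toLeft.card * h

theorem edgeSign_mul_self (F : Finset EA) (e : EA) :
    edgeSign numA F e * edgeSign numA F e = 1 := by
  rw [edgeSign, ← mul_pow]
  simp

theorem prodSign_mul_self (F : Finset (EA ⊕ EB)) (e : EA ⊕ EB) :
    prodSign numA numB F e * prodSign numA numB F e = 1 := by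
  rcases e with a | b
  · exact edgeSign_mul_self numA _ a
  · change (-1) ^ F.toLeft.card * edgeSign numB F.toRight b *
      ((-1) ^ F.toLeft.card * edgeSign numB F.toRight b) = 1
    rw [mul_mul_mul_comm, edgeSign_mul_self, ← mul_pow]
    simp

/-- The signs of the differential of the disjoint union differ from those of the tensor product of
the total complexes by a coboundary. -/
theorem exists_sign_comparison : ∃ η : Finset (EA ⊕ EB) → ℂ, (∀ F, η F ≠ 0) ∧
    ∀ F, ∀ e ∉ F, edgeSign num (insert e F) e * η (insert e F)
      = η F * prodSign numA numB (insert e F) e := by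
  -- Signs are their own inverses, so the product is the ratio of the two rules; the two minus signs
  -- of the anticommuting squares cancel.
  obtain ⟨η, h0, h1⟩ := exists_sign_potential
    (fun F e => edgeSign num F e * prodSign numA numB F e) (fun F e h => by
      have h2 : edgeSign num F e * edgeSign num F e * (prodSign numA numB F e *
          prodSign numA numB F e) = 0 := by
        rw [mul_mul_mul_comm, h, zero_mul]
      rw [edgeSign_mul_self, prodSign_mul_self] at h2
      simp at h2) (fun F e f he hf hef => by
      have h2 := edgeSign_anticomm num F he hf hef
      have h3 := prodSign_mul_prodSign_erase numA numB F he hf hef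
      rw [mul_mul_mul_comm, h2, h3]
      ring)
  refine ⟨η, h0, fun F e he => ?_⟩
  rw [h1 _ e (Finset.mem_insert_self e F), Finset.erase_insert he, ← mul_assoc, ← mul_assoc,
    edgeSign_mul_self, one_mul, mul_comm]

theorem diff_assemble {η : Finset (EA ⊕ EB) → ℂ}
    (hη : ∀ F, ∀ e ∉ F, edgeSign num (insert e F) e * η (insert e F)
      = η F * prodSign numA numB (insert e F) e) (j : ℕ)
    (w : ∀ a : Splitting j, TensorCoind A B a.1.1 a.1.2) :
    totalChain.diff (A.disjointUnion B) num j (assemble A B η j w)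
      = assemble A B η j fun a => tensorCoindMap (tensorDiff A B numA numB a.1.1 a.1.2)
          (tensorDiff_tensorRep numA numB a.1.1 a.1.2) (w a) := by
  ext1 F g
  simp only [diff_apply, assemble_apply, tensorEval_tensorCoindMap, evalWedge_tensorDiff]
  rw [Finset.sum_comm, Finset.smul_sum]
  refine Finset.sum_congr rfl fun e he => ?_
  rw [map_smul, smul_smul, hη F e (Finset.mem_compl.1 he), mul_smul, map_sum, Finset.smul_sum]

variable (A B) in
/-- The projection of the tensor product of two total complexes to the bidegree `(p, r)`. -/
def tensorDegProj (p r q s : ℕ) : TensorChain A B q s →ₗ[ℂ] TensorChain A B q s :=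
  tensorEnd (degProj A p q) (degProj B r s)

omit [DecidableEq EA] [DecidableEq EB] in
theorem tensorDegProj_tensorRep (p r q s : ℕ) (k) (t : TensorChain A B q s) :
    tensorDegProj A B p r q s (tensorRep A B q s k t)
      = tensorRep A B q s k (tensorDegProj A B p r q s t) :=
  tensorEnd_tensorRep _ _
    (fun σ x => (LinearMap.congr_fun (rep_mul_degProj A p q σ) x).symm)
    (fun σ x => (LinearMap.congr_fun (rep_mul_degProj B r s σ) x).symm) k t

omit [DecidableEq EA] [DecidableEq EB] in
theorem evalWedge_tensorDegProj {q s j : ℕ} (h : q + s = j) (p r : ℕ) (F : Finset (EA ⊕ EB))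
    (t : TensorChain A B q s) : evalWedge A B h F (tensorDegProj A B p r q s t)
      = if (F.toLeft.card, F.toRight.card) = (p, r) then evalWedge A B h F t else 0 := by
  have key : evalWedge A B h F ∘ₗ tensorDegProj A B p r q s
      = if (F.toLeft.card, F.toRight.card) = (p, r) then evalWedge A B h F else 0 := by
    refine TensorChain.hom_ext fun x y => ?_
    rw [LinearMap.comp_apply, tensorDegProj, tensorEnd_tmul, evalWedge_tmul, degProj_apply,
      degProj_apply, inc_pr_apply, inc_pr_apply]
    simp only [Prod.mk.injEq]
    by_cases h1 : F.toLeft.card = p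
    · by_cases h2 : F.toRight.card = r
      · rw [if_pos h1, if_pos h2, if_pos (by exact ⟨h1, h2⟩), evalWedge_tmul]
      · rw [if_neg h2, if_neg (show ¬(F.toLeft.card = p ∧ F.toRight.card = r) from fun h3 => h2 h3.2),
          TensorProduct.tmul_zero, map_zero]
        rfl
    · rw [if_neg h1, if_neg (show ¬(F.toLeft.card = p ∧ F.toRight.card = r) from fun h3 => h1 h3.1),
        TensorProduct.zero_tmul, map_zero]
      rfl
  rw [← LinearMap.comp_apply, key]
  split_ifs <;> rfl

-- `|F| = |F_A| + |F_B|`, so homological degree `i` collects the bidegrees of total degree `i`.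
omit [DecidableEq EA] [DecidableEq EB] in
theorem degProj_assemble (η : Finset (EA ⊕ EB) → ℂ) (i j : ℕ)
    (w : ∀ a : Splitting j, TensorCoind A B a.1.1 a.1.2) :
    degProj (A.disjointUnion B) i j (assemble A B η j w)
      = assemble A B η j fun a => ∑ x ∈ Finset.HasAntidiagonal.antidiagonal i,
          tensorCoindMap (tensorDegProj A B x.1 x.2 a.1.1 a.1.2)
            (tensorDegProj_tensorRep x.1 x.2 a.1.1 a.1.2) (w a) := by
  ext1 F g
  rw [degProj_apply, inc_pr_apply]
  have hm : (F.toLeft.card, F.toRight.card) ∈ Finset.HasAntidiagonal.antidiagonal i ↔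
      F.card = i := by
    rw [Finset.HasAntidiagonal.mem_antidiagonal, Finset.card_toLeft_add_card_toRight]
  simp only [assemble_apply, map_sum, tensorEval_tensorCoindMap, evalWedge_tensorDegProj,
    Prod.mk.eta, Finset.sum_ite_eq, hm]
  split_ifs
  · rfl
  · rw [Finset.sum_const_zero, smul_zero]

end

end MultiGraph

/-! ### Recognition of a direct sum of representations -/

namespace Representation

/-- A representation is isomorphic to a direct sum if it is spanned by the images of the summands
under equivariant maps that have an orthogonal family of left inverses. -/
theorem nonempty_equiv_directSum {G ι N : Type*} {M M' : ι → Type*} [Group G]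
    [∀ i, AddCommMonoid (M i)] [∀ i, Module ℂ (M i)] [∀ i, AddCommGroup (M' i)]
    [∀ i, Module ℂ (M' i)] [AddCommGroup N] [Module ℂ N] {ρ : ∀ i, Representation ℂ G (M i)}
    {ρ' : ∀ i, Representation ℂ G (M' i)} {τ : Representation ℂ G N}
    (e : ∀ i, (ρ i).Equiv (ρ' i)) (φ : ∀ i, M' i →ₗ[ℂ] N) (ψ : ∀ i, N →ₗ[ℂ] M' i)
    (hφ : ∀ i g x, φ i (ρ' i g x) = τ g (φ i x)) (hψ : ∀ i x, ψ i (φ i x) = x)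
    (hψ' : ∀ i k, i ≠ k → ∀ x, ψ i (φ k x) = 0)
    (h : ∀ S : Submodule ℂ N, (∀ i x, φ i x ∈ S) → ∀ z, z ∈ S) :
    Nonempty (τ.Equiv (directSum ρ)) := by
  classical
  let f : (⨁ i, M i) →ₗ[ℂ] N :=
    DirectSum.toModule ℂ ι N fun i => φ i ∘ₗ (e i).toLinearEquiv.toLinearMap
  have hf : ∀ i x, f (DirectSum.lof ℂ ι M i x) = φ i ((e i).toLinearEquiv x) := fun i x =>
    DirectSum.toModule_lof ℂ i x
  have hinj : Function.Injective f := by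
    intro y y' hy
    -- The left inverses recover every component, whence injectivity.
    have key : ∀ i, ψ i ∘ₗ f = (e i).toLinearEquiv.toLinearMap ∘ₗ DirectSum.component ℂ ι M i := by
      intro i
      refine DirectSum.linearMap_ext ℂ fun k => LinearMap.ext fun x => ?_
      change ψ i (f (DirectSum.lof ℂ ι M k x))
        = (e i).toLinearEquiv (DirectSum.component ℂ ι M i (DirectSum.lof ℂ ι M k x))
      rw [hf]
      by_cases hik : i = k
      · subst hik
        rw [hψ, DirectSum.component.lof_self]
      · rw [hψ' i k hik, DirectSum.component.of, dif_neg (Ne.symm hik), map_zero]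
    refine DirectSum.ext_component ℂ fun i => (e i).toLinearEquiv.injective ?_
    refine (LinearMap.congr_fun (key i) y).symm.trans
      (Eq.trans ?_ (LinearMap.congr_fun (key i) y'))
    rw [LinearMap.comp_apply, hy, LinearMap.comp_apply]
  have hsurj : Function.Surjective f := by
    refine h (LinearMap.range f) fun i x => ?_
    exact ⟨DirectSum.lof ℂ ι M i ((e i).toLinearEquiv.symm x), by
      rw [hf, LinearEquiv.apply_symm_apply]⟩
  refine ⟨Equiv.symm (.mk (LinearEquiv.ofBijective f ⟨hinj, hsurj⟩) fun g => ?_)⟩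
  refine DirectSum.linearMap_ext ℂ fun i => LinearMap.ext fun x => ?_
  change f (directSum ρ g (DirectSum.lof ℂ ι M i x)) = τ g (f (DirectSum.lof ℂ ι M i x))
  rw [directSum_apply, DirectSum.lmap_lof, hf, hf, ← hφ]
  exact congrArg (φ i) (LinearMap.congr_fun ((e i).isIntertwining' g) x)

end Representation

/-! ### The tensor product of two contractions -/

namespace MultiGraph

noncomputable section

universe u₁ u₂ v₁ v₂

open totalChain Representation

variable {VA : Type u₁} {VB : Type u₂} {EA : Type v₁} {EB : Type v₂}
  {A : MultiGraph VA EA} {B : MultiGraph VB EB} [Fintype VA] [Fintype VB]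
  [Fintype EA] [Fintype EB] [DecidableEq EA] [DecidableEq EB]
  {numA : EA ≃ Fin (Fintype.card EA)} {numB : EB ≃ Fin (Fintype.card EB)}
  {q s : ℕ} (CA : A.Contraction numA q) (CB : B.Contraction numB s)

/-- The contracting homotopy of the tensor product of two contractions. -/
def tensorHomotopy : TensorChain A B q s →ₗ[ℂ] TensorChain A B q s :=
  tensorEnd CA.h LinearMap.id + tensorEnd (totalChain.sign A q ∘ₗ CA.proj) CB.h

theorem tensorHomotopy_tmul (x : A.totalChain q) (y : B.totalChain s) :
    tensorHomotopy CA CB (TensorChain.tmul x y) = TensorChain.tmul (CA.h x) y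
      + TensorChain.tmul (totalChain.sign A q (CA.proj x)) (CB.h y) := rfl

theorem tensorHomotopy_tensorRep (k) (t : TensorChain A B q s) :
    tensorHomotopy CA CB (tensorRep A B q s k t)
      = tensorRep A B q s k (tensorHomotopy CA CB t) := by
  rw [tensorHomotopy, LinearMap.add_apply, LinearMap.add_apply, map_add]
  congr 1
  · exact tensorEnd_tensorRep _ _ CA.h_rep (fun _ _ => rfl) k t
  · refine tensorEnd_tensorRep _ _ (fun σ x => ?_) CB.h_rep k t
    rw [LinearMap.comp_apply, CA.proj_rep, sign_rep]
    rfl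

/-- With the Koszul signs the mixed terms cancel or vanish, leaving `(1 - proj) ⊗ 1 + proj ⊗ (1 -
proj) = 1 - proj ⊗ proj`. -/
theorem tensorDiff_tensorHomotopy (t : TensorChain A B q s) :
    tensorDiff A B numA numB q s (tensorHomotopy CA CB t)
      + tensorHomotopy CA CB (tensorDiff A B numA numB q s t)
      = t - tensorEnd CA.proj CB.proj t := by
  have key : tensorDiff A B numA numB q s ∘ₗ tensorHomotopy CA CB
      + tensorHomotopy CA CB ∘ₗ tensorDiff A B numA numB q s
      = LinearMap.id - tensorEnd CA.proj CB.proj := by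
    refine TensorChain.hom_ext fun x y => ?_
    have h1 := congrArg (TensorChain.tmul · y) (CA.diff_h x)
    have h2 := congrArg (TensorChain.tmul (CA.proj x)) (CB.diff_h y)
    simp only [sub_eq_add_neg, TensorChain.add_tmul, TensorChain.tmul_add,
      TensorChain.neg_tmul] at h1 h2
    have h3 : TensorChain.tmul (CA.proj x) (-CB.proj y)
        = -TensorChain.tmul (CA.proj x) (CB.proj y) :=
      TensorProduct.tmul_neg _ _
    rw [LinearMap.add_apply, LinearMap.comp_apply, LinearMap.comp_apply, LinearMap.sub_apply,
      LinearMap.id_apply, tensorHomotopy_tmul, tensorDiff_tmul, tensorEnd_tmul, map_add, map_add,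
      tensorDiff_tmul, tensorDiff_tmul, tensorHomotopy_tmul, tensorHomotopy_tmul, diff_sign,
      CA.diff_proj, CA.h_sign, CA.proj_diff, CA.proj_sign, sign_sign, map_zero, neg_zero,
      TensorChain.zero_tmul, TensorChain.neg_tmul]
    rw [h3] at h2
    rw [eq_add_neg_iff_add_eq, ← sub_eq_zero] at h1 h2
    rw [← sub_eq_zero]
    refine Eq.trans ?_ ((congrArg₂ (· + ·) h1 h2).trans (add_zero 0))
    abel
  exact LinearMap.congr_fun key t

variable (A B numA numB) in
/-- The external tensor product of homology modules. -/
def HomologyTensor (p q r s : ℕ) : Type (max u₁ u₂ v₁ v₂) :=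
  A.Homology numA p q ⊗[ℂ] B.Homology numB r s

instance (p r : ℕ) : AddCommGroup (HomologyTensor A B numA numB p q r s) :=
  inferInstanceAs (AddCommGroup (A.Homology numA p q ⊗[ℂ] B.Homology numB r s))

instance (p r : ℕ) : Module ℂ (HomologyTensor A B numA numB p q r s) :=
  inferInstanceAs (Module ℂ (A.Homology numA p q ⊗[ℂ] B.Homology numB r s))

variable (A B numA numB) in
/-- The action of `𝔖_{V_A} × 𝔖_{V_B}` on the external tensor product of homology modules. -/
def homologyTensorRep (p q r s : ℕ) : Representation ℂ (Equiv.Perm VA × Equiv.Perm VB)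
    (HomologyTensor A B numA numB p q r s) :=
  extTensorRep (A.homologyRep numA p q) (B.homologyRep numB r s)

theorem HomologyTensor.hom_ext {p r : ℕ} {X : Type*} [AddCommGroup X] [Module ℂ X]
    {f g : HomologyTensor A B numA numB p q r s →ₗ[ℂ] X}
    (h : ∀ (x : A.Homology numA p q) (y : B.Homology numB r s), f (x ⊗ₜ[ℂ] y : _ ⊗[ℂ] _)
      = g (x ⊗ₜ[ℂ] y : _ ⊗[ℂ] _)) : f = g :=
  TensorProduct.ext' (M := A.Homology numA p q) (N := B.Homology numB r s) h

/-- The inclusion of the tensor product of homology modules. -/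
def tensorIncl (p r : ℕ) : HomologyTensor A B numA numB p q r s →ₗ[ℂ] TensorChain A B q s :=
  TensorProduct.map (CA.incl p) (CB.incl r)

/-- The retraction to the tensor product of homology modules. -/
def tensorRetr (p r : ℕ) : TensorChain A B q s →ₗ[ℂ] HomologyTensor A B numA numB p q r s :=
  TensorProduct.map (CA.retr p) (CB.retr r)

theorem tensorIncl_rep (p r : ℕ) (k) (t : HomologyTensor A B numA numB p q r s) :
    tensorIncl CA CB p r (homologyTensorRep A B numA numB p q r s k t)
      = tensorRep A B q s k (tensorIncl CA CB p r t) := by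
  refine LinearMap.congr_fun (HomologyTensor.hom_ext
    (f := tensorIncl CA CB p r ∘ₗ homologyTensorRep A B numA numB p q r s k)
    (g := tensorRep A B q s k ∘ₗ tensorIncl CA CB p r) fun x y => ?_) t
  change TensorChain.tmul (CA.incl p (A.homologyRep numA p q k.1 x))
    (CB.incl r (B.homologyRep numB r s k.2 y)) = TensorChain.tmul
      (totalChain.rep A q k.1 (CA.incl p x)) (totalChain.rep B s k.2 (CB.incl r y))
  rw [CA.incl_rep, CB.incl_rep]

theorem tensorRetr_rep (p r : ℕ) (k) (t : TensorChain A B q s) :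
    tensorRetr CA CB p r (tensorRep A B q s k t)
      = homologyTensorRep A B numA numB p q r s k (tensorRetr CA CB p r t) := by
  refine LinearMap.congr_fun (TensorChain.hom_ext
    (f := tensorRetr CA CB p r ∘ₗ tensorRep A B q s k)
    (g := homologyTensorRep A B numA numB p q r s k ∘ₗ tensorRetr CA CB p r) fun x y => ?_) t
  change CA.retr p (totalChain.rep A q k.1 x) ⊗ₜ CB.retr r (totalChain.rep B s k.2 y)
    = A.homologyRep numA p q k.1 (CA.retr p x) ⊗ₜ B.homologyRep numB r s k.2 (CB.retr r y)
  rw [CA.retr_rep, CB.retr_rep]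

theorem tensorRetr_tensorIncl (p r : ℕ) (t : HomologyTensor A B numA numB p q r s) :
    tensorRetr CA CB p r (tensorIncl CA CB p r t) = t := by
  refine LinearMap.congr_fun (HomologyTensor.hom_ext
    (f := tensorRetr CA CB p r ∘ₗ tensorIncl CA CB p r) (g := LinearMap.id) fun x y => ?_) t
  change CA.retr p (CA.incl p x) ⊗ₜ CB.retr r (CB.incl r y) = x ⊗ₜ y
  rw [CA.retr_incl, CB.retr_incl]

theorem tensorRetr_tensorIncl_of_ne {p p' r r' : ℕ} (h : (p, r) ≠ (p', r'))
    (t : HomologyTensor A B numA numB p' q r' s) :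
    tensorRetr CA CB p r (tensorIncl CA CB p' r' t) = 0 := by
  refine LinearMap.congr_fun (HomologyTensor.hom_ext
    (f := tensorRetr CA CB p r ∘ₗ tensorIncl CA CB p' r') (g := 0) fun x y => ?_) t
  change CA.retr p (CA.incl p' x) ⊗ₜ CB.retr r (CB.incl r' y) = 0
  by_cases hp : p = p'
  · rw [CB.retr_incl_of_ne r r' fun hr => h (by rw [hp, hr])]
    exact TensorProduct.tmul_zero _ _
  · rw [CA.retr_incl_of_ne p p' hp]
    exact TensorProduct.zero_tmul _ _

theorem tensorRetr_tensorDiff (p r : ℕ) (t : TensorChain A B q s) :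
    tensorRetr CA CB p r (tensorDiff A B numA numB q s t) = 0 := by
  refine LinearMap.congr_fun (TensorChain.hom_ext
    (f := tensorRetr CA CB p r ∘ₗ tensorDiff A B numA numB q s) (g := 0) fun x y => ?_) t
  rw [LinearMap.comp_apply, tensorDiff_tmul, map_add]
  change CA.retr p (totalChain.diff A numA q x) ⊗ₜ CB.retr r y
    + CA.retr p (totalChain.sign A q x) ⊗ₜ CB.retr r (totalChain.diff B numB s y) = 0
  rw [CA.retr_diff, CB.retr_diff]
  exact (congrArg₂ (· + ·) (TensorProduct.zero_tmul _ _) (TensorProduct.tmul_zero _ _)).trans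
    (add_zero _)

theorem tensorDiff_tensorIncl (p r : ℕ) (t : HomologyTensor A B numA numB p q r s) :
    tensorDiff A B numA numB q s (tensorIncl CA CB p r t) = 0 := by
  refine LinearMap.congr_fun (HomologyTensor.hom_ext
    (f := tensorDiff A B numA numB q s ∘ₗ tensorIncl CA CB p r) (g := 0) fun x y => ?_) t
  change tensorDiff A B numA numB q s (TensorChain.tmul (CA.incl p x) (CB.incl r y)) = 0
  rw [tensorDiff_tmul, CA.diff_incl, CB.diff_incl, TensorChain.zero_tmul, TensorChain.tmul_zero,
    add_zero]

theorem tensorIncl_tensorRetr (p r : ℕ) (t : TensorChain A B q s) :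
    tensorIncl CA CB p r (tensorRetr CA CB p r t)
      = tensorEnd CA.proj CB.proj (tensorDegProj A B p r q s t) := by
  refine LinearMap.congr_fun (TensorChain.hom_ext
    (f := tensorIncl CA CB p r ∘ₗ tensorRetr CA CB p r)
    (g := tensorEnd CA.proj CB.proj ∘ₗ tensorDegProj A B p r q s) fun x y => ?_) t
  change TensorChain.tmul (CA.incl p (CA.retr p x)) (CB.incl r (CB.retr r y))
    = TensorChain.tmul (CA.proj (degProj A p q x)) (CB.proj (degProj B r s y))
  rw [CA.incl_retr, CB.incl_retr]
  rfl

theorem tensorDegProj_tensorIncl (p r p' r' : ℕ) (t : HomologyTensor A B numA numB p' q r' s) :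
    tensorDegProj A B p r q s (tensorIncl CA CB p' r' t)
      = if (p', r') = (p, r) then tensorIncl CA CB p' r' t else 0 := by
  have h : ∀ x y, tensorDegProj A B p r q s (TensorChain.tmul x y)
    = TensorChain.tmul (degProj A p q x) (degProj B r s y) := fun _ _ => rfl
  have hA : ∀ x, CA.incl p' x = degProj A p' q (CA.incl p' x) := fun x => (CA.inc_pr_incl p' x).symm
  have hB : ∀ y, CB.incl r' y = degProj B r' s (CB.incl r' y) := fun y => (CB.inc_pr_incl r' y).symm
  split_ifs with hp
  · obtain ⟨rfl, rfl⟩ := Prod.mk.inj hp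
    refine LinearMap.congr_fun (HomologyTensor.hom_ext
      (f := tensorDegProj A B p' r' q s ∘ₗ tensorIncl CA CB p' r')
      (g := tensorIncl CA CB p' r') fun x y => ?_) t
    change tensorDegProj A B p' r' q s (TensorChain.tmul (CA.incl p' x) (CB.incl r' y))
      = TensorChain.tmul (CA.incl p' x) (CB.incl r' y)
    rw [h, ← hA, ← hB]
  · refine LinearMap.congr_fun (HomologyTensor.hom_ext
      (f := tensorDegProj A B p r q s ∘ₗ tensorIncl CA CB p' r')
      (g := 0) fun x y => ?_) t
    change tensorDegProj A B p r q s (TensorChain.tmul (CA.incl p' x) (CB.incl r' y)) = 0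
    rw [h]
    by_cases hpp : p = p'
    · have hrr : r ≠ r' := fun hr => hp (by rw [hpp, hr])
      rw [hB]
      refine (congrArg (TensorChain.tmul _)
        (LinearMap.congr_fun (degProj_mul_of_ne B hrr s) _)).trans (TensorChain.tmul_zero _)
    · rw [hA]
      refine (congrArg (TensorChain.tmul · _)
        (LinearMap.congr_fun (degProj_mul_of_ne A hpp q) _)).trans (TensorChain.zero_tmul _)

end

end MultiGraph

/-! ### The Künneth maps and their left inverses -/

namespace MultiGraph

noncomputable section

universe u₁ u₂ v₁ v₂

open totalChain Representation

variable {VA : Type u₁} {VB : Type u₂} {EA : Type v₁} {EB : Type v₂}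
  {A : MultiGraph VA EA} {B : MultiGraph VB EB} [Fintype VA] [Fintype VB]
  [Fintype EA] [Fintype EB] [DecidableEq EA] [DecidableEq EB]
  {numA : EA ≃ Fin (Fintype.card EA)} {numB : EB ≃ Fin (Fintype.card EB)}
  {num : EA ⊕ EB ≃ Fin (Fintype.card (EA ⊕ EB))}

variable (A B numA numB) in
/-- The module coinduced from an external tensor product of homology modules. -/
abbrev HomologyCoind (p q r s : ℕ) : Type (max u₁ u₂ v₁ v₂) :=
  coindV (Equiv.Perm.sumCongrHom VA VB) (homologyTensorRep A B numA numB p q r s)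

section

variable {q s : ℕ} (CA : A.Contraction numA q) (CB : B.Contraction numB s)

/-- The coinduced inclusion of the tensor product of homology modules. -/
def coindIncl (p r : ℕ) : HomologyCoind A B numA numB p q r s →ₗ[ℂ] TensorCoind A B q s :=
  coindVMap (Equiv.Perm.sumCongrHom VA VB) (τ := tensorRep A B q s) (tensorIncl CA CB p r)
    (tensorIncl_rep CA CB p r)

/-- The coinduced retraction to the tensor product of homology modules. -/
def coindRetr (p r : ℕ) : TensorCoind A B q s →ₗ[ℂ] HomologyCoind A B numA numB p q r s :=
  coindVMap (Equiv.Perm.sumCongrHom VA VB) (ρ := tensorRep A B q s) (tensorRetr CA CB p r)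
    (tensorRetr_rep CA CB p r)

theorem tensorEval_coindIncl (p r : ℕ) (v : HomologyCoind A B numA numB p q r s)
    (g : Equiv.Perm (VA ⊕ VB)) :
    tensorEval A B g (coindIncl CA CB p r v) = tensorIncl CA CB p r (v.1 g) := rfl

theorem coindRetr_coindIncl (p r : ℕ) (v : HomologyCoind A B numA numB p q r s) :
    coindRetr CA CB p r (coindIncl CA CB p r v) = v :=
  Subtype.ext (funext fun g => tensorRetr_tensorIncl CA CB p r (v.1 g))

theorem coindRetr_coindIncl_of_ne {p r p' r' : ℕ} (h : (p, r) ≠ (p', r'))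
    (v : HomologyCoind A B numA numB p' q r' s) :
    coindRetr CA CB p r (coindIncl CA CB p' r' v) = 0 :=
  Subtype.ext (funext fun g => tensorRetr_tensorIncl_of_ne CA CB h (v.1 g))

theorem coindRetr_tensorDiff (p r : ℕ) (w : TensorCoind A B q s) :
    coindRetr CA CB p r (tensorCoindMap (tensorDiff A B numA numB q s)
      (tensorDiff_tensorRep numA numB q s) w) = 0 :=
  Subtype.ext (funext fun g => tensorRetr_tensorDiff CA CB p r (tensorEval A B g w))

theorem tensorDiff_coindIncl (p r : ℕ) (v : HomologyCoind A B numA numB p q r s) :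
    tensorCoindMap (tensorDiff A B numA numB q s) (tensorDiff_tensorRep numA numB q s)
      (coindIncl CA CB p r v) = 0 :=
  TensorCoind.ext fun g => (tensorDiff_tensorIncl CA CB p r (v.1 g)).trans
    (map_zero (tensorEval A B g)).symm

theorem sum_tensorDegProj_coindIncl {i p r : ℕ} (h : p + r = i)
    (v : HomologyCoind A B numA numB p q r s) :
    ∑ x ∈ Finset.HasAntidiagonal.antidiagonal i, tensorCoindMap (tensorDegProj A B x.1 x.2 q s)
      (tensorDegProj_tensorRep x.1 x.2 q s) (coindIncl CA CB p r v) = coindIncl CA CB p r v := by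
  refine TensorCoind.ext fun g => ?_
  simp only [map_sum, tensorEval_tensorCoindMap, tensorEval_coindIncl, tensorDegProj_tensorIncl,
    Prod.mk.eta, Finset.sum_ite_eq]
  rw [if_pos]
  rwa [Finset.HasAntidiagonal.mem_antidiagonal]

theorem tensorProj_tensorRep (k) (t : TensorChain A B q s) :
    tensorEnd CA.proj CB.proj (tensorRep A B q s k t)
      = tensorRep A B q s k (tensorEnd CA.proj CB.proj t) :=
  tensorEnd_tensorRep _ _ CA.proj_rep CB.proj_rep k t

theorem sum_coindIncl_coindRetr (i : ℕ) (w : TensorCoind A B q s) :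
    ∑ x ∈ Finset.HasAntidiagonal.antidiagonal i,
        coindIncl CA CB x.1 x.2 (coindRetr CA CB x.1 x.2 w)
      = tensorCoindMap (tensorEnd CA.proj CB.proj) (tensorProj_tensorRep CA CB)
        (∑ x ∈ Finset.HasAntidiagonal.antidiagonal i,
          tensorCoindMap (tensorDegProj A B x.1 x.2 q s)
            (tensorDegProj_tensorRep x.1 x.2 q s) w) := by
  rw [map_sum]
  refine Finset.sum_congr rfl fun x _ => TensorCoind.ext fun g => ?_
  exact tensorIncl_tensorRetr CA CB x.1 x.2 (tensorEval A B g w)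

theorem tensorCoindMap_tensorProj (w : TensorCoind A B q s) :
    tensorCoindMap (tensorEnd CA.proj CB.proj) (tensorProj_tensorRep CA CB) w
      = w - tensorCoindMap (tensorDiff A B numA numB q s) (tensorDiff_tensorRep numA numB q s)
          (tensorCoindMap (tensorHomotopy CA CB) (tensorHomotopy_tensorRep CA CB) w)
        - tensorCoindMap (tensorHomotopy CA CB) (tensorHomotopy_tensorRep CA CB)
          (tensorCoindMap (tensorDiff A B numA numB q s) (tensorDiff_tensorRep numA numB q s) w) := by
  refine TensorCoind.ext fun g => ?_
  simp only [map_sub, tensorEval_tensorCoindMap]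
  rw [sub_sub, tensorDiff_tensorHomotopy, sub_sub_cancel]

end

section

variable (CA : ∀ q, A.Contraction numA q) (CB : ∀ s, B.Contraction numB s) {j : ℕ}
  (CG : (A.disjointUnion B).Contraction num j) {η : Finset (EA ⊕ EB) → ℂ}

variable (η) in
/-- The map from a coinduced tensor product of homology modules of two graphs to the homology of
their disjoint union. -/
def kunnethMap (i : ℕ) (a : Splitting j) (p r : ℕ) :
    HomologyCoind A B numA numB p a.1.1 r a.1.2 →ₗ[ℂ] (A.disjointUnion B).Homology num i j :=
  CG.retr i ∘ₗ assemble A B η j ∘ₗ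
    LinearMap.single ℂ (fun a : Splitting j => TensorCoind A B a.1.1 a.1.2) a ∘ₗ
    coindIncl (CA a.1.1) (CB a.1.2) p r

theorem kunnethMap_apply (i : ℕ) (a : Splitting j) (p r : ℕ)
    (v : HomologyCoind A B numA numB p a.1.1 r a.1.2) : kunnethMap CA CB CG η i a p r v
      = CG.retr i (assemble A B η j (Pi.single a (coindIncl (CA a.1.1) (CB a.1.2) p r v))) := rfl

theorem kunnethMap_rep (i : ℕ) (a : Splitting j) (p r : ℕ) (σ : Equiv.Perm (VA ⊕ VB))
    (v : HomologyCoind A B numA numB p a.1.1 r a.1.2) :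
    kunnethMap CA CB CG η i a p r (coind (Equiv.Perm.sumCongrHom VA VB)
        (homologyTensorRep A B numA numB p a.1.1 r a.1.2) σ v)
      = (A.disjointUnion B).homologyRep num i j σ (kunnethMap CA CB CG η i a p r v) := by
  rw [kunnethMap_apply, kunnethMap_apply, ← CG.retr_rep, ← assemble_rep]
  congr 2
  funext b
  by_cases h : b = a
  · subst h
    rw [Pi.single_eq_same, Pi.single_eq_same]
    rfl
  · rw [Pi.single_eq_of_ne h, Pi.single_eq_of_ne h, map_zero]

variable (hη : ∀ F, η F ≠ 0)

variable (A B j) in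
/-- The comparison isomorphism. -/
def assembleEquiv :
    (∀ a : Splitting j, TensorCoind A B a.1.1 a.1.2) ≃ₗ[ℂ] (A.disjointUnion B).totalChain j :=
  LinearEquiv.ofBijective (assemble A B η j)
    ⟨assemble_injective A B η hη j, assemble_surjective A B η hη j⟩

/-- The map from the homology of the disjoint union of two graphs to a coinduced tensor product of
homology modules. -/
def kunnethInv (i : ℕ) (a : Splitting j) (p r : ℕ) :
    (A.disjointUnion B).Homology num i j →ₗ[ℂ] HomologyCoind A B numA numB p a.1.1 r a.1.2 :=
  coindRetr (CA a.1.1) (CB a.1.2) p r ∘ₗ LinearMap.proj a ∘ₗ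
    (assembleEquiv A B j hη).symm.toLinearMap ∘ₗ CG.incl i

variable (hd : ∀ F, ∀ e ∉ F, edgeSign num (insert e F) e * η (insert e F)
      = η F * prodSign numA numB (insert e F) e)

include hd

/-- Passing to homology of `A + B` and back changes an assembled cycle only by a boundary. Under
`assemble` this is a tensor boundary, which the retraction kills; so the composite is that of the
tensor contractions alone. -/
theorem kunnethInv_kunnethMap {i : ℕ} (a b : Splitting j) (p r p' r' : ℕ) (hpr : p' + r' = i)
    (v : HomologyCoind A B numA numB p' b.1.1 r' b.1.2) :
    kunnethInv CA CB CG hη i a p r (kunnethMap CA CB CG η i b p' r' v)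
      = coindRetr (CA a.1.1) (CB a.1.2) p r
        ((Pi.single b (coindIncl (CA b.1.1) (CB b.1.2) p' r' v) :
          ∀ a : Splitting j, TensorCoind A B a.1.1 a.1.2) a) := by
  set w : ∀ a : Splitting j, TensorCoind A B a.1.1 a.1.2 :=
    Pi.single b (coindIncl (CA b.1.1) (CB b.1.2) p' r' v) with hw
  have hdeg : degProj (A.disjointUnion B) i j (assemble A B η j w) = assemble A B η j w := by
    rw [degProj_assemble]
    congr 1
    funext c
    by_cases h : c = b
    · subst h
      rw [hw, Pi.single_eq_same, sum_tensorDegProj_coindIncl _ _ hpr]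
    · rw [hw, Pi.single_eq_of_ne h]
      exact Finset.sum_eq_zero fun x _ => map_zero _
  have hdiff : totalChain.diff (A.disjointUnion B) num j (assemble A B η j w) = 0 := by
    rw [diff_assemble numA numB num hd, ← map_zero (assemble A B η j)]
    congr 1
    funext c
    by_cases h : c = b
    · subst h
      rw [hw, Pi.single_eq_same, tensorDiff_coindIncl]
      rfl
    · rw [hw, Pi.single_eq_of_ne h, map_zero]
      rfl
  have h1 : CG.incl i (kunnethMap CA CB CG η i b p' r' v) = assemble A B η j w
      - totalChain.diff (A.disjointUnion B) num j (CG.h (assemble A B η j w)) := by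
    rw [kunnethMap_apply, CG.incl_retr, ← degProj_apply, hdeg]
    have h2 := CG.diff_h (assemble A B η j w)
    rw [hdiff, map_zero, add_zero] at h2
    rw [h2, sub_sub_cancel]
  -- The homotopy of `A + B` is unrelated to the tensor homotopy, but its value is assembled from
  -- some `w'`; this exhibits the correction as a tensor boundary.
  obtain ⟨w', hw'⟩ := assemble_surjective A B η hη j (CG.h (assemble A B η j w))
  rw [← hw', diff_assemble numA numB num hd, ← map_sub] at h1
  have h3 : (assembleEquiv A B j hη).symm (CG.incl i (kunnethMap CA CB CG η i b p' r' v))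
      = w - fun a => tensorCoindMap (tensorDiff A B numA numB a.1.1 a.1.2)
          (tensorDiff_tensorRep numA numB a.1.1 a.1.2) (w' a) :=
    (LinearEquiv.symm_apply_eq _).2 h1
  refine (congrArg (fun u : ∀ a : Splitting j, TensorCoind A B a.1.1 a.1.2 =>
    coindRetr (CA a.1.1) (CB a.1.2) p r (u a)) h3).trans ?_
  change coindRetr (CA a.1.1) (CB a.1.2) p r (w a - _) = _
  rw [map_sub, coindRetr_tensorDiff, sub_zero]

end

end

end MultiGraph

/-! ### Spanning by the Künneth summands, and the theorem -/

namespace MultiGraph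

noncomputable section

universe u₁ u₂ v₁ v₂

open totalChain Representation

variable {VA : Type u₁} {VB : Type u₂} {EA : Type v₁} {EB : Type v₂}
  {A : MultiGraph VA EA} {B : MultiGraph VB EB} [Fintype VA] [Fintype VB]
  [Fintype EA] [Fintype EB] [DecidableEq EA] [DecidableEq EB]
  {numA : EA ≃ Fin (Fintype.card EA)} {numB : EB ≃ Fin (Fintype.card EB)}
  {num : EA ⊕ EB ≃ Fin (Fintype.card (EA ⊕ EB))}
variable (A B numA numB) in
/-- The representation induced from an external tensor product of homology modules agrees with the
coinduced one. -/
def homologyIndEquiv [Fintype (Equiv.Perm VA × Equiv.Perm VB)]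
    [Fintype (Equiv.Perm (VA ⊕ VB))] (p q r s : ℕ) :
    (ind (Equiv.Perm.sumCongrHom VA VB)
      (extTensorRep (A.homologyRep numA p q) (B.homologyRep numB r s))).Equiv
    (coind (Equiv.Perm.sumCongrHom VA VB) (homologyTensorRep A B numA numB p q r s)) :=
  Representation.indEquivCoind (Equiv.Perm.sumCongrHom VA VB)
    (homologyTensorRep A B numA numB p q r s)

variable (CA : ∀ q, A.Contraction numA q) (CB : ∀ s, B.Contraction numB s) {j : ℕ}
  (CG : (A.disjointUnion B).Contraction num j) {η : Finset (EA ⊕ EB) → ℂ}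

theorem sum_kunnethMap (i : ℕ) (w u : ∀ a : Splitting j, TensorCoind A B a.1.1 a.1.2)
    (h : ∀ a : Splitting j, ∑ x ∈ Finset.HasAntidiagonal.antidiagonal i,
      coindIncl (CA a.1.1) (CB a.1.2) x.1 x.2 (coindRetr (CA a.1.1) (CB a.1.2) x.1 x.2 (w a))
        = u a) :
    ∑ a : Splitting j, ∑ x ∈ Finset.HasAntidiagonal.antidiagonal i,
      kunnethMap CA CB CG η i a x.1 x.2
        (coindRetr (CA a.1.1) (CB a.1.2) x.1 x.2 (w a))
      = CG.retr i (assemble A B η j u) := by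
  have h1 : ∀ a : Splitting j, ∑ x ∈ Finset.HasAntidiagonal.antidiagonal i,
      kunnethMap CA CB CG η i a x.1 x.2
        (coindRetr (CA a.1.1) (CB a.1.2) x.1 x.2 (w a))
      = CG.retr i (assemble A B η j (Pi.single a (u a))) := fun a => by
    rw [← h a]
    exact (map_sum (CG.retr i ∘ₗ assemble A B η j ∘ₗ
      LinearMap.single ℂ (fun a : Splitting j => TensorCoind A B a.1.1 a.1.2) a) _ _).symm
  rw [Finset.sum_congr rfl fun a _ => h1 a, ← map_sum, ← map_sum, Finset.univ_sum_single]

variable (hη : ∀ F, η F ≠ 0)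
variable (hd : ∀ F, ∀ e ∉ F, edgeSign num (insert e F) e * η (insert e F)
      = η F * prodSign numA numB (insert e F) e)

include hd

-- A class is represented by an assembled tensor cycle `w` of total degree `i`. Projecting `w` to
-- homology and embedding again changes it by a tensor boundary, which disappears in the homology of
-- `A + B`.
include hη in
theorem eq_sum_kunnethMap (i : ℕ) (z : (A.disjointUnion B).Homology num i j) :
    ∃ w : ∀ a : Splitting j, TensorCoind A B a.1.1 a.1.2,
      z = ∑ a : Splitting j, ∑ x ∈ Finset.HasAntidiagonal.antidiagonal i,
      kunnethMap CA CB CG η i a x.1 x.2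
        (coindRetr (CA a.1.1) (CB a.1.2) x.1 x.2 (w a)) := by
  obtain ⟨w, hw⟩ := assemble_surjective A B η hη j (CG.incl i z)
  refine ⟨w, ?_⟩
  have hdeg : (fun a : Splitting j => ∑ x ∈ Finset.HasAntidiagonal.antidiagonal i,
      tensorCoindMap (tensorDegProj A B x.1 x.2 a.1.1 a.1.2)
        (tensorDegProj_tensorRep x.1 x.2 a.1.1 a.1.2) (w a)) = w := by
    apply assemble_injective A B η hη j
    rw [← degProj_assemble, hw, degProj_apply, CG.inc_pr_incl]
  have hdiff : (fun a : Splitting j => tensorCoindMap (tensorDiff A B numA numB a.1.1 a.1.2)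
      (tensorDiff_tensorRep numA numB a.1.1 a.1.2) (w a)) = 0 := by
    apply assemble_injective A B η hη j
    rw [← diff_assemble numA numB num hd, hw, CG.diff_incl, map_zero]
  set w' : ∀ a : Splitting j, TensorCoind A B a.1.1 a.1.2 := fun a =>
    tensorCoindMap (tensorHomotopy (CA a.1.1) (CB a.1.2))
      (tensorHomotopy_tensorRep (CA a.1.1) (CB a.1.2)) (w a) with hw'
  have hsum : ∀ a : Splitting j, ∑ x ∈ Finset.HasAntidiagonal.antidiagonal i,
      coindIncl (CA a.1.1) (CB a.1.2) x.1 x.2 (coindRetr (CA a.1.1) (CB a.1.2) x.1 x.2 (w a))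
      = w a - tensorCoindMap (tensorDiff A B numA numB a.1.1 a.1.2)
        (tensorDiff_tensorRep numA numB a.1.1 a.1.2) (w' a) := fun a => by
    rw [sum_coindIncl_coindRetr, congrFun hdeg a, tensorCoindMap_tensorProj, congrFun hdiff a,
      Pi.zero_apply, map_zero, sub_zero]
  rw [sum_kunnethMap CA CB CG i w (w - fun a : Splitting j =>
        tensorCoindMap (tensorDiff A B numA numB a.1.1 a.1.2)
        (tensorDiff_tensorRep numA numB a.1.1 a.1.2) (w' a)) hsum, map_sub, map_sub,
    ← diff_assemble numA numB num hd, CG.retr_diff, sub_zero, hw, CG.retr_incl]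

theorem kunnethInv_kunnethMap_self {i p r : ℕ} (hpr : p + r = i) (a : Splitting j)
    (v : HomologyCoind A B numA numB p a.1.1 r a.1.2) :
    kunnethInv CA CB CG hη i a p r (kunnethMap CA CB CG η i a p r v) = v := by
  rw [kunnethInv_kunnethMap CA CB CG hη hd a a p r p r hpr, Pi.single_eq_same,
    coindRetr_coindIncl]

theorem kunnethInv_kunnethMap_of_ne {i p r p' r' : ℕ} (hpr : p' + r' = i) (a b : Splitting j)
    (h : a = b → (p, r) ≠ (p', r')) (v : HomologyCoind A B numA numB p' b.1.1 r' b.1.2) :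
    kunnethInv CA CB CG hη i a p r (kunnethMap CA CB CG η i b p' r' v) = 0 := by
  rw [kunnethInv_kunnethMap CA CB CG hη hd a b p r p' r' hpr]
  by_cases hab : a = b
  · subst hab
    rw [Pi.single_eq_same, coindRetr_coindIncl_of_ne _ _ (h rfl)]
  · rw [Pi.single_eq_of_ne hab, map_zero]

end

end MultiGraph

open MultiGraph in
theorem proposition3p3 {VA VB EA EB : Type*} [Fintype VA] [Fintype VB]
    [Fintype EA] [DecidableEq EA] [Fintype EB] [DecidableEq EB]
    (A : MultiGraph VA EA) (B : MultiGraph VB EB)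
    (numA : EA ≃ Fin (Fintype.card EA)) (numB : EB ≃ Fin (Fintype.card EB))
    (num : EA ⊕ EB ≃ Fin (Fintype.card (EA ⊕ EB))) (i j : ℕ) :
    Nonempty (Representation.Equiv
      ((A.disjointUnion B).homologyRep num i j)
      (Representation.directSum
        fun x : {x : (ℕ × ℕ) × (ℕ × ℕ) // x.1.1 + x.2.1 = i ∧ x.1.2 + x.2.2 = j} =>
          Representation.ind (Equiv.Perm.sumCongrHom VA VB)
            (extTensorRep (A.homologyRep numA x.1.1.1 x.1.1.2)
              (B.homologyRep numB x.1.2.1 x.1.2.2)))) := by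
  classical
  obtain ⟨η, hη, hd⟩ := exists_sign_comparison numA numB num
  have CA : ∀ q, A.Contraction numA q := fun q => (nonempty_contraction A numA q).some
  have CB : ∀ s, B.Contraction numB s := fun s => (nonempty_contraction B numB s).some
  have CG := (nonempty_contraction (A.disjointUnion B) num j).some
  let a : {x : (ℕ × ℕ) × (ℕ × ℕ) // x.1.1 + x.2.1 = i ∧ x.1.2 + x.2.2 = j} → Splitting j :=
    fun x => ⟨(x.1.1.2, x.1.2.2), Finset.HasAntidiagonal.mem_antidiagonal.2 x.2.2⟩
  have e : ∀ x : {x : (ℕ × ℕ) × (ℕ × ℕ) // x.1.1 + x.2.1 = i ∧ x.1.2 + x.2.2 = j},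
      (Representation.ind (Equiv.Perm.sumCongrHom VA VB)
        (extTensorRep (A.homologyRep numA x.1.1.1 x.1.1.2)
          (B.homologyRep numB x.1.2.1 x.1.2.2))).Equiv
        (Representation.coind (Equiv.Perm.sumCongrHom VA VB)
          (homologyTensorRep A B numA numB x.1.1.1 (a x).1.1 x.1.2.1 (a x).1.2)) := fun x =>
    homologyIndEquiv A B numA numB x.1.1.1 x.1.1.2 x.1.2.1 x.1.2.2
  refine Representation.nonempty_equiv_directSum e
    (fun x => kunnethMap CA CB CG η i (a x) x.1.1.1 x.1.2.1)
    (fun x => kunnethInv CA CB CG hη i (a x) x.1.1.1 x.1.2.1)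
    (fun x σ v => kunnethMap_rep CA CB CG i (a x) x.1.1.1 x.1.2.1 σ v)
    (fun x v => kunnethInv_kunnethMap_self CA CB CG hη hd x.2.1 (a x) v)
    (fun x y hxy v => kunnethInv_kunnethMap_of_ne CA CB CG hη hd y.2.1 (a x) (a y)
      (fun h h' => hxy ?_) v) (fun S hS z => ?_)
  -- The splitting determines `q, s` and the homological pair determines `p, r`, so distinct indices
  -- are separated by `kunnethInv`.
  · obtain ⟨⟨⟨p, q⟩, ⟨r, s⟩⟩, hx1, hx2⟩ := x
    obtain ⟨⟨⟨p', q'⟩, ⟨r', s'⟩⟩, hy1, hy2⟩ := y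
    obtain ⟨rfl, rfl⟩ := Prod.mk.inj h'
    obtain ⟨rfl, rfl⟩ := Prod.mk.inj (congrArg Subtype.val h)
    rfl
  · obtain ⟨w, hw⟩ := eq_sum_kunnethMap CA CB CG hη hd i z
    rw [hw]
    refine Submodule.sum_mem _ fun b _ => Submodule.sum_mem _ fun x hx => ?_
    replace hx := Finset.HasAntidiagonal.mem_antidiagonal.1 hx
    generalize coindRetr (CA b.1.1) (CB b.1.2) x.1 x.2 (w b) = v
    revert v hx
    generalize x.1 = p
    generalize x.2 = r
    intro hx v
    -- The splitting of `j` and the pair with sum `i` are repackaged as a single index of the direct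
    -- sum.
    obtain ⟨y, rfl, rfl, rfl⟩ : ∃ y : {x : (ℕ × ℕ) × (ℕ × ℕ) // x.1.1 + x.2.1 = i ∧
        x.1.2 + x.2.2 = j}, a y = b ∧ y.1.1.1 = p ∧ y.1.2.1 = r :=
      ⟨⟨((p, b.1.1), (r, b.1.2)), hx, b.add_eq⟩, rfl, rfl, rfl⟩
    exact hS y v
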